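/- For $\mu,\nu\in\mathbb R$, $\sigma\in\mathbb C$ put $a_{\mu,\nu,\sigma}=(1+\mu+\nu+\sigma)/2$, and for $\alpha,\beta\in\mathbb R$, $z\in\mathbb C$ put $\sigma_{\alpha,\beta}(z)=[(1+\alpha+\beta)^2+4z]^{1/2}$. Let $F={}_2F_1$, let $\psi=\Gamma'/\Gamma$, let $\gamma_E$ be Euler's constant, $(a)_n=a(a+1)\cdots(a+n-1)$, and $1/\Gamma(-n)=0$ for $n\in\mathbb N_0$. For $x\in(-1,1)$, $\beta\in(-1,1)$, with $\sigma=\sigma_{\alpha,\beta}(z)$, let $$y_{1,\alpha,\beta,-1}(z,x)=F\big(a_{\alpha,\beta,\sigma},a_{\alpha,\beta,-\sigma};1+\beta;\tfrac{1+x}2\big),$$ $$y_{2,\alpha,\beta,-1}(z,x)=(1+x)^{-\beta}F\big(a_{\alpha,-\beta,\sigma},a_{\alpha,-\beta,-\sigma};1-\beta;\tfrac{1+x}2\big)\quad(\beta\ne0),$$ and, for $\beta=0$, with $a=a_{\alpha,0,\sigma}$, $b=a_{\alpha,0,-\sigma}$, $\xi=\frac{1+x}2$, $$y_{2,\alpha,0,-1}(z,x)=F(a,b;1;\xi)\ln\xi+\sum_{n\ge1}\frac{(a)_n(b)_n}{(n!)^2}\big[\psi(a+n)-\psi(a)+\psi(b+n)-\psi(b)-2\psi(n+1)-2\gamma_E\big]\xi^n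 ,$$ where $(a)_n[\psi(a+n)-\psi(a)]$ is read as the polynomial $\frac{d}{da}(a)_n$, with which it agrees for $a\notin-\mathbb N_0$ (likewise for $b$). Generalized boundary values. Let $g^{[1]}(x)=(1-x)^{\alpha+1}(1+x)^{\beta+1}g'(x)$. At $x=-1$, for $\alpha\in\mathbb R$, $\beta\in(-1,1)$: * $\beta<0$: $\widetilde g(-1)=\lim_{x\downarrow-1}g(x)$ and $\widetilde g^{\,\prime}(-1)=\lim_{x\downarrow-1}g^{[1]}(x)$; * $\beta=0$: $\widetilde g(-1)=-2^{\alpha+1}\lim_{x\downarrow-1}g(x)/\ln\frac{1+x}2$ and $\widetilde g^{\,\prime}(-1)=\lim_{x\downarrow-1}\big[g(x)+\widetilde g(-1)2^{-\alpha-1}\ln\frac{1+x}2\big]$; * $\beta>0$: $\widetilde g(-1)=\beta2^{\alpha+1}\lim_{x\downarrow-1}(1+x)^\beta g(x)$ and $\widetilde g^{\,\prime}(-1)=\lim_{x\downarrow-1}\big[g(x)-\widetilde g(-1)2^{-\alpha-1}\beta^{-1}(1+x)^{-\beta}\big]$. At $x=1$, for $\alpha,\beta\in(-1,1)$: * $\alpha<0$: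 $\widetilde g(1)=\lim_{x\uparrow1}g(x)$ and $\widetilde g^{\,\prime}(1)=\lim_{x\uparrow1}g^{[1]}(x)$; * $\alpha=0$: $\widetilde g(1)=2^{\beta+1}\lim_{x\uparrow1}g(x)/\ln\frac{1-x}2$ and $\widetilde g^{\,\prime}(1)=\lim_{x\uparrow1}\big[g(x)-\widetilde g(1)2^{-\beta-1}\ln\frac{1-x}2\big]$; * $\alpha>0$: $\widetilde g(1)=-\alpha2^{\beta+1}\lim_{x\uparrow1}(1-x)^\alpha g(x)$ and $\widetilde g^{\,\prime}(1)=\lim_{x\uparrow1}\big[g(x)+\widetilde g(1)2^{-\beta-1}\alpha^{-1}(1-x)^{-\alpha}\big]$. **Statement.** Let $\alpha\in\mathbb R$, $\beta\in(-1,1)$, $z\in\mathbb C$, and write $y_j=y_{j,\alpha,\beta,-1}(z,\cdot)$. Both $y_1$ and $y_2$ solve the Jacobi equation $-(1-x^2)y''+[\alpha-\beta+(\alpha+\beta+2)x]y'=zy$ on $(-1,1)$, and the following limits exist and have the given values. (1) At $-1$, for all $\alpha\in\mathbb R$: * $\beta<0$: $\widetilde y_1(-1)=1$, $\widetilde y_1^{\,\prime}(-1)=0$,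 $\widetilde y_2(-1)=0$, $\widetilde y_2^{\,\prime}(-1)=-\beta2^{\alpha+1}$; * $\beta=0$: $\widetilde y_1(-1)=0$, $\widetilde y_1^{\,\prime}(-1)=1$, $\widetilde y_2(-1)=-2^{\alpha+1}$, $\widetilde y_2^{\,\prime}(-1)=0$; * $\beta>0$: $\widetilde y_1(-1)=0$, $\widetilde y_1^{\,\prime}(-1)=1$, $\widetilde y_2(-1)=\beta2^{\alpha+1}$, $\widetilde y_2^{\,\prime}(-1)=0$. For (2)–(4) let $\alpha\in(-1,1)$, $\sigma=\sigma_{\alpha,\beta}(z)$, $P_{\mu,\nu}=\Gamma(a_{\mu,\nu,\sigma})\Gamma(a_{\mu,\nu,-\sigma})$ and $S_{\mu,\nu}=2\gamma_E+\psi(a_{\mu,\nu,\sigma})+\psi(a_{\mu,\nu,-\sigma})$. Expressions containing $S_{\mu,\nu}$ are, at those $z$ for which $a_{\mu,\nu,\sigma}$ or $a_{\mu,\nu,-\sigma}$ lies in $-\mathbb N_0$, understood as their limits in $z$ (removable singularities). (2) For $\beta\in(-1,1)$: $$\widetilde y_1(1)=\begin{cases}\Gamma(1+\beta)\Gamma(-\alpha)/P_{-\alpha,\beta},&\alpha\in(-1,0),\\-2^{1+\alpha+\beta}\Gamma(1+\alpha)\Gamma(1+\beta)/P_{\alpha,\beta},&\alpha\in[0,1),\end{cases}$$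 $$\widetilde y_1^{\,\prime}(1)=\begin{cases}2^{1+\alpha+\beta}\Gamma(1+\alpha)\Gamma(1+\beta)/P_{\alpha,\beta},&\alpha\in(-1,0),\\-\Gamma(1+\beta)S_{0,\beta}/P_{0,\beta},&\alpha=0,\\\Gamma(1+\beta)\Gamma(-\alpha)/P_{-\alpha,\beta},&\alpha\in(0,1).\end{cases}$$ (3) For $\beta\in(-1,1)\setminus\{0\}$: $$\widetilde y_2(1)=\begin{cases}2^{-\beta}\Gamma(1-\beta)\Gamma(-\alpha)/P_{-\alpha,-\beta},&\alpha\in(-1,0),\\-2^{\alpha+1}\Gamma(1+\alpha)\Gamma(1-\beta)/P_{\alpha,-\beta},&\alpha\in[0,1),\end{cases}$$ $$\widetilde y_2^{\,\prime}(1)=\begin{cases}2^{\alpha+1}\Gamma(1+\alpha)\Gamma(1-\beta)/P_{\alpha,-\beta},&\alpha\in(-1,0),\\-2^{-\beta}\Gamma(1-\beta)S_{0,-\beta}/P_{0,-\beta},&\alpha=0,\\2^{-\beta}\Gamma(1-\beta)\Gamma(-\alpha)/P_{-\alpha,-\beta},&\alpha\in(0,1).\end{cases}$$ (4) For $\beta=0$: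 $$\widetilde y_2(1)=\begin{cases}-S_{-\alpha,0}\Gamma(-\alpha)/P_{-\alpha,0},&\alpha\in(-1,0),\\2^{\alpha+1}S_{\alpha,0}\Gamma(1+\alpha)/P_{\alpha,0},&\alpha\in[0,1),\end{cases}$$ $$\widetilde y_2^{\,\prime}(1)=\begin{cases}-2^{\alpha+1}S_{\alpha,0}\Gamma(1+\alpha)/P_{\alpha,0},&\alpha\in(-1,0),\\-P_{0,0}+S_{0,0}^2/P_{0,0},&\alpha=0,\\-S_{-\alpha,0}\Gamma(-\alpha)/P_{-\alpha,0},&\alpha\in(0,1).\end{cases}$$ -/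

import Mathlib

open Set Filter Topology

noncomputable section

namespace Jacobi

/-- `a_{μ,ν,σ} = (1 + μ + ν + σ)/2`. -/
def aPar (μ ν : ℝ) (σ : ℂ) : ℂ := (1 + μ + ν + σ) / 2

/-- `σ_{α,β}(z) = [(1 + α + β)² + 4z]^{1/2}` (principal branch; everything below is even in it). -/
def sig (α β : ℝ) (z : ℂ) : ℂ := ((1 + α + β : ℂ) ^ 2 + 4 * z) ^ (1 / 2 : ℂ)

/-- Pochhammer's symbol `(a)_n = a (a+1) ⋯ (a+n-1)`. -/
def poch (n : ℕ) (a : ℂ) : ℂ := (ascPochhammer ℂ n).eval a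

/-- The derivative of `(a)_n` with respect to `a`; it is equal to `(a)_n [ψ(a+n) - ψ(a)]` when
`a` is not in `{0, -1, -2, …}` (`poch_mul_digamma`), and extends this entirely in `a`. -/
def pochDeriv (n : ℕ) (a : ℂ) : ℂ := (Polynomial.derivative (ascPochhammer ℂ n)).eval a

theorem poch_mul_digamma (n : ℕ) (a : ℂ) (ha : ∀ m : ℕ, a ≠ -(m : ℂ)) :
    poch n a * (Complex.digamma (a + n) - Complex.digamma a) = pochDeriv n a := by
  induction n with
  | zero => simp [poch, pochDeriv]
  | succ n ih =>
    have h0 : a + n ≠ 0 := fun h => ha n (eq_neg_of_add_eq_zero_left h)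
    have h1 : ∀ m : ℕ, a + n ≠ -(m : ℂ) := fun m h => ha (n + m) (by
      push_cast; linear_combination h)
    have h2 := Complex.digamma_apply_add_one (a + n) h1
    have e1 : poch (n + 1) a = poch n a * (a + n) := by
      simp [poch, ascPochhammer_succ_right]
    have e2 : pochDeriv (n + 1) a = pochDeriv n a * (a + n) + poch n a := by
      simp [poch, pochDeriv, ascPochhammer_succ_right]
    have e3 : a + ((n + 1 : ℕ) : ℂ) = a + n + 1 := by push_cast; ring
    rw [e1, e2, e3, h2, ← ih]
    field_simp
    ring

/-- The coefficient
`(a)_n (b)_n (n!)⁻² [ψ(a+n) - ψ(a) + ψ(b+n) - ψ(b) - 2ψ(n+1) - 2γ]`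
of the logarithmic Frobenius solution, written so that it makes sense for all `a`, `b`. -/
def logCoeff (a b : ℂ) (n : ℕ) : ℂ :=
  (pochDeriv n a * poch n b + poch n a * pochDeriv n b
    + poch n a * poch n b *
      (-2 * Complex.digamma (n + 1) - 2 * (Real.eulerMascheroniConstant : ℂ)))
    / (n.factorial : ℂ) ^ 2

theorem logCoeff_eq (a b : ℂ) (n : ℕ) (ha : ∀ m : ℕ, a ≠ -(m : ℂ)) (hb : ∀ m : ℕ, b ≠ -(m : ℂ)) :
    logCoeff a b n = poch n a * poch n b / (n.factorial : ℂ) ^ 2 *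
      (Complex.digamma (a + n) - Complex.digamma a + Complex.digamma (b + n) - Complex.digamma b
        - 2 * Complex.digamma (n + 1) - 2 * (Real.eulerMascheroniConstant : ℂ)) := by
  rw [logCoeff, ← poch_mul_digamma n a ha, ← poch_mul_digamma n b hb]
  ring

/-- `y_{1,α,β,-1}(z,x) = F(a_{α,β,σ}, a_{α,β,-σ}; 1+β; (1+x)/2)`, with `σ = σ_{α,β}(z)`. -/
def y₁ (α β : ℝ) (z : ℂ) (x : ℝ) : ℂ :=
  ₂F₁ (aPar α β (sig α β z)) (aPar α β (-sig α β z)) (1 + β : ℂ) (((1 + x) / 2 : ℝ) : ℂ)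

/-- `y_{2,α,β,-1}(z,x)`: for `β ≠ 0` it is
`(1+x)^{-β} F(a_{α,-β,σ}, a_{α,-β,-σ}; 1-β; (1+x)/2)` with `σ = σ_{α,β}(z)`, and for `β = 0` it is
the logarithmic solution. -/
def y₂ (α β : ℝ) (z : ℂ) (x : ℝ) : ℂ :=
  if β = 0 then
    ₂F₁ (aPar α 0 (sig α 0 z)) (aPar α 0 (-sig α 0 z)) (1 : ℂ) (((1 + x) / 2 : ℝ) : ℂ)
        * (Real.log ((1 + x) / 2) : ℂ)
      + ∑' n : ℕ, logCoeff (aPar α 0 (sig α 0 z)) (aPar α 0 (-sig α 0 z)) (n + 1)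
          * (((1 + x) / 2 : ℝ) : ℂ) ^ (n + 1)
  else
    (((1 + x) ^ (-β) : ℝ) : ℂ) *
      ₂F₁ (aPar α (-β) (sig α β z)) (aPar α (-β) (-sig α β z)) (1 - β : ℂ) (((1 + x) / 2 : ℝ) : ℂ)

/-- `y` solves the Jacobi differential equation
`-(1-x²) y'' + [α - β + (α+β+2) x] y' = z y` on `(-1,1)`. -/
def IsSolution (α β : ℝ) (z : ℂ) (y : ℝ → ℂ) : Prop :=
  ∀ x ∈ Ioo (-1 : ℝ) 1, DifferentiableAt ℝ y x ∧ DifferentiableAt ℝ (deriv y) x ∧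
    -(1 - (x : ℂ) ^ 2) * deriv (deriv y) x + (α - β + (α + β + 2) * x) * deriv y x = z * y x

/-- The quasi-derivative `g^{[1]} = p g'` with `p(x) = (1-x)^{α+1} (1+x)^{β+1}`. -/
def quasiDeriv (α β : ℝ) (g : ℝ → ℂ) (x : ℝ) : ℂ :=
  (((1 - x) ^ (α + 1) * (1 + x) ^ (β + 1) : ℝ) : ℂ) * deriv g x

/-- The generalized boundary values of `g` at `-1` exist, and `g̃(-1) = v`, `g̃'(-1) = v'`
(for `β ∈ (-1,1)`). -/
def HasBdryLeft (α β : ℝ) (g : ℝ → ℂ) (v v' : ℂ) : Prop :=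
  if β < 0 then
    Tendsto g (𝓝[>] (-1)) (𝓝 v) ∧ Tendsto (quasiDeriv α β g) (𝓝[>] (-1)) (𝓝 v')
  else if β = 0 then
    Tendsto (fun x : ℝ => -((2 ^ (α + 1) : ℝ) : ℂ) * (g x / (Real.log ((1 + x) / 2) : ℂ)))
      (𝓝[>] (-1)) (𝓝 v) ∧
    Tendsto (fun x : ℝ => g x + v * ((2 ^ (-α - 1) * Real.log ((1 + x) / 2) : ℝ) : ℂ))
      (𝓝[>] (-1)) (𝓝 v')
  else
    Tendsto (fun x : ℝ => ((β * 2 ^ (α + 1) * (1 + x) ^ β : ℝ) : ℂ) * g x) (𝓝[>] (-1)) (𝓝 v) ∧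
    Tendsto (fun x : ℝ => g x - v * ((2 ^ (-α - 1) * β⁻¹ * (1 + x) ^ (-β) : ℝ) : ℂ))
      (𝓝[>] (-1)) (𝓝 v')

/-- The generalized boundary values of `g` at `1` exist, and `g̃(1) = v`, `g̃'(1) = v'`
(for `α ∈ (-1,1)`). -/
def HasBdryRight (α β : ℝ) (g : ℝ → ℂ) (v v' : ℂ) : Prop :=
  if α < 0 then
    Tendsto g (𝓝[<] 1) (𝓝 v) ∧ Tendsto (quasiDeriv α β g) (𝓝[<] 1) (𝓝 v')
  else if α = 0 then
    Tendsto (fun x : ℝ => ((2 ^ (β + 1) : ℝ) : ℂ) * (g x / (Real.log ((1 - x) / 2) : ℂ)))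
      (𝓝[<] 1) (𝓝 v) ∧
    Tendsto (fun x : ℝ => g x - v * ((2 ^ (-β - 1) * Real.log ((1 - x) / 2) : ℝ) : ℂ))
      (𝓝[<] 1) (𝓝 v')
  else
    Tendsto (fun x : ℝ => ((-α * 2 ^ (β + 1) * (1 - x) ^ α : ℝ) : ℂ) * g x) (𝓝[<] 1) (𝓝 v) ∧
    Tendsto (fun x : ℝ => g x + v * ((2 ^ (-β - 1) * α⁻¹ * (1 - x) ^ (-α) : ℝ) : ℂ))
      (𝓝[<] 1) (𝓝 v')

/-- `Γ(a_{μ,ν,σ}) Γ(a_{μ,ν,-σ})`. It is `0` in Lean when one of the factors has a pole, so that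
dividing by it gives `0`, as the convention `1/Γ(-n) = 0` requires. -/
def GG (μ ν : ℝ) (σ : ℂ) : ℂ := Complex.Gamma (aPar μ ν σ) * Complex.Gamma (aPar μ ν (-σ))

/-- `2γ + ψ(a_{μ,ν,σ}) + ψ(a_{μ,ν,-σ})`. -/
def psiSum (μ ν : ℝ) (σ : ℂ) : ℂ :=
  2 * (Real.eulerMascheroniConstant : ℂ) + Complex.digamma (aPar μ ν σ)
    + Complex.digamma (aPar μ ν (-σ))

/-- Neither `a_{μ,ν,σ}` nor `a_{μ,ν,-σ}` is a pole of `Γ` (equivalently, of `ψ`). -/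
def NoPole (μ ν : ℝ) (σ : ℂ) : Prop :=
  ∀ n : ℕ, aPar μ ν σ ≠ -(n : ℂ) ∧ aPar μ ν (-σ) ≠ -(n : ℂ)

/-- `v` is the value at `z` of the expression `f`, continued through its removable singularities:
`f` has the limit `v` at `z`, and `v = f z` whenever `z` is a regular point. -/
def IsContinuedValue (regular : ℂ → Prop) (f : ℂ → ℂ) (z v : ℂ) : Prop :=
  Tendsto f (𝓝[≠] z) (𝓝 v) ∧ (regular z → v = f z)

end Jacobi

end

noncomputable section

namespace Jacobi

/-! ### Power series on the unit disk -/

/-! In `t = (1+x)/2` the Jacobi equation is the hypergeometric equation with `c = 1 + β`, and on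
power series its operator is a two-term recurrence (`hypergeometric_operator_psum`). So `y₁` is a
solution. Multiplication by `(1+x)^{-β}` exchanges `(α, β)` and `(α, -β)` after a shift of `z` that
leaves `σ` unchanged, which gives `y₂` for `β ≠ 0`; the logarithmic solution is checked on its
coefficients (`logCoeff_succ`). The values at `-1` are read off from these local expansions.

At `1`, reflection `x ↦ -x` provides a fundamental system `r₁`, `r₂` with known boundary values. The
modified Wronskian is constant, so every solution is `A r₁ + B r₂`, and its boundary values at `1`
are `A` and `± B * leadingCoeff β α`, in an order fixed by the sign of `α` (`hasBdryRight_of_eq_r`).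
What remains is to find connection coefficients.

For `y₁` and `α < 0`, the limit at `1` is Gauss's sum (`tsum_hcoeff`, obtained by iterating a
contiguous relation and using Euler's limit for `Γ`) combined with Abel's theorem. The
quasi-derivative reduces to the same sum, since `y₁'` is again a `y₁` with both parameters raised by
one, and Euler's transformation extracts its singular factor. Euler's transformation follows from
uniqueness of the solution regular at `-1`, and it also carries the result from `-α` to `α > 0`. For
`α = 0` the connection formula at `(-ε, β + ε)` is a difference quotient in `ε`; its limit is a
derivative, which is where `ψ` and the logarithm come from (`y₁_zero_connection`).

For `y₂` with `β ≠ 0` one multiplies by `(1+x)^{-β}`. For `β = 0`, the reflected logarithmic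
connection formula and a Wronskian give the coefficient along `r₂`. The coefficient along `r₁` comes
from Euler's transformation if `α ≠ 0`. If `α = β = 0` it comes from inserting the connection
formulas into one another.

Exceptional `z` cause no trouble: `psiRatio` is entire in both arguments and even in `σ`, hence
continuous in `z`, and the exceptional points are isolated. -/

/-- The power series with coefficients `w` converges absolutely on the open unit disk. -/
def DiskSummable (w : ℕ → ℂ) : Prop :=
  ∀ r : ℝ, 0 ≤ r → r < 1 → Summable fun n => ‖w n‖ * r ^ n

/-- The sum of the power series with coefficients `w`. -/
def psum (w : ℕ → ℂ) (t : ℂ) : ℂ := ∑' n : ℕ, w n * t ^ n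

/-- The coefficients of the derivative of a power series. -/
def shift (w : ℕ → ℂ) (n : ℕ) : ℂ := (n + 1) * w (n + 1)

theorem DiskSummable.norm_summable {w : ℕ → ℂ} (hw : DiskSummable w) {t : ℂ} (ht : ‖t‖ < 1) :
    Summable fun n => ‖w n * t ^ n‖ := by
  simpa [norm_mul, norm_pow] using hw ‖t‖ (norm_nonneg t) ht

theorem DiskSummable.summable {w : ℕ → ℂ} (hw : DiskSummable w) {t : ℂ} (ht : ‖t‖ < 1) :
    Summable fun n => w n * t ^ n := (hw.norm_summable ht).of_norm

theorem DiskSummable.of_norm_le {w : ℕ → ℂ} {B : ℕ → ℝ}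
    (hB : ∀ r : ℝ, 0 ≤ r → r < 1 → Summable fun n => B n * r ^ n) (h : ∀ n, ‖w n‖ ≤ B n) :
    DiskSummable w := fun r h0 h1 =>
  Summable.of_nonneg_of_le (fun n => by positivity)
    (fun n => mul_le_mul_of_nonneg_right (h n) (by positivity)) (hB r h0 h1)

theorem psum_zero (w : ℕ → ℂ) : psum w 0 = w 0 := by
  rw [psum, tsum_eq_single 0]
  · simp
  · intro n hn; simp [hn]

theorem DiskSummable.hasSum_deriv {w : ℕ → ℂ} (hw : DiskSummable w) {t : ℂ} (ht : ‖t‖ < 1) :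
    HasSum (fun n => shift w n * t ^ n) (deriv (psum w) t) ∧ DifferentiableAt ℂ (psum w) t := by
  obtain ⟨r, hr, hr1⟩ := exists_between ht
  have hr0 : 0 ≤ r := (norm_nonneg t).trans hr.le
  have hF : ∀ n : ℕ, DifferentiableOn ℂ (fun t : ℂ => w n * t ^ n) (Metric.ball 0 r) :=
    fun n => by fun_prop
  have hle : ∀ (n : ℕ) (s : ℂ), s ∈ Metric.ball (0 : ℂ) r → ‖w n * s ^ n‖ ≤ ‖w n‖ * r ^ n := by
    intro n s hs
    rw [norm_mul, norm_pow]
    have : ‖s‖ ≤ r := by simpa using (Metric.mem_ball.1 hs).le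
    gcongr
  have htr : t ∈ Metric.ball (0 : ℂ) r := by simpa using hr
  have h := Complex.hasSum_deriv_of_summable_norm (hw r hr0 hr1) hF Metric.isOpen_ball hle htr
  have h2 := Complex.differentiableOn_tsum_of_summable_norm (hw r hr0 hr1) hF Metric.isOpen_ball hle
  refine ⟨?_, (h2 t htr).differentiableAt (Metric.isOpen_ball.mem_nhds htr)⟩
  have e : ∀ n : ℕ, deriv (fun t : ℂ => w n * t ^ n) t = w n * (n * t ^ (n - 1)) := fun n => by
    simp
  simp_rw [e] at h
  have h3 := (hasSum_nat_add_iff' 1).2 h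
  simp only [Finset.range_one, Finset.sum_singleton, CharP.cast_eq_zero, zero_mul, mul_zero,
    sub_zero, Nat.add_sub_cancel] at h3
  convert! h3 using 1
  funext n
  simp only [shift]
  push_cast
  ring

theorem DiskSummable.shift {w : ℕ → ℂ} (hw : DiskSummable w) : DiskSummable (shift w) := by
  intro r h0 h1
  have h : ‖(r : ℂ)‖ < 1 := by simpa [abs_of_nonneg h0] using h1
  -- Summability in `ℂ` is absolute, so convergence of the derived series at the real point `r`
  -- already gives the norms.
  have := (hw.hasSum_deriv h).1.summable.norm
  simpa [norm_mul, norm_pow, abs_of_nonneg h0] using this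

theorem DiskSummable.hasDerivAt {w : ℕ → ℂ} (hw : DiskSummable w) {t : ℂ} (ht : ‖t‖ < 1) :
    HasDerivAt (psum w) (psum (Jacobi.shift w) t) t := by
  have h := hw.hasSum_deriv ht
  rw [psum, h.1.tsum_eq]
  exact h.2.hasDerivAt

theorem DiskSummable.const_mul {w : ℕ → ℂ} (hw : DiskSummable w) (k : ℂ) :
    DiskSummable fun n => k * w n := fun r h0 h1 => by
  simpa [norm_mul, mul_assoc] using (hw r h0 h1).mul_left ‖k‖

theorem DiskSummable.add {v w : ℕ → ℂ} (hv : DiskSummable v) (hw : DiskSummable w) :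
    DiskSummable fun n => v n + w n := fun r h0 h1 =>
  Summable.of_nonneg_of_le (fun n => by positivity)
    (fun n => by rw [← add_mul]; gcongr; exact norm_add_le _ _) ((hv r h0 h1).add (hw r h0 h1))

theorem psum_const_mul (w : ℕ → ℂ) (k t : ℂ) : psum (fun n => k * w n) t = k * psum w t := by
  simp only [psum, mul_assoc, tsum_mul_left]

theorem psum_add {v w : ℕ → ℂ} (hv : DiskSummable v) (hw : DiskSummable w) {t : ℂ}
    (ht : ‖t‖ < 1) : psum (fun n => v n + w n) t = psum v t + psum w t := by
  simp only [psum, add_mul]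
  exact (hv.summable ht).tsum_add (hw.summable ht)

theorem mul_psum_shift {w : ℕ → ℂ} (hw : DiskSummable w) {t : ℂ} (ht : ‖t‖ < 1) :
    HasSum (fun n : ℕ => (n * w n) * t ^ n) (t * psum (shift w) t) := by
  have h := (hw.shift.summable ht).hasSum.mul_left t
  rw [← hasSum_nat_add_iff' 1]
  simp only [Finset.range_one, Finset.sum_singleton, CharP.cast_eq_zero, zero_mul, sub_zero]
  convert! h using 1
  funext n
  simp only [shift]
  push_cast
  ring

theorem DiskSummable.nat_mul {w : ℕ → ℂ} (hw : DiskSummable w) :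
    DiskSummable fun n => (n : ℂ) * w n := fun r h0 h1 => by
  have h : ‖(r : ℂ)‖ < 1 := by simpa [abs_of_nonneg h0] using h1
  have := (mul_psum_shift hw h).summable.norm
  simpa [norm_mul, norm_pow, abs_of_nonneg h0] using this

theorem mul_psum_shift_eq {w : ℕ → ℂ} (hw : DiskSummable w) {t : ℂ} (ht : ‖t‖ < 1) :
    t * psum (shift w) t = psum (fun n => (n : ℂ) * w n) t :=
  (mul_psum_shift hw ht).tsum_eq.symm

/-- The hypergeometric operator acts on the coefficients of a power series by a two-term
recurrence. -/
theorem hypergeometric_operator_psum {w : ℕ → ℂ} (hw : DiskSummable w) (a b c : ℂ) {t : ℂ}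
    (ht : ‖t‖ < 1) :
    t * (1 - t) * psum (shift (shift w)) t + (c - (a + b + 1) * t) * psum (shift w) t
        - a * b * psum w t
      = psum (fun n => (n + 1) * (n + c) * w (n + 1) - (n + a) * (n + b) * w n) t := by
  have e1 : t * psum (shift (shift w)) t = psum (fun n => (n : ℂ) * shift w n) t :=
    mul_psum_shift_eq hw.shift ht
  have hv : DiskSummable fun n => (n : ℂ) * w n + (-1) * w n := hw.nat_mul.add (hw.const_mul (-1))
  -- `n (n+1) w_{n+1}` is itself the derived series of `(n-1) w_n`, so a second factor `t` can be
  -- absorbed in the same way.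
  have e2 : (fun n : ℕ => (n : ℂ) * shift w n) = shift (fun n => (n : ℂ) * w n + (-1) * w n) := by
    funext n; simp only [shift]; push_cast; ring
  have e3 : t * (t * psum (shift (shift w)) t)
      = psum (fun n => (n : ℂ) * ((n : ℂ) * w n + (-1) * w n)) t := by
    rw [e1, e2, mul_psum_shift_eq hv ht]
  have e4 := mul_psum_shift_eq hw ht
  have s1 := hw.shift.nat_mul
  have s3 : DiskSummable fun n => (n : ℂ) * ((n : ℂ) * w n + (-1) * w n) := hv.nat_mul
  have e5 : (fun n : ℕ => (n + 1) * (n + c) * w (n + 1) - (n + a) * (n + b) * w n)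
      = fun n : ℕ => ((((n : ℂ) * shift w n + (-1) * ((n : ℂ) * ((n : ℂ) * w n + (-1) * w n)))
        + c * shift w n) + (-(a + b + 1)) * ((n : ℂ) * w n)) + (-(a * b)) * w n := by
    funext n; simp only [shift]; ring
  have s2 := s1.add (s3.const_mul (-1))
  have s4 := s2.add (hw.shift.const_mul c)
  have s5 := s4.add (hw.nat_mul.const_mul (-(a + b + 1)))
  rw [e5, psum_add s5 (hw.const_mul _) ht, psum_add s4 (hw.nat_mul.const_mul _) ht,
    psum_add s2 (hw.shift.const_mul _) ht, psum_add s1 (s3.const_mul _) ht, psum_const_mul,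
    psum_const_mul, psum_const_mul, psum_const_mul, ← e1, ← e3, ← e4]
  ring

/-- Dominated convergence. One majorant for all parameters near the limit is what makes every later
passage to the limit in `ε` or `z` possible. -/
theorem tendsto_psum {X : Type*} {l : Filter X} {w : X → ℕ → ℂ} {w₀ : ℕ → ℂ} {B : ℕ → ℝ}
    (hB : ∀ r : ℝ, 0 ≤ r → r < 1 → Summable fun n => B n * r ^ n)
    (hw : ∀ n, Tendsto (fun x => w x n) l (𝓝 (w₀ n)))
    (hle : ∀ᶠ x in l, ∀ n, ‖w x n‖ ≤ B n) {t : ℂ} (ht : ‖t‖ < 1) :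
    Tendsto (fun x => psum (w x) t) l (𝓝 (psum w₀ t)) := by
  refine tendsto_tsum_of_dominated_convergence (hB ‖t‖ (norm_nonneg t) ht)
    (fun n => (hw n).mul_const _) ?_
  filter_upwards [hle] with x hx n
  rw [norm_mul, norm_pow]
  gcongr
  exact hx n

/-! ### Pochhammer symbols -/

theorem poch_zero (a : ℂ) : poch 0 a = 1 := by simp [poch]

theorem poch_succ (n : ℕ) (a : ℂ) : poch (n + 1) a = poch n a * (a + n) := by
  simp [poch, ascPochhammer_succ_right]

theorem poch_succ_left (n : ℕ) (a : ℂ) : poch (n + 1) a = a * poch n (a + 1) := by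
  simp [poch, ascPochhammer_succ_left, Polynomial.eval_comp]

theorem pochDeriv_zero (a : ℂ) : pochDeriv 0 a = 0 := by simp [pochDeriv]

theorem pochDeriv_succ (n : ℕ) (a : ℂ) :
    pochDeriv (n + 1) a = pochDeriv n a * (a + n) + poch n a := by
  simp [poch, pochDeriv, ascPochhammer_succ_right]

theorem hasDerivAt_poch (n : ℕ) (a : ℂ) : HasDerivAt (poch n) (pochDeriv n a) a :=
  Polynomial.hasDerivAt _ _

theorem poch_one (n : ℕ) : poch n 1 = (n.factorial : ℂ) := by
  simp [poch, ascPochhammer_eval_one]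

/-- The product `M (M + 1) ⋯ (M + n - 1)` of real numbers. -/
def rpoch (M : ℝ) (n : ℕ) : ℝ := ∏ k ∈ Finset.range n, (M + k)

theorem rpoch_pos {M : ℝ} (hM : 0 < M) (n : ℕ) : 0 < rpoch M n :=
  Finset.prod_pos fun k _ => by positivity

theorem norm_poch_le {a : ℂ} {M : ℝ} (h : ‖a‖ ≤ M) (n : ℕ) : ‖poch n a‖ ≤ rpoch M n := by
  induction n with
  | zero => simp [poch_zero, rpoch]
  | succ n ih =>
    rw [poch_succ, norm_mul, rpoch, Finset.prod_range_succ]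
    have : ‖a + n‖ ≤ M + n := (norm_add_le _ _).trans (by simpa using h)
    exact mul_le_mul ih this (norm_nonneg _) ((norm_nonneg _).trans ih)

theorem rpoch_le_norm_poch {c : ℂ} {δ : ℝ} (hδ : 0 ≤ δ) (h : δ ≤ c.re) (n : ℕ) :
    rpoch δ n ≤ ‖poch n c‖ := by
  induction n with
  | zero => simp [poch_zero, rpoch]
  | succ n ih =>
    rw [poch_succ, norm_mul, rpoch, Finset.prod_range_succ]
    have : δ + n ≤ ‖c + n‖ := le_trans (by simpa using h) (Complex.re_le_norm _)
    exact mul_le_mul ih this (by positivity) (norm_nonneg _)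

theorem poch_ne_zero {c : ℂ} (h : 0 < c.re) (n : ℕ) : poch n c ≠ 0 :=
  norm_pos_iff.1 ((rpoch_pos h n).trans_le (rpoch_le_norm_poch h.le le_rfl n))

/-- A majorant for the coefficients of hypergeometric series. -/
def majorant (M δ : ℝ) (n : ℕ) : ℝ := rpoch M n ^ 2 / rpoch δ n ^ 2

theorem summable_majorant {M δ : ℝ} (hM : 0 < M) (hδ : 0 < δ) (r : ℝ) (h0 : 0 ≤ r) (h1 : r < 1) :
    Summable fun n => majorant M δ n * r ^ n := by
  rcases h0.eq_or_lt with rfl | h0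
  · refine summable_of_ne_finset_zero (s := {0}) fun n hn => ?_
    simp at hn
    simp [hn]
  have hpos : ∀ n, 0 < majorant M δ n * r ^ n := fun n => by
    have := rpoch_pos hM n
    have := rpoch_pos hδ n
    unfold majorant
    positivity
  refine summable_of_ratio_test_tendsto_lt_one h1 (Eventually.of_forall fun n => (hpos n).ne') ?_
  have h : Tendsto (fun n : ℕ => ((M + 1 * n) / (δ + 1 * n)) ^ 2 * r) atTop (𝓝 ((1 / 1) ^ 2 * r)) :=
    ((tendsto_add_mul_div_add_mul_atTop_nhds M δ (1 : ℝ) one_ne_zero).pow 2).mul_const r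
  simp only [div_one, one_pow, one_mul] at h
  refine h.congr fun n => ?_
  have e1 := rpoch_pos hM n
  have e2 := rpoch_pos hδ n
  have e3 : 0 < δ + n := by positivity
  rw [Real.norm_of_nonneg (hpos _).le, Real.norm_of_nonneg (hpos _).le]
  simp only [majorant, rpoch, Finset.prod_range_succ] at *
  field_simp
  ring

/-- The coefficients of the hypergeometric series. -/
def hcoeff (a b c : ℂ) (n : ℕ) : ℂ := poch n a * poch n b / (poch n c * n.factorial)

/-- The factorial is `(1)_n`, so it is bounded below in the same way as `(c)_n`; hence the condition
`δ ≤ 1`. The bound sees the parameters only through `M` and `δ`, so it is locally uniform in them.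
-/
theorem norm_hcoeff_le {a b c : ℂ} {M δ : ℝ} (ha : ‖a‖ ≤ M) (hb : ‖b‖ ≤ M) (hδ : 0 < δ)
    (hδ1 : δ ≤ 1) (hc : δ ≤ c.re) (n : ℕ) : ‖hcoeff a b c n‖ ≤ majorant M δ n := by
  have hM : 0 ≤ M := (norm_nonneg a).trans ha
  have h1 := norm_poch_le ha n
  have h2 := norm_poch_le hb n
  have h3 := rpoch_le_norm_poch hδ.le hc n
  have h4 := rpoch_le_norm_poch (c := 1) hδ.le (by simpa using hδ1) n
  rw [poch_one] at h4
  have h5 := rpoch_pos hδ n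
  rw [hcoeff, norm_div, norm_mul, norm_mul, majorant, sq, sq]
  exact div_le_div₀ (mul_self_nonneg _) (mul_le_mul h1 h2 (norm_nonneg _) ((norm_nonneg _).trans h1))
    (by positivity) (mul_le_mul h3 h4 h5.le (norm_nonneg _))

theorem diskSummable_hcoeff (a b : ℂ) {c : ℂ} (hc : 0 < c.re) : DiskSummable (hcoeff a b c) :=
  .of_norm_le (summable_majorant (M := ‖a‖ + ‖b‖ + 1) (δ := min 1 c.re) (by positivity)
    (lt_min one_pos hc)) (norm_hcoeff_le (by linarith [norm_nonneg b]) (by linarith [norm_nonneg a])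
      (lt_min one_pos hc) (min_le_left _ _) (min_le_right _ _))

theorem hypergeometric_eq_psum (a b c t : ℂ) : ₂F₁ a b c t = psum (hcoeff a b c) t := by
  rw [ordinaryHypergeometric_eq_tsum]
  refine tsum_congr fun n => ?_
  simp only [hcoeff, poch, smul_eq_mul]
  ring

theorem hcoeff_zero (a b c : ℂ) : hcoeff a b c 0 = 1 := by simp [hcoeff, poch_zero]

theorem hcoeff_succ (a b : ℂ) {c : ℂ} (hc : 0 < c.re) (n : ℕ) :
    (n + 1) * (n + c) * hcoeff a b c (n + 1) = (n + a) * (n + b) * hcoeff a b c n := by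
  have h1 := poch_ne_zero hc n
  have h2 := poch_ne_zero hc (n + 1)
  rw [poch_succ] at h2
  have h3 : (n.factorial : ℂ) ≠ 0 := by exact_mod_cast n.factorial_ne_zero
  have h4 : ((n : ℂ) + 1) ≠ 0 := by exact_mod_cast n.succ_ne_zero
  have h5 : c + n ≠ 0 := right_ne_zero_of_mul h2
  simp only [hcoeff, poch_succ, Nat.factorial_succ]
  push_cast
  field_simp
  ring

/-- `d/dt F(a,b;c;t) = (ab/c) F(a+1,b+1;c+1;t)` on the level of coefficients. -/
theorem shift_hcoeff (a b : ℂ) {c : ℂ} (hc : 0 < c.re) (n : ℕ) :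
    shift (hcoeff a b c) n = a * b / c * hcoeff (a + 1) (b + 1) (c + 1) n := by
  have h3 : (n.factorial : ℂ) ≠ 0 := by exact_mod_cast n.factorial_ne_zero
  have h4 : ((n : ℂ) + 1) ≠ 0 := by exact_mod_cast n.succ_ne_zero
  have h0 : c ≠ 0 := fun h => by simp [h] at hc
  have h1 := poch_ne_zero (c := c + 1) (by simp; linarith) n
  simp only [shift, hcoeff, poch_succ_left, Nat.factorial_succ]
  push_cast
  field_simp

/-! ### Solutions of the Jacobi equation -/

theorem sig_sq (α β : ℝ) (z : ℂ) : sig α β z ^ 2 = (1 + α + β : ℂ) ^ 2 + 4 * z := by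
  rw [sig, ← Complex.cpow_nat_mul]
  simp

theorem aPar_add (μ ν : ℝ) (σ : ℂ) : aPar μ ν σ + aPar μ ν (-σ) = 1 + μ + ν := by
  simp only [aPar]; ring

theorem aPar_mul (α β : ℝ) (z : ℂ) :
    aPar α β (sig α β z) * aPar α β (-sig α β z) = -z := by
  have h := sig_sq α β z
  simp only [aPar]
  linear_combination -h / 4

/-- `(1+α-β)² + 4β(1+α) = (1+α+β)²`: the shift of `z` compensates the change of sign of `β`. -/
theorem sig_shift_right (α β : ℝ) (z : ℂ) : sig α (-β) (z + β * (1 + α)) = sig α β z := by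
  simp only [sig]; congr 1; push_cast; ring

theorem sig_shift_left (α β : ℝ) (z : ℂ) : sig (-α) β (z + α * (1 + β)) = sig α β z := by
  simp only [sig]; congr 1; push_cast; ring

theorem sig_comm (α β : ℝ) (z : ℂ) : sig α β z = sig β α z := by
  simp only [sig]; congr 1; ring

theorem aPar_comm (α β : ℝ) (σ : ℂ) : aPar α β σ = aPar β α σ := by
  simp only [aPar]; ring

theorem hcoeff_symm (a b c : ℂ) : hcoeff a b c = hcoeff b a c := by
  funext n; simp only [hcoeff]; ring

theorem y₁_eq_psum (α β : ℝ) (z : ℂ) (x : ℝ) : y₁ α β z x =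
    psum (hcoeff (aPar α β (sig α β z)) (aPar α β (-sig α β z)) (1 + β))
      (((1 + x) / 2 : ℝ) : ℂ) := hypergeometric_eq_psum _ _ _ _

theorem y₂_eq_rpow_mul {α β : ℝ} (hβ : β ≠ 0) (z : ℂ) (x : ℝ) : y₂ α β z x =
    (((1 + x) ^ (-β) : ℝ) : ℂ) * y₁ α (-β) (z + β * (1 + α)) x := by
  rw [y₂, if_neg hβ, y₁, sig_shift_right]
  push_cast
  rfl

theorem norm_half_add_lt {x : ℝ} (hx : x ∈ Ioo (-1 : ℝ) 1) :
    ‖(((1 + x) / 2 : ℝ) : ℂ)‖ < 1 := by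
  rw [Complex.norm_real, Real.norm_eq_abs, abs_lt]
  constructor <;> linarith [hx.1, hx.2]

theorem hasDerivAt_psum_half {w : ℕ → ℂ} (hw : DiskSummable w) {x : ℝ}
    (hx : ‖(((1 + x) / 2 : ℝ) : ℂ)‖ < 1) :
    HasDerivAt (fun x : ℝ => psum w (((1 + x) / 2 : ℝ) : ℂ))
      (psum (shift w) (((1 + x) / 2 : ℝ) : ℂ) / 2) x := by
  have h1 : HasDerivAt (fun x : ℝ => (((1 + x) / 2 : ℝ) : ℂ)) (((1 / 2 : ℝ)) : ℂ) x :=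
    (((hasDerivAt_id x).const_add 1).div_const 2).ofReal_comp
  have h2 := (hw.hasDerivAt hx).comp x h1
  convert! h2 using 1
  push_cast
  ring

theorem IsSolution.of_hasDerivAt {α β : ℝ} {z : ℂ} {y y' y'' : ℝ → ℂ}
    (h1 : ∀ x ∈ Ioo (-1 : ℝ) 1, HasDerivAt y (y' x) x)
    (h2 : ∀ x ∈ Ioo (-1 : ℝ) 1, HasDerivAt y' (y'' x) x)
    (h : ∀ x ∈ Ioo (-1 : ℝ) 1,
      -(1 - (x : ℂ) ^ 2) * y'' x + (α - β + (α + β + 2) * x) * y' x = z * y x) :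
    IsSolution α β z y := by
  intro x hx
  have e : deriv y =ᶠ[𝓝 x] y' := by
    filter_upwards [isOpen_Ioo.mem_nhds hx] with s hs using (h1 s hs).deriv
  have h3 : HasDerivAt (deriv y) (y'' x) x := (h2 x hx).congr_of_eventuallyEq e
  refine ⟨(h1 x hx).differentiableAt, h3.differentiableAt, ?_⟩
  rw [h3.deriv, e.self_of_nhds]
  exact h x hx

theorem isSolution_y₁ (α : ℝ) {β : ℝ} (hβ : -1 < β) (z : ℂ) : IsSolution α β z (y₁ α β z) := by
  set a := aPar α β (sig α β z) with ha
  set b := aPar α β (-sig α β z) with hb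
  have hc : 0 < (1 + β : ℂ).re := by simp; linarith
  have hw : DiskSummable (hcoeff a b (1 + β)) := diskSummable_hcoeff a b hc
  have hy : y₁ α β z = fun x : ℝ => psum (hcoeff a b (1 + β)) (((1 + x) / 2 : ℝ) : ℂ) :=
    funext fun x => y₁_eq_psum α β z x
  rw [hy]
  refine IsSolution.of_hasDerivAt (fun x hx => hasDerivAt_psum_half hw (norm_half_add_lt hx))
    (fun x hx => (hasDerivAt_psum_half hw.shift (norm_half_add_lt hx)).div_const 2) fun x hx => ?_
  have h := hypergeometric_operator_psum hw a b (1 + β) (norm_half_add_lt hx)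
  have h0 : (fun n : ℕ => (n + 1) * (n + (1 + β)) * hcoeff a b (1 + β) (n + 1)
      - (n + a) * (n + b) * hcoeff a b (1 + β) n) = fun n => 0 * hcoeff a b (1 + β) n := by
    funext n; rw [hcoeff_succ a b hc n]; ring
  -- With `t = (1+x)/2` one has `1 - x² = 4t(1-t)`, and `a + b = 1+α+β`, `ab = -z` turn the
  -- hypergeometric equation into minus the Jacobi equation.
  rw [h0, psum_const_mul, zero_mul] at h
  have e1 : a + b = 1 + α + β := aPar_add _ _ _
  have e2 : a * b = -z := aPar_mul _ _ _
  rw [e1, e2] at h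
  simp only [Complex.ofReal_div, Complex.ofReal_add, Complex.ofReal_one, Complex.ofReal_ofNat] at h ⊢
  linear_combination -h

/-- Multiplication by `(1 + x)^{-β}` turns solutions for `(α, -β)` into solutions for `(α, β)`. -/
theorem IsSolution.one_add_rpow_mul {α β : ℝ} {z : ℂ} {g : ℝ → ℂ}
    (hg : IsSolution α (-β) (z + β * (1 + α)) g) :
    IsSolution α β z fun x => (((1 + x) ^ (-β) : ℝ) : ℂ) * g x := by
  have hu : ∀ (s x : ℝ), x ∈ Ioo (-1 : ℝ) 1 → HasDerivAt (fun x : ℝ => (((1 + x) ^ s : ℝ) : ℂ))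
      ((s : ℂ) * (((1 + x) ^ (s - 1) : ℝ) : ℂ)) x := by
    intro s x hx
    have h : HasDerivAt (fun x : ℝ => (1 + x) ^ s) (1 * s * (1 + x) ^ (s - 1)) x :=
      ((hasDerivAt_id x).const_add 1).rpow_const (Or.inl (by simp only [id]; linarith [hx.1]))
    convert! h.ofReal_comp using 1
    push_cast
    ring
  refine IsSolution.of_hasDerivAt
    (fun x hx => (hu (-β) x hx).mul (hg x hx).1.hasDerivAt)
    (fun x hx => (((hu (-β - 1) x hx).const_mul _).mul (hg x hx).1.hasDerivAt).add
      ((hu (-β) x hx).mul (hg x hx).2.1.hasDerivAt)) fun x hx => ?_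
  have h := (hg x hx).2.2
  have hpos : 0 < 1 + x := by linarith [hx.1]
  -- All powers are expressed through the lowest one, `(1+x)^{-β-2}`; what is left is polynomial in
  -- `x`.
  have e1 : (((1 + x) ^ (-β) : ℝ) : ℂ) = (1 + x) ^ 2 * (((1 + x) ^ (-β - 1 - 1) : ℝ) : ℂ) := by
    rw [show -β = (-β - 1 - 1) + 2 by ring, Real.rpow_add hpos]
    norm_cast
    ring_nf
  have e2 : (((1 + x) ^ (-β - 1) : ℝ) : ℂ) = (1 + x) * (((1 + x) ^ (-β - 1 - 1) : ℝ) : ℂ) := by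
    rw [show -β - 1 = (-β - 1 - 1) + 1 by ring, Real.rpow_add hpos]
    norm_cast
    simp [mul_comm]
  push_cast [e1, e2] at h ⊢
  linear_combination (1 + (x : ℂ)) ^ 2 * (((1 + x) ^ (-β - 1 - 1) : ℝ) : ℂ) * h

/-! ### The logarithmic solution -/

theorem pochDeriv_one (n : ℕ) : pochDeriv n 1 =
    n.factorial * (Complex.digamma (n + 1) + (Real.eulerMascheroniConstant : ℂ)) := by
  rw [← poch_mul_digamma n 1, poch_one, Complex.digamma_one, add_comm (1 : ℂ)]
  · ring
  · intro m h
    have : ((1 + m : ℕ) : ℂ) = 0 := by push_cast; linear_combination h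
    exact absurd (Nat.cast_eq_zero.1 this) (by omega)

theorem logCoeff_eq_pochDeriv (a b : ℂ) (n : ℕ) : logCoeff a b n =
    (pochDeriv n a * poch n b + poch n a * pochDeriv n b) / (n.factorial : ℂ) ^ 2
      - 2 * (poch n a * poch n b) * pochDeriv n 1 / (n.factorial : ℂ) ^ 3 := by
  have h3 : (n.factorial : ℂ) ≠ 0 := by exact_mod_cast n.factorial_ne_zero
  rw [logCoeff, pochDeriv_one]
  field_simp
  ring

/-- Frobenius' method: the logarithmic coefficients are the derivatives at exponent `ε = 0` of the
coefficients of the series starting with `t^ε`. Holomorphy in `ε` then allows a Cauchy estimate. -/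
theorem hasDerivAt_logCoeff (a b : ℂ) (n : ℕ) : HasDerivAt
    (fun ε => poch n (a + ε) * poch n (b + ε) / poch n (1 + ε) ^ 2) (logCoeff a b n) 0 := by
  have hp : ∀ a : ℂ, HasDerivAt (fun ε => poch n (a + ε)) (pochDeriv n a) 0 := fun a =>
    HasDerivAt.comp_const_add a 0 (by simpa using hasDerivAt_poch n a)
  have h3 : (n.factorial : ℂ) ≠ 0 := by exact_mod_cast n.factorial_ne_zero
  have h := ((hp a).mul (hp b)).div ((hp 1).pow 2) (by simp [poch_one, h3])
  convert! h using 1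
  rw [logCoeff_eq_pochDeriv]
  simp only [add_zero, poch_one, Pi.mul_apply, Pi.pow_apply]
  push_cast
  field_simp

/-- Cauchy's estimate on the circle `|ε| = 1/2`: there `Re (1 + ε) ≥ 1/2`, the numerators are
bounded with `M`, and dividing by the radius gives the factor `2`. -/
theorem norm_logCoeff_le {a b : ℂ} {M : ℝ} (ha : ‖a‖ + 1 / 2 ≤ M) (hb : ‖b‖ + 1 / 2 ≤ M) (n : ℕ) :
    ‖logCoeff a b n‖ ≤ 2 * majorant M (1 / 2) n := by
  have hre : ∀ ε : ℂ, ‖ε‖ ≤ 1 / 2 → 1 / 2 ≤ (1 + ε).re := fun ε hε => by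
    have := (abs_le.1 ((Complex.abs_re_le_norm ε).trans hε)).1
    simp; linarith
  have hd : DiffContOnCl ℂ (fun ε => poch n (a + ε) * poch n (b + ε) / poch n (1 + ε) ^ 2)
      (Metric.ball 0 (1 / 2)) := by
    refine DifferentiableOn.diffContOnCl fun ε hε => DifferentiableAt.differentiableWithinAt ?_
    rw [closure_ball _ (by norm_num), mem_closedBall_zero_iff] at hε
    have hp : ∀ a : ℂ, DifferentiableAt ℂ (fun ε => poch n (a + ε)) ε := fun a =>
      (HasDerivAt.comp_const_add a ε (hasDerivAt_poch n _)).differentiableAt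
    exact ((hp a).mul (hp b)).div ((hp 1).pow 2)
      (pow_ne_zero 2 (poch_ne_zero (by linarith [hre ε hε]) n))
  have h := Complex.norm_deriv_le_of_forall_mem_sphere_norm_le (by norm_num : (0 : ℝ) < 1 / 2) hd
    (C := majorant M (1 / 2) n) fun ε hε => by
      rw [mem_sphere_zero_iff_norm] at hε
      have h1 := norm_poch_le (a := a + ε) (M := M) (by linarith [norm_add_le a ε]) n
      have h2 := norm_poch_le (a := b + ε) (M := M) (by linarith [norm_add_le b ε]) n
      have h3 := rpoch_le_norm_poch (by norm_num : (0 : ℝ) ≤ 1 / 2) (hre ε hε.le) n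
      have h4 := rpoch_pos (by norm_num : (0 : ℝ) < 1 / 2) n
      rw [norm_div, norm_mul, norm_pow, majorant, sq (rpoch M n)]
      have h5 : 0 ≤ rpoch M n := (norm_nonneg _).trans h1
      gcongr
  rw [(hasDerivAt_logCoeff a b n).deriv] at h
  linarith

theorem summable_two_mul_majorant {M δ : ℝ} (hM : 0 < M) (hδ : 0 < δ) (r : ℝ) (h0 : 0 ≤ r)
    (h1 : r < 1) : Summable fun n => 2 * majorant M δ n * r ^ n := by
  simpa [mul_assoc] using (summable_majorant hM hδ r h0 h1).mul_left 2

theorem diskSummable_logCoeff (a b : ℂ) : DiskSummable (logCoeff a b) :=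
  .of_norm_le (summable_two_mul_majorant (M := ‖a‖ + ‖b‖ + 1 / 2) (by positivity) (by norm_num))
    (norm_logCoeff_le (by linarith [norm_nonneg b]) (by linarith [norm_nonneg a]))

theorem logCoeff_zero (a b : ℂ) : logCoeff a b 0 = 0 := by
  simp [logCoeff, poch_zero, pochDeriv_zero, Complex.digamma_one]

/-- Applied to `F(t) log t` with `c = 1`, the hypergeometric operator leaves `2(1-t)F' - (a+b)F`.
The right-hand side lists the coefficients of its negative, so the power series part cancels this
remainder. -/
theorem logCoeff_succ (a b : ℂ) (n : ℕ) :
    (n + 1) * (n + 1) * logCoeff a b (n + 1) - (n + a) * (n + b) * logCoeff a b n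
      = -2 * shift (hcoeff a b 1) n + (a + b) * hcoeff a b 1 n + 2 * (n * hcoeff a b 1 n) := by
  have h3 : (n.factorial : ℂ) ≠ 0 := by exact_mod_cast n.factorial_ne_zero
  have h4 : ((n : ℂ) + 1) ≠ 0 := by exact_mod_cast n.succ_ne_zero
  simp only [logCoeff_eq_pochDeriv, shift, hcoeff, poch_one, pochDeriv_succ, poch_succ,
    Nat.factorial_succ]
  push_cast
  rw [add_comm (1 : ℂ) n]
  field_simp
  ring

theorem y₂_zero_eq {α : ℝ} (z : ℂ) {x : ℝ} (hx : x ∈ Ioo (-1 : ℝ) 1) : y₂ α 0 z x =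
    psum (hcoeff (aPar α 0 (sig α 0 z)) (aPar α 0 (-sig α 0 z)) 1) (((1 + x) / 2 : ℝ) : ℂ)
        * (Real.log ((1 + x) / 2) : ℂ)
      + psum (logCoeff (aPar α 0 (sig α 0 z)) (aPar α 0 (-sig α 0 z)))
        (((1 + x) / 2 : ℝ) : ℂ) := by
  have h := ((diskSummable_logCoeff (aPar α 0 (sig α 0 z)) (aPar α 0 (-sig α 0 z))).summable
    (norm_half_add_lt hx)).tsum_eq_zero_add
  rw [logCoeff_zero, zero_mul, zero_add] at h
  rw [y₂, if_pos rfl, hypergeometric_eq_psum, ← h, psum, psum]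

theorem IsSolution.congr {α β : ℝ} {z : ℂ} {f g : ℝ → ℂ} (hf : IsSolution α β z f)
    (h : ∀ x ∈ Ioo (-1 : ℝ) 1, g x = f x) : IsSolution α β z g := by
  intro x hx
  have e : g =ᶠ[𝓝 x] f := by
    filter_upwards [isOpen_Ioo.mem_nhds hx] with s hs using h s hs
  obtain ⟨h1, h2, h3⟩ := hf x hx
  refine ⟨h1.congr_of_eventuallyEq e, h2.congr_of_eventuallyEq e.deriv, ?_⟩
  rw [e.deriv.deriv_eq, e.deriv_eq, h x hx, h3]

theorem isSolution_y₂_zero (α : ℝ) (z : ℂ) : IsSolution α 0 z (y₂ α 0 z) := by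
  refine IsSolution.congr ?_ fun x hx => y₂_zero_eq z hx
  set a := aPar α 0 (sig α 0 z) with ha
  set b := aPar α 0 (-sig α 0 z) with hb
  have hw : DiskSummable (hcoeff a b 1) := diskSummable_hcoeff a b (by simp)
  have hv : DiskSummable (logCoeff a b) := diskSummable_logCoeff a b
  have hl : ∀ x ∈ Ioo (-1 : ℝ) 1, HasDerivAt (fun x : ℝ => (Real.log ((1 + x) / 2) : ℂ))
      (1 + (x : ℂ))⁻¹ x := by
    intro x hx
    have hpos : (1 + x) ≠ 0 := by linarith [hx.1]
    have h : HasDerivAt (fun x : ℝ => Real.log ((1 + x) / 2)) ((1 / 2) / ((1 + x) / 2)) x :=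
      (((hasDerivAt_id x).const_add 1).div_const 2).log (by simpa using hpos)
    convert! h.ofReal_comp using 1
    have : (1 + (x : ℂ)) ≠ 0 := by exact_mod_cast hpos
    push_cast
    field_simp
  have hi : ∀ x ∈ Ioo (-1 : ℝ) 1, HasDerivAt (fun x : ℝ => (1 + (x : ℂ))⁻¹)
      (-1 / (1 + (x : ℂ)) ^ 2) x := by
    intro x hx
    have : (1 + (x : ℂ)) ≠ 0 := by
      have : (1 + x) ≠ 0 := by linarith [hx.1]
      exact_mod_cast this
    have h1 : HasDerivAt (fun x : ℝ => 1 + (x : ℂ)) 1 x := by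
      simpa using ((hasDerivAt_id x).ofReal_comp).const_add 1
    exact h1.inv this
  have hd := fun x (hx : x ∈ Ioo (-1 : ℝ) 1) => hasDerivAt_psum_half hw (norm_half_add_lt hx)
  have hd' := fun x (hx : x ∈ Ioo (-1 : ℝ) 1) => hasDerivAt_psum_half hw.shift (norm_half_add_lt hx)
  refine IsSolution.of_hasDerivAt
    (fun x hx => ((hd x hx).mul (hl x hx)).add (hasDerivAt_psum_half hv (norm_half_add_lt hx)))
    (fun x hx => ((((hd' x hx).div_const 2).mul (hl x hx)).add ((hd x hx).mul (hi x hx))).add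
      ((hasDerivAt_psum_half hv.shift (norm_half_add_lt hx)).div_const 2)) fun x hx => ?_
  have ht := norm_half_add_lt hx
  have h := hypergeometric_operator_psum hw a b 1 ht
  have h0 : (fun n : ℕ => ((n : ℂ) + 1) * (n + 1) * hcoeff a b 1 (n + 1)
      - (n + a) * (n + b) * hcoeff a b 1 n) = fun n => 0 * hcoeff a b 1 n := by
    funext n; rw [hcoeff_succ a b (by simp) n]; ring
  rw [h0, psum_const_mul, zero_mul] at h
  have k := hypergeometric_operator_psum hv a b 1 ht
  have k0 : (fun n : ℕ => ((n : ℂ) + 1) * (n + 1) * logCoeff a b (n + 1)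
      - (n + a) * (n + b) * logCoeff a b n) = _ := funext fun n => logCoeff_succ a b n
  rw [k0, psum_add ((hw.shift.const_mul _).add (hw.const_mul _)) (hw.nat_mul.const_mul _) ht,
    psum_add (hw.shift.const_mul _) (hw.const_mul _) ht, psum_const_mul, psum_const_mul,
    psum_const_mul, ← mul_psum_shift_eq hw ht] at k
  have e1 : a + b = 1 + α + 0 := by simpa using aPar_add α 0 (sig α 0 z)
  have e2 : a * b = -z := aPar_mul _ _ _
  rw [e1, e2] at h k
  have hne : (1 + (x : ℂ)) ≠ 0 := by
    have : (1 + x) ≠ 0 := by linarith [hx.1]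
    exact_mod_cast this
  simp only [Complex.ofReal_div, Complex.ofReal_add, Complex.ofReal_one, Complex.ofReal_ofNat,
    Complex.ofReal_zero] at h k ⊢
  set ℓ := (Real.log ((1 + x) / 2) : ℂ)
  have e3 : (1 - (x : ℂ) ^ 2) * (-1 / (1 + (x : ℂ)) ^ 2) = -(1 - x) * (1 + (x : ℂ))⁻¹ := by
    field_simp; ring
  have e4 : (x : ℂ) * (1 + (x : ℂ))⁻¹ = 1 - (1 + (x : ℂ))⁻¹ := by field_simp; ring
  have e5 : (x : ℂ) ^ 2 * (1 + (x : ℂ))⁻¹ = x - 1 + (1 + (x : ℂ))⁻¹ := by field_simp; ring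
  -- `h` removes the terms with the logarithm and `k` the inhomogeneous remainder; `e3`, `e4`, `e5`
  -- dispose of the products with `(1+x)⁻¹`.
  linear_combination -ℓ * h - k - psum (hcoeff a b 1) ((1 + (x : ℂ)) / 2) * e3
    + (1 + (α : ℂ)) * psum (hcoeff a b 1) ((1 + (x : ℂ)) / 2) * e4
    + psum (shift (hcoeff a b 1)) ((1 + (x : ℂ)) / 2) * e5

theorem isSolution_y₂ (α : ℝ) {β : ℝ} (hβ : β < 1) (z : ℂ) : IsSolution α β z (y₂ α β z) := by
  by_cases h : β = 0
  · subst h; exact isSolution_y₂_zero α z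
  · exact (isSolution_y₁ α (by linarith) _).one_add_rpow_mul.congr
      fun x _ => y₂_eq_rpow_mul h z x

/-! ### The left end point -/

theorem Ioo_mem_nhdsGT_neg_one : Ioo (-1 : ℝ) 1 ∈ 𝓝[>] (-1 : ℝ) :=
  Ioo_mem_nhdsGT (by norm_num)

theorem Ioo_mem_nhdsLT_one : Ioo (-1 : ℝ) 1 ∈ 𝓝[<] (1 : ℝ) :=
  Ioo_mem_nhdsLT (by norm_num)

theorem tendsto_one_add_rpow {s : ℝ} (hs : 0 < s) :
    Tendsto (fun x : ℝ => (((1 + x) ^ s : ℝ) : ℂ)) (𝓝[>] (-1)) (𝓝 0) := by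
  have h : ContinuousAt (fun x : ℝ => (1 + x) ^ s) (-1) :=
    (continuousAt_const.add continuousAt_id).rpow_const (Or.inr hs.le)
  have h2 : Tendsto (fun x : ℝ => (1 + x) ^ s) (𝓝[>] (-1)) (𝓝 0) := by
    have := h.tendsto.mono_left (nhdsWithin_le_nhds (s := Ioi (-1)))
    simpa [Real.zero_rpow hs.ne'] using this
  exact_mod_cast (Complex.continuous_ofReal.tendsto 0).comp h2

theorem tendsto_one_sub_rpow_left (s : ℝ) :
    Tendsto (fun x : ℝ => (((1 - x) ^ s : ℝ) : ℂ)) (𝓝[>] (-1)) (𝓝 ((2 ^ s : ℝ) : ℂ)) := by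
  have h : ContinuousAt (fun x : ℝ => (1 - x) ^ s) (-1) :=
    (continuousAt_const.sub continuousAt_id).rpow_const (Or.inl (by norm_num))
  have h2 : Tendsto (fun x : ℝ => (1 - x) ^ s) (𝓝[>] (-1)) (𝓝 (2 ^ s)) := by
    have := h.tendsto.mono_left (nhdsWithin_le_nhds (s := Ioi (-1)))
    rwa [show (1 : ℝ) - -1 = 2 by norm_num] at this
  exact (Complex.continuous_ofReal.tendsto _).comp h2

theorem tendsto_one_add_mul_log :
    Tendsto (fun x : ℝ => (((1 + x) * Real.log ((1 + x) / 2) : ℝ) : ℂ)) (𝓝[>] (-1)) (𝓝 0) := by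
  have h : Continuous fun x : ℝ => 2 * (((1 + x) / 2) * Real.log ((1 + x) / 2)) :=
    continuous_const.mul (Real.continuous_mul_log.comp (by fun_prop))
  have h2 := (h.tendsto (-1)).mono_left (nhdsWithin_le_nhds (s := Ioi (-1)))
  have h3 : Tendsto (fun x : ℝ => (1 + x) * Real.log ((1 + x) / 2)) (𝓝[>] (-1)) (𝓝 0) := by
    convert! h2 using 1
    · funext x; ring
    · norm_num
  exact_mod_cast (Complex.continuous_ofReal.tendsto 0).comp h3

theorem tendsto_log_half_add : Tendsto (fun x : ℝ => Real.log ((1 + x) / 2)) (𝓝[>] (-1)) atBot := by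
  refine Real.tendsto_log_nhdsGT_zero.comp ?_
  refine tendsto_nhdsWithin_iff.2 ⟨?_, ?_⟩
  · have h : Continuous fun x : ℝ => (1 + x) / 2 := by fun_prop
    have := (h.tendsto (-1)).mono_left (nhdsWithin_le_nhds (s := Ioi (-1)))
    simpa using this
  · filter_upwards [self_mem_nhdsWithin] with x hx
    have : -1 < x := hx
    simp only [mem_Ioi]; linarith

theorem tendsto_inv_log_half_add :
    Tendsto (fun x : ℝ => ((Real.log ((1 + x) / 2) : ℝ) : ℂ)⁻¹) (𝓝[>] (-1)) (𝓝 0) := by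
  have h := tendsto_inv_atBot_zero.comp tendsto_log_half_add
  have := (Complex.continuous_ofReal.tendsto 0).comp h
  simpa [Function.comp_def] using this

theorem hasDerivAt_y₁ (α : ℝ) {β : ℝ} (hβ : -1 < β) (z : ℂ) {x : ℝ}
    (hx : ‖(((1 + x) / 2 : ℝ) : ℂ)‖ < 1) : HasDerivAt (y₁ α β z)
      (psum (shift (hcoeff (aPar α β (sig α β z)) (aPar α β (-sig α β z)) (1 + β)))
        (((1 + x) / 2 : ℝ) : ℂ) / 2) x := by
  rw [show y₁ α β z = _ from funext (y₁_eq_psum α β z)]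
  exact hasDerivAt_psum_half (diskSummable_hcoeff _ _ (by simp; linarith)) hx

theorem y₁_neg_one (α β : ℝ) (z : ℂ) : y₁ α β z (-1) = 1 := by
  simp [y₁_eq_psum, psum_zero, hcoeff_zero]

theorem tendsto_y₁_left (α : ℝ) {β : ℝ} (hβ : -1 < β) (z : ℂ) :
    Tendsto (y₁ α β z) (𝓝[>] (-1)) (𝓝 1) := by
  have h := (hasDerivAt_y₁ α hβ z (x := -1) (by simp)).continuousAt.tendsto
  rw [y₁_neg_one] at h
  exact h.mono_left nhdsWithin_le_nhds

theorem tendsto_deriv_y₁_left (α : ℝ) {β : ℝ} (hβ : -1 < β) (z : ℂ) :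
    ∃ d, Tendsto (deriv (y₁ α β z)) (𝓝[>] (-1)) (𝓝 d) := by
  have hw : DiskSummable (hcoeff (aPar α β (sig α β z)) (aPar α β (-sig α β z)) (1 + β)) :=
    diskSummable_hcoeff _ _ (by simp; linarith)
  have h := ((hasDerivAt_psum_half hw.shift (x := -1) (by simp)).div_const 2).continuousAt.tendsto
  refine ⟨_, (h.mono_left nhdsWithin_le_nhds).congr' ?_⟩
  filter_upwards [Ioo_mem_nhdsGT_neg_one] with x hx
  exact (hasDerivAt_y₁ α hβ z (norm_half_add_lt hx)).deriv.symm

theorem tendsto_slope_y₁_left (α : ℝ) {β : ℝ} (hβ : -1 < β) (z : ℂ) :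
    ∃ d, Tendsto (fun x : ℝ => (y₁ α β z x - 1) / (1 + x : ℝ)) (𝓝[>] (-1)) (𝓝 d) := by
  have h := (hasDerivAt_y₁ α hβ z (x := -1) (by simp))
  rw [hasDerivAt_iff_tendsto_slope] at h
  refine ⟨_, (h.mono_left (nhdsWithin_mono _ fun x hx => ?_)).congr fun x => ?_⟩
  · exact ne_of_gt hx
  · rw [slope_def_module, y₁_neg_one, sub_neg_eq_add, add_comm x, Complex.real_smul, div_eq_inv_mul]
    push_cast
    rfl

/-- `y₁ - 1` vanishes to first order at `-1`, so it absorbs both kinds of singular factor used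
below, `ln ((1+x)/2)` and `(1+x)^{-β}` with `β < 1`. -/
theorem tendsto_y₁_sub_one_mul {φ : ℝ → ℂ} (α : ℝ) {β : ℝ} (hβ : -1 < β) (z : ℂ)
    (hφ : Tendsto (fun x : ℝ => ((1 + x : ℝ) : ℂ) * φ x) (𝓝[>] (-1)) (𝓝 0)) :
    Tendsto (fun x : ℝ => (y₁ α β z x - 1) * φ x) (𝓝[>] (-1)) (𝓝 0) := by
  obtain ⟨d, hd⟩ := tendsto_slope_y₁_left α hβ z
  have h := hd.mul hφ
  rw [mul_zero] at h
  refine h.congr' ?_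
  filter_upwards [self_mem_nhdsWithin] with x hx
  have h0 : ((1 + x : ℝ) : ℂ) ≠ 0 := by
    have : -1 < x := hx
    exact_mod_cast (by linarith : (1 + x) ≠ 0)
  field_simp

theorem one_add_mul_rpow {x : ℝ} (hx : -1 < x) (s : ℝ) :
    ((1 + x : ℝ) : ℂ) * (((1 + x) ^ s : ℝ) : ℂ) = (((1 + x) ^ (1 + s) : ℝ) : ℂ) := by
  rw [Real.rpow_add (by linarith), Real.rpow_one]
  push_cast; ring

theorem rpow_mul_rpow_cast {u : ℝ} (hu : 0 < u) (s t : ℝ) :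
    ((u ^ s : ℝ) : ℂ) * ((u ^ t : ℝ) : ℂ) = ((u ^ (s + t) : ℝ) : ℂ) := by
  rw [Real.rpow_add hu]; push_cast; rfl

theorem tendsto_one_add_mul_rpow {s : ℝ} (hs : -1 < s) :
    Tendsto (fun x : ℝ => ((1 + x : ℝ) : ℂ) * (((1 + x) ^ s : ℝ) : ℂ)) (𝓝[>] (-1)) (𝓝 0) := by
  refine (tendsto_one_add_rpow (s := 1 + s) (by linarith)).congr' ?_
  filter_upwards [self_mem_nhdsWithin] with x hx
  rw [one_add_mul_rpow hx]

/-- `y₂` behaves like `ln ((1 + x)/2)` at `-1` when `β = 0`. -/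
theorem tendsto_y₂_sub_log (α : ℝ) (z : ℂ) :
    Tendsto (fun x : ℝ => y₂ α 0 z x - (Real.log ((1 + x) / 2) : ℂ)) (𝓝[>] (-1)) (𝓝 0) := by
  have h1 := tendsto_y₁_sub_one_mul α (by norm_num : (-1 : ℝ) < 0) z
    (φ := fun x => (Real.log ((1 + x) / 2) : ℂ)) (by exact_mod_cast tendsto_one_add_mul_log)
  have h2 := (hasDerivAt_psum_half (diskSummable_logCoeff (aPar α 0 (sig α 0 z))
    (aPar α 0 (-sig α 0 z))) (x := -1) (by simp)).continuousAt.tendsto.mono_left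
      (nhdsWithin_le_nhds (s := Ioi (-1)))
  have h3 := h1.add h2
  simp only [add_neg_cancel, zero_div, Complex.ofReal_zero, psum_zero, logCoeff_zero,
    add_zero] at h3
  refine h3.congr' ?_
  filter_upwards [Ioo_mem_nhdsGT_neg_one] with x hx
  rw [y₂_zero_eq z hx, y₁_eq_psum]
  simp only [Complex.ofReal_zero, add_zero]
  ring

/-- `y₂` behaves like `(1 + x)^{-β}` at `-1` when `β ≠ 0`. -/
theorem tendsto_y₂_sub_rpow (α : ℝ) {β : ℝ} (h0 : β ≠ 0) (hβ : β < 1) (z : ℂ) :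
    Tendsto (fun x : ℝ => y₂ α β z x - (((1 + x) ^ (-β) : ℝ) : ℂ)) (𝓝[>] (-1)) (𝓝 0) := by
  have h1 := tendsto_y₁_sub_one_mul α (by linarith : (-1 : ℝ) < -β) (z + β * (1 + α))
    (tendsto_one_add_mul_rpow (s := -β) (by linarith))
  refine h1.congr fun x => ?_
  rw [y₂_eq_rpow_mul h0]
  ring

/-- The limit of the quasi-derivative of `y₂` at `-1`. -/
def leadingCoeff (α β : ℝ) : ℝ := if β = 0 then 2 ^ (α + 1) else -β * 2 ^ (α + 1)

theorem leadingCoeff_ne_zero (α β : ℝ) : leadingCoeff α β ≠ 0 := by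
  unfold leadingCoeff
  split_ifs with h
  · positivity
  · exact mul_ne_zero (neg_ne_zero.2 h) (by positivity)

/-- The weight cancels the singularity exactly. For `β ≠ 0`, `(1+x)^{β+1} ((1+x)^{-β} y)' = -β y +
(1+x) y'`. For `β = 0`, only `(1+x)` times the derivative of the logarithm survives. -/
theorem tendsto_quasiDeriv_y₂_left (α : ℝ) {β : ℝ} (hβ : β < 1) (z : ℂ) :
    Tendsto (quasiDeriv α β (y₂ α β z)) (𝓝[>] (-1)) (𝓝 (leadingCoeff α β)) := by
  by_cases h0 : β = 0
  · subst h0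
    have hw : DiskSummable (hcoeff (aPar α 0 (sig α 0 z)) (aPar α 0 (-sig α 0 z)) 1) :=
      diskSummable_hcoeff _ _ (by simp)
    have hv := diskSummable_logCoeff (aPar α 0 (sig α 0 z)) (aPar α 0 (-sig α 0 z))
    have c : ∀ {w : ℕ → ℂ}, DiskSummable w →
        Tendsto (fun x : ℝ => psum w (((1 + x) / 2 : ℝ) : ℂ)) (𝓝[>] (-1)) (𝓝 (w 0)) := by
      intro w hw
      have := (hasDerivAt_psum_half hw (x := -1) (by simp)).continuousAt.tendsto.mono_left
        (nhdsWithin_le_nhds (s := Ioi (-1)))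
      simpa [psum_zero] using this
    have hx1 : Tendsto (fun x : ℝ => ((1 + x : ℝ) : ℂ)) (𝓝[>] (-1)) (𝓝 0) := by
      simpa using tendsto_one_add_rpow one_pos
    have h := (tendsto_one_sub_rpow_left (α + 1)).mul
      (((((c hw.shift).div_const 2).mul tendsto_one_add_mul_log).add (c hw)).add
        (hx1.mul ((c hv.shift).div_const 2)))
    rw [leadingCoeff, if_pos rfl]
    simp only [mul_zero, hcoeff_zero, zero_add, zero_mul, add_zero, mul_one] at h
    refine h.congr' ?_
    filter_upwards [Ioo_mem_nhdsGT_neg_one] with x hx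
    have hpos : (1 + x) ≠ 0 := by linarith [hx.1]
    have hl : HasDerivAt (fun x : ℝ => (Real.log ((1 + x) / 2) : ℂ)) (1 + (x : ℂ))⁻¹ x := by
      have h : HasDerivAt (fun x : ℝ => Real.log ((1 + x) / 2)) ((1 / 2) / ((1 + x) / 2)) x :=
        (((hasDerivAt_id x).const_add 1).div_const 2).log (by simpa using hpos)
      convert! h.ofReal_comp using 1
      have : (1 + (x : ℂ)) ≠ 0 := by exact_mod_cast hpos
      push_cast
      field_simp
    have hd := ((hasDerivAt_psum_half hw (norm_half_add_lt hx)).mul hl).add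
      (hasDerivAt_psum_half hv (norm_half_add_lt hx))
    have hd' : HasDerivAt (y₂ α 0 z) _ x := hd.congr_of_eventuallyEq (by
      filter_upwards [isOpen_Ioo.mem_nhds hx] with s hs using y₂_zero_eq z hs)
    rw [quasiDeriv, hd'.deriv]
    have : (1 + (x : ℂ)) ≠ 0 := by exact_mod_cast hpos
    push_cast
    rw [zero_add, Real.rpow_one]
    push_cast
    field_simp
  · have hβ' : -1 < -β := by linarith
    obtain ⟨d, hd⟩ := tendsto_deriv_y₁_left α hβ' (z + β * (1 + α))
    have hx1 : Tendsto (fun x : ℝ => ((1 + x : ℝ) : ℂ)) (𝓝[>] (-1)) (𝓝 0) := by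
      simpa using tendsto_one_add_rpow one_pos
    have h := (tendsto_one_sub_rpow_left (α + 1)).mul
      (((tendsto_y₁_left α hβ' (z + β * (1 + α))).const_mul (-β : ℂ)).add (hx1.mul hd))
    rw [leadingCoeff, if_neg h0]
    simp only [zero_mul, add_zero, mul_one] at h
    have e0 : (((2 ^ (α + 1) : ℝ) : ℂ) * (-β)) = ((-β * 2 ^ (α + 1) : ℝ) : ℂ) := by
      push_cast; ring
    rw [e0] at h
    refine h.congr' ?_
    filter_upwards [Ioo_mem_nhdsGT_neg_one] with x hx
    have hpos : 0 < 1 + x := by linarith [hx.1]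
    have h1 : HasDerivAt (fun x : ℝ => (1 + x) ^ (-β)) (1 * -β * (1 + x) ^ (-β - 1)) x :=
      ((hasDerivAt_id x).const_add 1).rpow_const (Or.inl (by simpa using hpos.ne'))
    have h2 := h1.ofReal_comp.mul
      (isSolution_y₁ α hβ' (z + β * (1 + α)) x hx).1.hasDerivAt
    rw [quasiDeriv, show y₂ α β z = _ from funext (y₂_eq_rpow_mul h0 z)]
    have h2' := h2.deriv
    simp only [Pi.mul_def] at h2'
    rw [h2']
    have e1 := rpow_mul_rpow_cast hpos (β + 1) (-β - 1)
    have e2 := rpow_mul_rpow_cast hpos (β + 1) (-β)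
    rw [show β + 1 + (-β - 1) = 0 by ring, Real.rpow_zero, Complex.ofReal_one] at e1
    rw [show β + 1 + (-β) = 1 by ring, Real.rpow_one] at e2
    push_cast at e1 e2 ⊢
    linear_combination (-(((1 - x) ^ (α + 1) : ℝ) : ℂ)) * (-β *
      y₁ α (-β) (z + β * (1 + α)) x * e1 + deriv (y₁ α (-β) (z + β * (1 + α))) x * e2)

/-- This disposes of the term `g^{[1]} y₂` in the Wronskian of `y₂` with a function `g` whose
derivative has a limit at `-1`. -/
theorem tendsto_one_add_rpow_mul_y₂ (α : ℝ) {β : ℝ} (hβ : β ∈ Ioo (-1 : ℝ) 1) (z : ℂ) :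
    Tendsto (fun x : ℝ => (((1 + x) ^ (β + 1) : ℝ) : ℂ) * y₂ α β z x) (𝓝[>] (-1)) (𝓝 0) := by
  have hp := tendsto_one_add_rpow (s := β + 1) (by linarith [hβ.1])
  by_cases h0 : β = 0
  · subst h0
    have h := (hp.mul (tendsto_y₂_sub_log α z)).add tendsto_one_add_mul_log
    simp only [mul_zero, add_zero] at h
    refine h.congr fun x => ?_
    simp only [zero_add, Real.rpow_one]
    push_cast
    ring
  · have h := (hp.mul (tendsto_y₂_sub_rpow α h0 hβ.2 z)).add (tendsto_one_add_rpow one_pos)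
    simp only [mul_zero, add_zero] at h
    refine h.congr' ?_
    filter_upwards [Ioo_mem_nhdsGT_neg_one] with x hx
    have e2 := rpow_mul_rpow_cast (by linarith [hx.1] : 0 < 1 + x) (β + 1) (-β)
    rw [show β + 1 + (-β) = 1 by ring] at e2
    rw [← e2]
    ring

theorem tendsto_quasiDeriv_left_of_tendsto_deriv (α : ℝ) {β : ℝ} (hβ : -1 < β) {g : ℝ → ℂ} {d : ℂ}
    (hd : Tendsto (deriv g) (𝓝[>] (-1)) (𝓝 d)) :
    Tendsto (quasiDeriv α β g) (𝓝[>] (-1)) (𝓝 0) := by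
  have h := ((tendsto_one_sub_rpow_left (α + 1)).mul
    (tendsto_one_add_rpow (s := β + 1) (by linarith))).mul hd
  simp only [mul_zero, zero_mul] at h
  refine h.congr fun x => ?_
  rw [quasiDeriv]; push_cast; rfl

theorem hasBdryLeft_y₁_of_neg (α : ℝ) {β : ℝ} (hβ : -1 < β) (h : β < 0) (z : ℂ) :
    HasBdryLeft α β (y₁ α β z) 1 0 := by
  obtain ⟨d, hd⟩ := tendsto_deriv_y₁_left α hβ z
  rw [HasBdryLeft, if_pos h]
  exact ⟨tendsto_y₁_left α hβ z, tendsto_quasiDeriv_left_of_tendsto_deriv α hβ hd⟩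

theorem hasBdryLeft_y₁_of_nonneg (α : ℝ) {β : ℝ} (h : 0 ≤ β) (z : ℂ) :
    HasBdryLeft α β (y₁ α β z) 0 1 := by
  have h1 := tendsto_y₁_left α (by linarith : -1 < β) z
  rw [HasBdryLeft, if_neg (not_lt.2 h)]
  simp only [zero_mul, add_zero, sub_zero]
  split_ifs with h0
  · refine ⟨?_, h1⟩
    have := (h1.mul tendsto_inv_log_half_add).const_mul (-((2 ^ (α + 1) : ℝ) : ℂ))
    simpa only [mul_zero, div_eq_mul_inv] using this
  · refine ⟨?_, h1⟩
    have := ((tendsto_one_add_rpow (s := β) (lt_of_le_of_ne h (Ne.symm h0))).const_mul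
      ((β * 2 ^ (α + 1) : ℝ) : ℂ)).mul h1
    simp only [mul_zero, zero_mul] at this
    refine this.congr fun x => ?_
    push_cast; ring

theorem hasBdryLeft_y₂_of_neg (α : ℝ) {β : ℝ} (h : β < 0) (z : ℂ) :
    HasBdryLeft α β (y₂ α β z) 0 ((-β * 2 ^ (α + 1) : ℝ) : ℂ) := by
  rw [HasBdryLeft, if_pos h]
  constructor
  · have := (tendsto_y₂_sub_rpow α h.ne (by linarith) z).add
      (tendsto_one_add_rpow (s := -β) (by linarith))
    simpa using this
  · have := tendsto_quasiDeriv_y₂_left α (by linarith : β < 1) z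
    rwa [leadingCoeff, if_neg h.ne] at this

theorem hasBdryLeft_y₂_zero (α : ℝ) (z : ℂ) :
    HasBdryLeft α 0 (y₂ α 0 z) ((-2 ^ (α + 1) : ℝ) : ℂ) 0 := by
  rw [HasBdryLeft, if_neg (lt_irrefl 0), if_pos rfl]
  have h1 := tendsto_y₂_sub_log α z
  constructor
  · have h := ((h1.mul tendsto_inv_log_half_add).add_const 1).const_mul (-((2 ^ (α + 1) : ℝ) : ℂ))
    simp only [mul_zero, zero_add, mul_one] at h
    rw [Complex.ofReal_neg]
    refine h.congr' ?_
    filter_upwards [tendsto_log_half_add.eventually (eventually_lt_atBot 0)] with x hx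
    have : ((Real.log ((1 + x) / 2) : ℝ) : ℂ) ≠ 0 := by exact_mod_cast hx.ne
    field_simp
    ring
  · refine h1.congr fun x => ?_
    have : (((2 : ℝ) ^ (α + 1) : ℝ) : ℂ) * ((2 ^ (-α - 1) : ℝ) : ℂ) = 1 := by
      rw [rpow_mul_rpow_cast two_pos, show α + 1 + (-α - 1) = 0 by ring]; simp
    push_cast at this ⊢
    linear_combination (Real.log ((1 + x) / 2) : ℂ) * this

theorem hasBdryLeft_y₂_of_pos (α : ℝ) {β : ℝ} (h : 0 < β) (hβ : β < 1) (z : ℂ) :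
    HasBdryLeft α β (y₂ α β z) ((β * 2 ^ (α + 1) : ℝ) : ℂ) 0 := by
  rw [HasBdryLeft, if_neg (not_lt.2 h.le), if_neg h.ne']
  have h1 := tendsto_y₂_sub_rpow α h.ne' hβ z
  constructor
  · have h2 := (((tendsto_one_add_rpow (s := β) h).mul h1).add_const 1).const_mul
      ((β * 2 ^ (α + 1) : ℝ) : ℂ)
    simp only [mul_zero, zero_add, mul_one] at h2
    refine h2.congr' ?_
    filter_upwards [self_mem_nhdsWithin] with x hx
    have hx' : -1 < x := hx
    have e := rpow_mul_rpow_cast (by linarith : 0 < 1 + x) β (-β)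
    rw [add_neg_cancel, Real.rpow_zero] at e
    push_cast at e ⊢
    linear_combination (-(β * ((2 ^ (α + 1) : ℝ) : ℂ))) * e
  · refine h1.congr fun x => ?_
    have : (((2 : ℝ) ^ (α + 1) : ℝ) : ℂ) * ((2 ^ (-α - 1) : ℝ) : ℂ) = 1 := by
      rw [rpow_mul_rpow_cast two_pos, show α + 1 + (-α - 1) = 0 by ring]; simp
    have hb : (β : ℂ) * (β : ℂ)⁻¹ = 1 := mul_inv_cancel₀ (by exact_mod_cast h.ne')
    push_cast at this ⊢
    linear_combination (((1 + x) ^ (-β) : ℝ) : ℂ) * ((β : ℂ) * (β : ℂ)⁻¹ * this + hb)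

/-! ### Wronskians -/

/-- The modified Wronskian `f g^{[1]} - f^{[1]} g`. -/
def wronskian (α β : ℝ) (f g : ℝ → ℂ) (x : ℝ) : ℂ :=
  f x * quasiDeriv α β g x - quasiDeriv α β f x * g x

/-- Pearson's relation for the Jacobi weight. It puts the equation in Sturm–Liouville form, which is
why the modified Wronskian of two solutions is constant. -/
theorem hasDerivAt_weight (α β : ℝ) {x : ℝ} (hx : x ∈ Ioo (-1 : ℝ) 1) :
    ∃ p' : ℂ, HasDerivAt (fun x : ℝ => (((1 - x) ^ (α + 1) * (1 + x) ^ (β + 1) : ℝ) : ℂ)) p' x ∧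
      (1 - (x : ℂ) ^ 2) * p' =
        (((1 - x) ^ (α + 1) * (1 + x) ^ (β + 1) : ℝ) : ℂ) * (β - α - (α + β + 2) * x) := by
  have h1 : 0 < 1 - x := by linarith [hx.2]
  have h2 : 0 < 1 + x := by linarith [hx.1]
  have d1 : HasDerivAt (fun x : ℝ => (1 - x) ^ (α + 1)) (-1 * (α + 1) * (1 - x) ^ (α + 1 - 1)) x :=
    ((hasDerivAt_id x).const_sub 1).rpow_const (Or.inl h1.ne')
  have d2 : HasDerivAt (fun x : ℝ => (1 + x) ^ (β + 1)) (1 * (β + 1) * (1 + x) ^ (β + 1 - 1)) x :=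
    ((hasDerivAt_id x).const_add 1).rpow_const (Or.inl h2.ne')
  refine ⟨_, (d1.mul d2).ofReal_comp, ?_⟩
  rw [Real.rpow_sub_one h1.ne', Real.rpow_sub_one h2.ne']
  have h1' : (1 - (x : ℂ)) ≠ 0 := by exact_mod_cast h1.ne'
  have h2' : (1 + (x : ℂ)) ≠ 0 := by exact_mod_cast h2.ne'
  push_cast
  field_simp
  ring

theorem one_sub_sq_ne_zero {x : ℝ} (hx : x ∈ Ioo (-1 : ℝ) 1) : (1 - (x : ℂ) ^ 2) ≠ 0 := by
  have : 1 - x ^ 2 ≠ 0 := by nlinarith [hx.1, hx.2]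
  exact_mod_cast this

theorem IsSolution.exists_wronskian_eq {α β : ℝ} {z : ℂ} {f g : ℝ → ℂ} (hf : IsSolution α β z f)
    (hg : IsSolution α β z g) : ∃ c, ∀ x ∈ Ioo (-1 : ℝ) 1, wronskian α β f g x = c := by
  have key : ∀ x ∈ Ioo (-1 : ℝ) 1, HasDerivAt (wronskian α β f g) 0 x := by
    intro x hx
    obtain ⟨p', hp, hp'⟩ := hasDerivAt_weight α β hx
    obtain ⟨f1, f2, f3⟩ := hf x hx
    obtain ⟨g1, g2, g3⟩ := hg x hx
    have h := (f1.hasDerivAt.mul (hp.mul g2.hasDerivAt)).sub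
      ((hp.mul f2.hasDerivAt).mul g1.hasDerivAt)
    convert! h using 1
    refine mul_left_cancel₀ (one_sub_sq_ne_zero hx) ?_
    set p := (((1 - x) ^ (α + 1) * (1 + x) ^ (β + 1) : ℝ) : ℂ)
    simp only [Pi.mul_apply]
    linear_combination p * f x * g3 - p * g x * f3
      - (f x * deriv g x - deriv f x * g x) * hp'
  exact isOpen_Ioo.exists_is_const_of_deriv_eq_zero isPreconnected_Ioo
    (fun x hx => (key x hx).differentiableAt.differentiableWithinAt) fun x hx => (key x hx).deriv

theorem IsSolution.wronskian_eq_of_tendsto {α β : ℝ} {z : ℂ} {f g : ℝ → ℂ}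
    (hf : IsSolution α β z f) (hg : IsSolution α β z g) {c : ℂ}
    (h : Tendsto (wronskian α β f g) (𝓝[>] (-1)) (𝓝 c)) :
    ∀ x ∈ Ioo (-1 : ℝ) 1, wronskian α β f g x = c := by
  obtain ⟨d, hd⟩ := hf.exists_wronskian_eq hg
  have h2 : Tendsto (wronskian α β f g) (𝓝[>] (-1)) (𝓝 d) := by
    refine tendsto_const_nhds.congr' ?_
    filter_upwards [Ioo_mem_nhdsGT_neg_one] with x hx using (hd x hx).symm
  rw [tendsto_nhds_unique h h2]
  exact hd

/-- Expansion of a solution in a fundamental system. -/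
theorem IsSolution.exists_eq_add {α β : ℝ} {z : ℂ} {g f₁ f₂ : ℝ → ℂ} (hg : IsSolution α β z g)
    (h₁ : IsSolution α β z f₁) (h₂ : IsSolution α β z f₂) {c : ℂ} (hc : c ≠ 0)
    (hw : ∀ x ∈ Ioo (-1 : ℝ) 1, wronskian α β f₁ f₂ x = c) :
    ∃ A B : ℂ, (∀ x ∈ Ioo (-1 : ℝ) 1, g x = A * f₁ x + B * f₂ x) ∧
      (∀ x ∈ Ioo (-1 : ℝ) 1, wronskian α β g f₂ x = A * c) ∧
      (∀ x ∈ Ioo (-1 : ℝ) 1, wronskian α β f₁ g x = B * c) := by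
  obtain ⟨p, hp⟩ := hg.exists_wronskian_eq h₂
  obtain ⟨q, hq⟩ := h₁.exists_wronskian_eq hg
  refine ⟨p / c, q / c, fun x hx => ?_, fun x hx => by rw [hp x hx]; field_simp,
    fun x hx => by rw [hq x hx]; field_simp⟩
  have e1 := hp x hx
  have e2 := hq x hx
  have e3 := hw x hx
  field_simp
  simp only [wronskian] at e1 e2 e3
  -- The pointwise identity `g W(f₁,f₂) = f₁ W(g,f₂) + f₂ W(f₁,g)`; the coefficients are therefore
  -- quotients of constant Wronskians.
  linear_combination f₁ x * e1 + f₂ x * e2 - g x * e3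

theorem wronskian_self (α β : ℝ) (f : ℝ → ℂ) (x : ℝ) : wronskian α β f f x = 0 := by
  simp only [wronskian]; ring

theorem tendsto_wronskian_y₂ {α β : ℝ} (hβ : β ∈ Ioo (-1 : ℝ) 1) (z : ℂ) {g : ℝ → ℂ} {ℓ d : ℂ}
    (hg : Tendsto g (𝓝[>] (-1)) (𝓝 ℓ)) (hd : Tendsto (deriv g) (𝓝[>] (-1)) (𝓝 d)) :
    Tendsto (wronskian α β g (y₂ α β z)) (𝓝[>] (-1)) (𝓝 (ℓ * leadingCoeff α β)) := by
  have h1 := hg.mul (tendsto_quasiDeriv_y₂_left α hβ.2 z)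
  have h2 := ((tendsto_one_sub_rpow_left (α + 1)).mul hd).mul (tendsto_one_add_rpow_mul_y₂ α hβ z)
  have h3 := h1.sub h2
  rw [mul_zero, sub_zero] at h3
  refine h3.congr fun x => ?_
  simp only [wronskian, quasiDeriv]
  push_cast
  ring

theorem wronskian_y₁_y₂ (α : ℝ) {β : ℝ} (hβ : β ∈ Ioo (-1 : ℝ) 1) (z : ℂ) :
    ∀ x ∈ Ioo (-1 : ℝ) 1, wronskian α β (y₁ α β z) (y₂ α β z) x = leadingCoeff α β := by
  obtain ⟨d, hd⟩ := tendsto_deriv_y₁_left α hβ.1 z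
  have h := tendsto_wronskian_y₂ (α := α) hβ z (tendsto_y₁_left α hβ.1 z) hd
  rw [one_mul] at h
  exact (isSolution_y₁ α hβ.1 z).wronskian_eq_of_tendsto (isSolution_y₂ α hβ.2 z) h

/-! ### Reflection -/

theorem neg_mem_Ioo {x : ℝ} (hx : x ∈ Ioo (-1 : ℝ) 1) : -x ∈ Ioo (-1 : ℝ) 1 :=
  ⟨by linarith [hx.2], by linarith [hx.1]⟩

theorem IsSolution.comp_neg {α β : ℝ} {z : ℂ} {f : ℝ → ℂ} (hf : IsSolution β α z f) :
    IsSolution α β z fun x => f (-x) := by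
  refine IsSolution.of_hasDerivAt (y' := fun x => -deriv f (-x))
    (y'' := fun x => deriv (deriv f) (-x)) (fun x hx => ?_) (fun x hx => ?_) fun x hx => ?_
  · have := (hf _ (neg_mem_Ioo hx)).1.hasDerivAt.scomp x (hasDerivAt_neg x)
    simpa [Function.comp_def] using this
  · have := ((hf _ (neg_mem_Ioo hx)).2.1.hasDerivAt.scomp x (hasDerivAt_neg x)).neg
    simpa [Function.comp_def, Pi.neg_def] using this
  · have := (hf _ (neg_mem_Ioo hx)).2.2
    push_cast at this
    linear_combination this

theorem quasiDeriv_comp_neg (α β : ℝ) (f : ℝ → ℂ) (x : ℝ) :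
    quasiDeriv α β (fun x => f (-x)) x = -quasiDeriv β α f (-x) := by
  rw [quasiDeriv, quasiDeriv, deriv_comp_neg, mul_comm ((1 - x) ^ (α + 1))]
  simp only [sub_neg_eq_add, mul_neg, ← sub_eq_add_neg]

theorem wronskian_comp_neg (α β : ℝ) (f g : ℝ → ℂ) (x : ℝ) :
    wronskian α β (fun x => f (-x)) (fun x => g (-x)) x = -wronskian β α f g (-x) := by
  simp only [wronskian, quasiDeriv_comp_neg]; ring

/-- Reflection reverses the sign of the quasi-derivative, which affects the second value when `α <
0`. For `α ≥ 0` the normalizations of the first value at `-1` and at `1` have opposite signs. -/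
theorem HasBdryLeft.comp_neg {α β : ℝ} {g : ℝ → ℂ} {v v' : ℂ} (h : HasBdryLeft β α g v v') :
    HasBdryRight α β (fun x => g (-x)) (if α < 0 then v else -v) (if α < 0 then -v' else v') := by
  have hn : Tendsto (fun x : ℝ => -x) (𝓝[<] 1) (𝓝[>] (-1)) := tendsto_neg_nhdsLT
  rw [HasBdryLeft] at h
  rw [HasBdryRight]
  by_cases h1 : α < 0
  · simp only [if_pos h1] at h ⊢
    refine ⟨h.1.comp hn, (h.2.comp hn).neg.congr fun x => ?_⟩
    rw [quasiDeriv_comp_neg]; rfl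
  · simp only [if_neg h1] at h ⊢
    by_cases h2 : α = 0
    · simp only [if_pos h2] at h ⊢
      refine ⟨(h.1.comp hn).neg.congr fun x => ?_, (h.2.comp hn).congr fun x => ?_⟩
      · simp only [Function.comp, ← sub_eq_add_neg]; ring
      · simp only [Function.comp, ← sub_eq_add_neg]; ring
    · simp only [if_neg h2] at h ⊢
      refine ⟨(h.1.comp hn).neg.congr fun x => ?_, (h.2.comp hn).congr fun x => ?_⟩
      · simp only [Function.comp, ← sub_eq_add_neg]; push_cast; ring
      · simp only [Function.comp, ← sub_eq_add_neg]; ring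

/-! ### The fundamental system at the right end point -/

/-- The solution regular at `1`. -/
def r₁ (α β : ℝ) (z : ℂ) (x : ℝ) : ℂ := y₁ β α z (-x)

/-- The second solution of the fundamental system at `1`. -/
def r₂ (α β : ℝ) (z : ℂ) (x : ℝ) : ℂ := y₂ β α z (-x)

theorem isSolution_r₁ {α : ℝ} (β : ℝ) (hα : -1 < α) (z : ℂ) : IsSolution α β z (r₁ α β z) :=
  (isSolution_y₁ β hα z).comp_neg

theorem isSolution_r₂ {α : ℝ} (β : ℝ) (hα : α < 1) (z : ℂ) : IsSolution α β z (r₂ α β z) :=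
  (isSolution_y₂ β hα z).comp_neg

theorem wronskian_r₁_r₂ {α : ℝ} (β : ℝ) (hα : α ∈ Ioo (-1 : ℝ) 1) (z : ℂ) :
    ∀ x ∈ Ioo (-1 : ℝ) 1, wronskian α β (r₁ α β z) (r₂ α β z) x = -leadingCoeff β α :=
  fun x hx => (wronskian_comp_neg α β _ _ x).trans
    (by rw [wronskian_y₁_y₂ β hα z _ (neg_mem_Ioo hx)])

theorem hasBdryRight_r₁ {α : ℝ} (β : ℝ) (hα : -1 < α) (z : ℂ) :
    HasBdryRight α β (r₁ α β z) (if α < 0 then 1 else 0) (if α < 0 then 0 else 1) := by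
  by_cases h : α < 0
  · simpa [h] using! (hasBdryLeft_y₁_of_neg β hα h z).comp_neg
  · simpa [h] using! (hasBdryLeft_y₁_of_nonneg β (not_lt.1 h) z).comp_neg

theorem hasBdryRight_r₂ {α : ℝ} (β : ℝ) (hα : α < 1) (z : ℂ) :
    HasBdryRight α β (r₂ α β z) (if α < 0 then 0 else leadingCoeff β α)
      (if α < 0 then -leadingCoeff β α else 0) := by
  rcases lt_trichotomy α 0 with h | h | h
  · have := (hasBdryLeft_y₂_of_neg β h z).comp_neg
    simp only [if_pos h] at this ⊢
    rwa [leadingCoeff, if_neg h.ne]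
  · subst h
    have := (hasBdryLeft_y₂_zero β z).comp_neg
    simp only [lt_irrefl, if_false] at this ⊢
    rw [leadingCoeff, if_pos rfl]
    convert! this using 1
    push_cast; ring
  · have := (hasBdryLeft_y₂_of_pos β h hα z).comp_neg
    simp only [if_neg h.not_gt] at this ⊢
    rw [leadingCoeff, if_neg h.ne']
    convert! this using 1
    push_cast; ring

theorem HasBdryRight.of_eq_add {α β : ℝ} {f g h : ℝ → ℂ} {a a' b b' : ℂ}
    (hf : HasBdryRight α β f a a') (hg : HasBdryRight α β g b b')
    (df : ∀ x ∈ Ioo (-1 : ℝ) 1, DifferentiableAt ℝ f x)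
    (dg : ∀ x ∈ Ioo (-1 : ℝ) 1, DifferentiableAt ℝ g x) {A B : ℂ}
    (hh : ∀ x ∈ Ioo (-1 : ℝ) 1, h x = A * f x + B * g x) :
    HasBdryRight α β h (A * a + B * b) (A * a' + B * b') := by
  have hq : ∀ x ∈ Ioo (-1 : ℝ) 1,
      quasiDeriv α β h x = A * quasiDeriv α β f x + B * quasiDeriv α β g x := by
    intro x hx
    have e : h =ᶠ[𝓝 x] fun x => A * f x + B * g x := by
      filter_upwards [isOpen_Ioo.mem_nhds hx] with s hs using hh s hs
    have := (((df x hx).hasDerivAt.const_mul A).add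
      ((dg x hx).hasDerivAt.const_mul B)).congr_of_eventuallyEq e
    rw [quasiDeriv, this.deriv, quasiDeriv, quasiDeriv]
    ring
  have hmem := Ioo_mem_nhdsLT_one
  rw [HasBdryRight] at *
  split_ifs at * with h1 h2
  · refine ⟨((hf.1.const_mul A).add (hg.1.const_mul B)).congr' ?_,
      ((hf.2.const_mul A).add (hg.2.const_mul B)).congr' ?_⟩
    · filter_upwards [hmem] with x hx using (hh x hx).symm
    · filter_upwards [hmem] with x hx using (hq x hx).symm
  · refine ⟨((hf.1.const_mul A).add (hg.1.const_mul B)).congr' ?_,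
      ((hf.2.const_mul A).add (hg.2.const_mul B)).congr' ?_⟩
    · filter_upwards [hmem] with x hx
      rw [hh x hx]; ring
    · filter_upwards [hmem] with x hx
      rw [hh x hx]; ring
  · refine ⟨((hf.1.const_mul A).add (hg.1.const_mul B)).congr' ?_,
      ((hf.2.const_mul A).add (hg.2.const_mul B)).congr' ?_⟩
    · filter_upwards [hmem] with x hx
      rw [hh x hx]; ring
    · filter_upwards [hmem] with x hx
      rw [hh x hx]; ring

/-- Lets connection coefficients be read off by comparing two computations of the boundary values.
The first value must be identified first, because it enters the definition of the second when `α ≥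
0`. -/
theorem HasBdryRight.unique {α β : ℝ} {g : ℝ → ℂ} {v v' w w' : ℂ} (h : HasBdryRight α β g v v')
    (k : HasBdryRight α β g w w') : v = w ∧ v' = w' := by
  rw [HasBdryRight] at *
  split_ifs at * <;>
  · have e := tendsto_nhds_unique h.1 k.1
    subst e
    exact ⟨rfl, tendsto_nhds_unique h.2 k.2⟩

/-- The boundary values at `1` of a solution given in the fundamental system at `1`. -/
theorem hasBdryRight_of_eq_r {α β : ℝ} (hα : α ∈ Ioo (-1 : ℝ) 1) {z : ℂ} {g : ℝ → ℂ} {A B : ℂ}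
    (hg : ∀ x ∈ Ioo (-1 : ℝ) 1, g x = A * r₁ α β z x + B * r₂ α β z x) :
    HasBdryRight α β g (if α < 0 then A else B * leadingCoeff β α)
      (if α < 0 then -(B * leadingCoeff β α) else A) := by
  have h := (hasBdryRight_r₁ β hα.1 z).of_eq_add (hasBdryRight_r₂ β hα.2 z)
    (fun x hx => (isSolution_r₁ β hα.1 z x hx).1) (fun x hx => (isSolution_r₂ β hα.2 z x hx).1) hg
  split_ifs at * <;> simpa using h

theorem IsSolution.exists_eq_r {α β : ℝ} (hα : α ∈ Ioo (-1 : ℝ) 1) {z : ℂ} {g : ℝ → ℂ}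
    (hg : IsSolution α β z g) : ∃ A B : ℂ,
      (∀ x ∈ Ioo (-1 : ℝ) 1, g x = A * r₁ α β z x + B * r₂ α β z x) ∧
      (∀ x ∈ Ioo (-1 : ℝ) 1, wronskian α β (r₁ α β z) g x = B * -leadingCoeff β α) := by
  have hL : (-(leadingCoeff β α : ℂ)) ≠ 0 :=
    neg_ne_zero.2 (by exact_mod_cast leadingCoeff_ne_zero β α)
  obtain ⟨A, B, h, -, h2⟩ := hg.exists_eq_add (isSolution_r₁ β hα.1 z) (isSolution_r₂ β hα.2 z) hL
    (wronskian_r₁_r₂ β hα z)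
  exact ⟨A, B, h, h2⟩

/-- A solution regular at `-1` with value `1` there is unique. -/
theorem IsSolution.eq_of_tendsto_left {α β : ℝ} (hα : α ∈ Ioo (-1 : ℝ) 1) (hβ : -1 < β) {z : ℂ}
    {f g : ℝ → ℂ} (hf : IsSolution α β z f) (hg : IsSolution α β z g) {d e : ℂ}
    (f1 : Tendsto f (𝓝[>] (-1)) (𝓝 1)) (f2 : Tendsto (deriv f) (𝓝[>] (-1)) (𝓝 d))
    (g1 : Tendsto g (𝓝[>] (-1)) (𝓝 1)) (g2 : Tendsto (deriv g) (𝓝[>] (-1)) (𝓝 e)) :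
    ∀ x ∈ Ioo (-1 : ℝ) 1, f x = g x := by
  have hw : ∀ x ∈ Ioo (-1 : ℝ) 1, wronskian α β f g x = 0 := by
    refine hf.wronskian_eq_of_tendsto hg ?_
    have := (f1.mul (tendsto_quasiDeriv_left_of_tendsto_deriv α hβ g2)).sub
      ((tendsto_quasiDeriv_left_of_tendsto_deriv α hβ f2).mul g1)
    rw [mul_zero, zero_mul, sub_zero] at this
    exact this
  obtain ⟨x₀, hx₀, hfx⟩ : ∃ x₀ ∈ Ioo (-1 : ℝ) 1, f x₀ ≠ 0 :=
    (Filter.Eventually.and Ioo_mem_nhdsGT_neg_one (f1.eventually_ne one_ne_zero)).exists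
  -- The expansion uses the system at `1`, available because `α ∈ (-1,1)`. At `-1` there may be no
  -- partner `y₂`, since `β ≥ 1` is allowed. A vanishing Wronskian makes the two coefficient vectors
  -- proportional, and the common limit `1` fixes the ratio.
  obtain ⟨A, B, hA, hA1, hA2⟩ := hf.exists_eq_add (isSolution_r₁ β hα.1 z)
    (isSolution_r₂ β hα.2 z) (neg_ne_zero.2 (Complex.ofReal_ne_zero.2 (leadingCoeff_ne_zero β α)))
    (wronskian_r₁_r₂ β hα z)
  obtain ⟨C, D, hC, hC1, hC2⟩ := hg.exists_eq_add (isSolution_r₁ β hα.1 z)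
    (isSolution_r₂ β hα.2 z) (neg_ne_zero.2 (Complex.ofReal_ne_zero.2 (leadingCoeff_ne_zero β α)))
    (wronskian_r₁_r₂ β hα z)
  have hL : (leadingCoeff β α : ℂ) ≠ 0 := Complex.ofReal_ne_zero.2 (leadingCoeff_ne_zero β α)
  have h0 := hw x₀ hx₀
  have e1 : f x₀ * C = g x₀ * A := by
    refine mul_right_cancel₀ hL ?_
    have h1 := hA1 x₀ hx₀
    have h2 := hC1 x₀ hx₀
    simp only [wronskian] at h0 h1 h2
    linear_combination f x₀ * h2 - g x₀ * h1 + r₂ α β z x₀ * h0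
  have e2 : f x₀ * D = g x₀ * B := by
    refine mul_right_cancel₀ hL ?_
    have h1 := hA2 x₀ hx₀
    have h2 := hC2 x₀ hx₀
    simp only [wronskian] at h0 h1 h2
    linear_combination f x₀ * h2 - g x₀ * h1 - r₁ α β z x₀ * h0
  have hprop : ∀ x ∈ Ioo (-1 : ℝ) 1, f x₀ * g x = g x₀ * f x := by
    intro x hx
    rw [hA x hx, hC x hx]
    linear_combination r₁ α β z x * e1 + r₂ α β z x * e2
  have hlim : f x₀ = g x₀ := by
    have l1 := g1.const_mul (f x₀)
    have l2 := f1.const_mul (g x₀)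
    have := tendsto_nhds_unique l1 (l2.congr' (by
      filter_upwards [Ioo_mem_nhdsGT_neg_one] with x hx using (hprop x hx).symm))
    simpa using this
  intro x hx
  have := hprop x hx
  rw [← hlim] at this
  exact (mul_left_cancel₀ hfx this).symm

/-- For `β = 0`, a solution asymptotic to `ln ((1 + x)/2)` up to `o(1)` at `-1` is unique. -/
theorem IsSolution.eq_y₂_of_tendsto {α : ℝ} {z : ℂ} {g : ℝ → ℂ} (hg : IsSolution α 0 z g)
    (h : Tendsto (fun x : ℝ => g x - (Real.log ((1 + x) / 2) : ℂ)) (𝓝[>] (-1)) (𝓝 0)) :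
    ∀ x ∈ Ioo (-1 : ℝ) 1, g x = y₂ α 0 z x := by
  have h0 : (0 : ℝ) ∈ Ioo (-1 : ℝ) 1 := by norm_num
  obtain ⟨A, B, hA, -, -⟩ := hg.exists_eq_add (isSolution_y₁ α h0.1 z) (isSolution_y₂ α h0.2 z)
    (Complex.ofReal_ne_zero.2 (leadingCoeff_ne_zero α 0)) (wronskian_y₁_y₂ α h0 z)
  have l1 := tendsto_y₁_left α h0.1 z
  have l2 := tendsto_y₂_sub_log α z
  have l3 := tendsto_inv_log_half_add
  -- `(B - 1) ln ((1+x)/2)` has a finite limit, which forces `B = 1` and then `A = 0`.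
  have hlog : Tendsto (fun x : ℝ => (B - 1) * (Real.log ((1 + x) / 2) : ℂ)) (𝓝[>] (-1))
      (𝓝 (-A)) := by
    have := (h.sub (l1.const_mul A)).sub (l2.const_mul B)
    simp only [mul_one, mul_zero, sub_zero, zero_sub] at this
    refine this.congr' ?_
    filter_upwards [Ioo_mem_nhdsGT_neg_one] with x hx
    rw [hA x hx]; ring
  have hB : B - 1 = 0 := by
    have h4 := hlog.mul l3
    rw [mul_zero] at h4
    refine tendsto_nhds_unique (tendsto_const_nhds.congr' ?_) h4
    filter_upwards [tendsto_log_half_add.eventually (eventually_lt_atBot 0)] with x hx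
    have : ((Real.log ((1 + x) / 2) : ℝ) : ℂ) ≠ 0 := by exact_mod_cast hx.ne
    field_simp
  have hA0 : A = 0 := by
    simp only [hB, zero_mul] at hlog
    simpa using (tendsto_nhds_unique hlog tendsto_const_nhds)
  intro x hx
  rw [hA x hx, hA0, sub_eq_zero.1 hB]
  ring

/-! ### Gauss's summation theorem -/

theorem poch_eq_prod (n : ℕ) (a : ℂ) : poch n a = ∏ j ∈ Finset.range n, (a + j) := by
  induction n with
  | zero => simp [poch_zero]
  | succ n ih => rw [poch_succ, ih, Finset.prod_range_succ]

/-- Euler's limit for `Γ`, inverted. At a pole the product eventually contains a zero factor, in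
accordance with `1/Γ = 0`, so no condition on `a` is needed. -/
theorem tendsto_poch_div (a : ℂ) :
    Tendsto (fun n : ℕ => poch (n + 1) a / ((n : ℂ) ^ a * n.factorial)) atTop
      (𝓝 (Complex.Gamma a)⁻¹) := by
  have e : ∀ n : ℕ, poch (n + 1) a / ((n : ℂ) ^ a * n.factorial) = (Complex.GammaSeq a n)⁻¹ :=
    fun n => by rw [Complex.GammaSeq, poch_eq_prod, inv_div]
  by_cases h : Complex.Gamma a = 0
  · obtain ⟨m, rfl⟩ := (Complex.Gamma_eq_zero_iff a).1 h
    rw [h, inv_zero]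
    refine tendsto_const_nhds.congr' ?_
    filter_upwards [eventually_ge_atTop m] with n hn
    rw [poch_eq_prod, Finset.prod_eq_zero (Finset.mem_range.2 (Nat.lt_succ_of_le hn)) (by ring),
      zero_div]
  · simp_rw [e]
    exact (Complex.GammaSeq_tendsto_Gamma a).inv₀ h

/-- The coefficients are `O(n^{a+b-c-1})`. This gives both absolute convergence at `t = 1` and the
vanishing of the boundary term in the contiguous relation. -/
theorem tendsto_succ_mul_hcoeff (a b : ℂ) {c : ℂ} (hc : 0 < c.re) :
    Tendsto (fun n : ℕ => (n + 1) * hcoeff a b c (n + 1) * (n : ℂ) ^ (c - a - b)) atTop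
      (𝓝 (Complex.Gamma c / (Complex.Gamma a * Complex.Gamma b))) := by
  have h := ((tendsto_poch_div a).mul (tendsto_poch_div b)).div (tendsto_poch_div c)
    (inv_ne_zero (Complex.Gamma_ne_zero_of_re_pos hc))
  have e : (Complex.Gamma a)⁻¹ * (Complex.Gamma b)⁻¹ / (Complex.Gamma c)⁻¹ =
      Complex.Gamma c / (Complex.Gamma a * Complex.Gamma b) := by
    rw [div_inv_eq_mul, ← mul_inv, div_eq_mul_inv, mul_comm]
  rw [e] at h
  refine h.congr' ?_
  filter_upwards [eventually_ne_atTop 0] with n hn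
  have hn' : (n : ℂ) ≠ 0 := Nat.cast_ne_zero.2 hn
  have h1 : (n.factorial : ℂ) ≠ 0 := by exact_mod_cast n.factorial_ne_zero
  have h2 : ((n : ℂ) + 1) ≠ 0 := by exact_mod_cast n.succ_ne_zero
  have h3 := poch_ne_zero hc (n + 1)
  have h4 : ∀ s : ℂ, (n : ℂ) ^ s ≠ 0 := fun s => by simp [Complex.cpow_eq_zero_iff, hn']
  have h5 := h4 a
  have h6 := h4 b
  have h7 := h4 c
  simp only [Pi.div_apply]
  rw [Complex.cpow_sub _ _ hn', Complex.cpow_sub _ _ hn', hcoeff, Nat.factorial_succ]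
  push_cast
  field_simp

theorem tendsto_nat_cpow_neg {s : ℂ} (hs : 0 < s.re) :
    Tendsto (fun n : ℕ => (n : ℂ) ^ (-s)) atTop (𝓝 0) := by
  rw [tendsto_zero_iff_norm_tendsto_zero]
  refine ((tendsto_rpow_neg_atTop hs).comp tendsto_natCast_atTop_atTop).congr' ?_
  filter_upwards [eventually_gt_atTop 0] with n hn
  rw [Complex.norm_natCast_cpow_of_pos hn]; simp

theorem tendsto_nat_mul_hcoeff (a b : ℂ) {c : ℂ} (hc : 0 < c.re) (hs : 0 < (c - a - b).re) :
    Tendsto (fun n : ℕ => n * hcoeff a b c n) atTop (𝓝 0) := by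
  rw [← tendsto_add_atTop_iff_nat 1]
  have h := (tendsto_succ_mul_hcoeff a b hc).mul (tendsto_nat_cpow_neg hs)
  rw [mul_zero] at h
  refine h.congr' ?_
  filter_upwards [eventually_ne_atTop 0] with n hn
  have hn' : (n : ℂ) ≠ 0 := Nat.cast_ne_zero.2 hn
  rw [mul_assoc, ← Complex.cpow_add _ _ hn', add_neg_cancel, Complex.cpow_zero]
  push_cast; ring

theorem summable_norm_hcoeff (a b : ℂ) {c : ℂ} (hc : 0 < c.re) (hs : 0 < (c - a - b).re) :
    Summable fun n => ‖hcoeff a b c n‖ := by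
  rw [← summable_nat_add_iff 1]
  have h := (tendsto_succ_mul_hcoeff a b hc).norm.isBigO_one ℝ
  refine summable_of_isBigO_nat (g := fun n : ℕ => (n : ℝ) ^ (-(1 + (c - a - b).re)))
    (Real.summable_nat_rpow.2 (by linarith)) ?_
  have h2 := h.mul (Asymptotics.isBigO_refl
    (fun n : ℕ => (n : ℝ) ^ (-(1 + (c - a - b).re))) atTop)
  simp only [one_mul] at h2
  refine Asymptotics.IsBigO.trans (Asymptotics.IsBigO.of_bound 1 ?_) h2
  filter_upwards [eventually_gt_atTop 0] with n hn
  have hn' : (0 : ℝ) < n := by exact_mod_cast hn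
  have e : ‖(n : ℂ) + 1‖ = n + 1 := by
    rw [← Nat.cast_succ, Complex.norm_natCast]; push_cast; rfl
  have e2 : (n : ℝ) ^ (c - a - b).re * (n : ℝ) ^ (-(1 + (c - a - b).re)) = (n : ℝ)⁻¹ := by
    rw [← Real.rpow_add hn', show (c - a - b).re + -(1 + (c - a - b).re) = -1 by ring,
      Real.rpow_neg_one]
  rw [norm_norm, one_mul, Real.norm_of_nonneg (by positivity), norm_mul, norm_mul, e,
    Complex.norm_natCast_cpow_of_pos hn, mul_assoc, e2]
  have : 1 ≤ ((n : ℝ) + 1) * (n : ℝ)⁻¹ := by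
    rw [le_mul_inv_iff₀ hn']; linarith
  nlinarith [norm_nonneg (hcoeff a b c (n + 1))]

/-- On partial sums the contiguous relation telescopes, with an explicit boundary term that tends to
zero when `Re (c-a-b) > 0`. -/
theorem sum_range_hcoeff_contiguous (a b : ℂ) {c : ℂ} (hc : 0 < c.re) (N : ℕ) :
    c * (c - a - b) * ∑ n ∈ Finset.range N, hcoeff a b c n
        - (c - a) * (c - b) * ∑ n ∈ Finset.range N, hcoeff a b (c + 1) n
      = -(c * (N * hcoeff a b c N)) := by
  have h0 : c ≠ 0 := fun h => by simp [h] at hc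
  induction N with
  | zero => simp
  | succ N ih =>
    have h1 : c + N ≠ 0 := fun h => by
      have := congrArg Complex.re h; simp at this; linarith [(N.cast_nonneg : (0 : ℝ) ≤ N)]
    have h2 : hcoeff a b (c + 1) N * (c + N) = c * hcoeff a b c N := by
      have e : c * poch N (c + 1) = poch N c * (c + N) := by rw [← poch_succ_left, poch_succ]
      have h3 := poch_ne_zero hc N
      have h4 := poch_ne_zero (c := c + 1) (by simp; linarith) N
      have h5 : (N.factorial : ℂ) ≠ 0 := by exact_mod_cast N.factorial_ne_zero
      simp only [hcoeff]
      field_simp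
      linear_combination -(poch N a * poch N b) * e
    have h3 := hcoeff_succ a b hc N
    rw [Finset.sum_range_succ, Finset.sum_range_succ]
    refine mul_left_cancel₀ h1 ?_
    push_cast
    linear_combination (c + N) * ih + -(c - a) * (c - b) * h2 + c * h3

/-- The contiguous relation for the hypergeometric series at `1`. -/
theorem tsum_hcoeff_contiguous (a b : ℂ) {c : ℂ} (hc : 0 < c.re) (hs : 0 < (c - a - b).re) :
    c * (c - a - b) * ∑' n, hcoeff a b c n = (c - a) * (c - b) * ∑' n, hcoeff a b (c + 1) n := by
  have h1 := ((summable_norm_hcoeff a b hc hs).of_norm).hasSum.tendsto_sum_nat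
  have h2 := ((summable_norm_hcoeff a b (c := c + 1) (by simp; linarith)
    (by simp at hs ⊢; linarith)).of_norm).hasSum.tendsto_sum_nat
  have h3 := (h1.const_mul (c * (c - a - b))).sub (h2.const_mul ((c - a) * (c - b)))
  simp_rw [sum_range_hcoeff_contiguous a b hc] at h3
  have h4 := ((tendsto_nat_mul_hcoeff a b hc hs).const_mul c).neg
  rw [mul_zero, neg_zero] at h4
  exact sub_eq_zero.1 (tendsto_nhds_unique h3 h4)

theorem tsum_hcoeff_eq_poch_mul (a b : ℂ) {c : ℂ} (hc : 0 < c.re) (hs : 0 < (c - a - b).re)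
    (N : ℕ) : ∑' n, hcoeff a b c n = poch N (c - a) * poch N (c - b) /
      (poch N c * poch N (c - a - b)) * ∑' n, hcoeff a b (c + N) n := by
  induction N with
  | zero => simp [poch_zero]
  | succ N ih =>
    have hN : (0 : ℝ) ≤ N := N.cast_nonneg
    have h := tsum_hcoeff_contiguous a b (c := c + N) (by simp; linarith)
      (by simp at hs ⊢; linarith)
    have h1 := poch_ne_zero hc (N + 1)
    have h2 := poch_ne_zero hs (N + 1)
    rw [poch_succ] at h1 h2
    have h3 := left_ne_zero_of_mul h1
    have h4 := right_ne_zero_of_mul h1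
    have h5 := left_ne_zero_of_mul h2
    have h6 := right_ne_zero_of_mul h2
    rw [ih]
    simp only [poch_succ]
    push_cast
    rw [← add_assoc]
    set S := ∑' n, hcoeff a b (c + N) n
    set T := ∑' n, hcoeff a b (c + N + 1) n
    rw [div_mul_eq_mul_div, div_mul_eq_mul_div, div_eq_div_iff (mul_ne_zero h3 h5)
      (mul_ne_zero h1 h2)]
    linear_combination poch N (c - a) * poch N (c - b) * poch N c * poch N (c - a - b) * h

/-- Every term with `n ≥ 1` is `O(1/N)`, and the series at `N = 0` dominates because `|(c)_n| ≤
|(c+N)_n|` for real `c > 0`. This is the end of the iteration `c → c + 1`. -/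
theorem tendsto_tsum_hcoeff_add_nat (a b : ℂ) {c : ℝ} (hc : 0 < c) (hs : 0 < ((c : ℂ) - a - b).re) :
    Tendsto (fun N : ℕ => ∑' n, hcoeff a b (c + N) n) atTop (𝓝 1) := by
  have hre : 0 < (c : ℂ).re := by simpa using hc
  have hmono : ∀ N n : ℕ, ‖poch n (c : ℂ)‖ ≤ ‖poch n ((c : ℂ) + N)‖ := by
    intro N n
    refine (norm_poch_le (M := c) (by simp [abs_of_pos hc]) n).trans
      (rpoch_le_norm_poch hc.le (by simp) n)
  have hlim : ∀ n : ℕ, Tendsto (fun N : ℕ => hcoeff a b (c + N) n) atTop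
      (𝓝 (if n = 0 then 1 else 0)) := by
    intro n
    rcases n with _ | n
    · simp [hcoeff_zero]
    · simp only [Nat.succ_ne_zero, if_false]
      have h1 : Tendsto (fun N : ℕ => ‖poch (n + 1) a * poch (n + 1) b‖ / (rpoch c n) *
          ((N : ℝ))⁻¹) atTop (𝓝 0) := by
        simpa using (tendsto_natCast_atTop_atTop (R := ℝ)).inv_tendsto_atTop.const_mul
          (‖poch (n + 1) a * poch (n + 1) b‖ / (rpoch c n))
      refine squeeze_zero_norm' ?_ h1
      filter_upwards [eventually_gt_atTop 0] with N hN
      have hN' : (0 : ℝ) < N := by exact_mod_cast hN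
      have h2 : (N : ℝ) ≤ ‖(c : ℂ) + N‖ := le_trans (by simpa using hc.le) (Complex.re_le_norm _)
      have h3 : rpoch c n ≤ ‖poch n ((c : ℂ) + N + 1)‖ :=
        rpoch_le_norm_poch hc.le (by simp; linarith) n
      have h4 := rpoch_pos hc n
      have h5 : (1 : ℝ) ≤ (n + 1).factorial := by exact_mod_cast (n + 1).factorial_pos
      rw [hcoeff, norm_div, poch_succ_left n ((c : ℂ) + N), norm_mul (((c : ℂ) + N) * _),
        norm_mul ((c : ℂ) + N), Complex.norm_natCast, ← div_eq_mul_inv, div_div]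
      refine div_le_div_of_nonneg_left (norm_nonneg _) (by positivity) ?_
      calc rpoch c n * N = N * rpoch c n * 1 := by ring
        _ ≤ _ := by gcongr
  have h := tendsto_tsum_of_dominated_convergence (summable_norm_hcoeff a b hre hs) hlim
    (Eventually.of_forall fun N n => by
      have h1 := norm_pos_iff.2 (poch_ne_zero hre n)
      have h2 := hmono N n
      have h3 : (0 : ℝ) < n.factorial := by exact_mod_cast n.factorial_pos
      rw [hcoeff, hcoeff, norm_div, norm_div, norm_mul (poch n ((c : ℂ) + N)),
        norm_mul (poch n (c : ℂ)), Complex.norm_natCast]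
      gcongr)
  simpa using h

/-- The powers of `N` in the four Euler limits cancel, since `(c-a) + (c-b) = c + (c-a-b)`. -/
theorem tendsto_poch_ratio (a b : ℂ) {c : ℂ} (hc : 0 < c.re) (hs : 0 < (c - a - b).re) :
    Tendsto (fun N : ℕ => poch (N + 1) (c - a) * poch (N + 1) (c - b) /
      (poch (N + 1) c * poch (N + 1) (c - a - b))) atTop
      (𝓝 (Complex.Gamma c * Complex.Gamma (c - a - b) /
        (Complex.Gamma (c - a) * Complex.Gamma (c - b)))) := by
  have h := ((tendsto_poch_div (c - a)).mul (tendsto_poch_div (c - b))).div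
    ((tendsto_poch_div c).mul (tendsto_poch_div (c - a - b)))
    (mul_ne_zero (inv_ne_zero (Complex.Gamma_ne_zero_of_re_pos hc))
      (inv_ne_zero (Complex.Gamma_ne_zero_of_re_pos hs)))
  rw [← mul_inv, ← mul_inv, div_inv_eq_mul, inv_mul_eq_div] at h
  refine h.congr' ?_
  filter_upwards [eventually_ne_atTop 0] with n hn
  have hn' : (n : ℂ) ≠ 0 := Nat.cast_ne_zero.2 hn
  have h1 : (n.factorial : ℂ) ≠ 0 := by exact_mod_cast n.factorial_ne_zero
  have h4 : ∀ s : ℂ, (n : ℂ) ^ s ≠ 0 := fun s => by simp [Complex.cpow_eq_zero_iff, hn']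
  have e : (n : ℂ) ^ (c - a) * (n : ℂ) ^ (c - b) = (n : ℂ) ^ c * (n : ℂ) ^ (c - a - b) := by
    rw [← Complex.cpow_add _ _ hn', ← Complex.cpow_add _ _ hn']; ring_nf
  have h5 := h4 c
  have h6 := h4 (c - a)
  have h7 := h4 (c - b)
  have h8 := h4 (c - a - b)
  have h9 := poch_ne_zero hc (n + 1)
  have h10 := poch_ne_zero hs (n + 1)
  simp only [Pi.div_apply]
  rw [div_mul_div_comm, div_mul_div_comm, div_div_div_eq]
  rw [div_eq_div_iff (by positivity) (by positivity)]
  linear_combination (-(poch (n + 1) (c - a) * poch (n + 1) (c - b) * poch (n + 1) c *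
    poch (n + 1) (c - a - b)) * (n.factorial : ℂ) ^ 2) * e

/-- **Gauss's summation theorem**. -/
theorem tsum_hcoeff (a b : ℂ) {c : ℝ} (hc : 0 < c) (hs : 0 < ((c : ℂ) - a - b).re) :
    ∑' n, hcoeff a b c n = Complex.Gamma c * Complex.Gamma (c - a - b) /
      (Complex.Gamma (c - a) * Complex.Gamma (c - b)) := by
  have hre : 0 < (c : ℂ).re := by simpa using hc
  have h := (tendsto_poch_ratio a b hre hs).mul
    ((tendsto_add_atTop_iff_nat 1).2 (tendsto_tsum_hcoeff_add_nat a b hc hs))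
  rw [mul_one] at h
  refine tendsto_nhds_unique (tendsto_const_nhds.congr fun N => ?_) h
  exact tsum_hcoeff_eq_poch_mul a b hre hs (N + 1)

/-! ### Passage to the end point `1` by Abel's limit theorem -/

theorem tendsto_half_add_right :
    Tendsto (fun x : ℝ => (1 + x) / 2) (𝓝[<] 1) (𝓝[<] 1) := by
  refine tendsto_nhdsWithin_iff.2 ⟨?_, ?_⟩
  · have h : Continuous fun x : ℝ => (1 + x) / 2 := by fun_prop
    have := (h.tendsto 1).mono_left (nhdsWithin_le_nhds (s := Iio 1))
    simpa using this
  · filter_upwards [self_mem_nhdsWithin] with x hx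
    have : x < 1 := hx
    simp only [mem_Iio]; linarith

/-- The value of `y₁` at `1` for `α < 0`. -/
theorem tendsto_y₁_right {α β : ℝ} (hα : α < 0) (hβ : -1 < β) (z : ℂ) :
    Tendsto (y₁ α β z) (𝓝[<] 1) (𝓝 (Complex.Gamma (1 + β) * Complex.Gamma (-α) /
      GG (-α) β (sig α β z))) := by
  set a := aPar α β (sig α β z) with ha
  set b := aPar α β (-sig α β z) with hb
  have e0 : ((1 + β : ℝ) : ℂ) = 1 + β := by push_cast; rfl
  have e1 : ((1 + β : ℝ) : ℂ) - a - b = -α := by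
    rw [sub_sub, ha, hb, aPar_add]; push_cast; ring
  have hs : 0 < (((1 + β : ℝ) : ℂ) - a - b).re := by rw [e1]; simpa using hα
  have hc : 0 < 1 + β := by linarith
  have h := tsum_hcoeff a b hc hs
  have e2 : ((1 + β : ℝ) : ℂ) - a = aPar (-α) β (-sig α β z) := by
    rw [ha]; simp only [aPar]; push_cast; ring
  have e3 : ((1 + β : ℝ) : ℂ) - b = aPar (-α) β (sig α β z) := by
    rw [hb]; simp only [aPar]; push_cast; ring
  rw [e1, e2, e3, mul_comm (Complex.Gamma (aPar (-α) β (-sig α β z))), e0] at h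
  have hsum := (summable_norm_hcoeff a b (c := ((1 + β : ℝ) : ℂ)) (by simpa using hc)
    hs).of_norm.hasSum.tendsto_sum_nat
  -- Abel's theorem along `t = (1+x)/2 ↑ 1`; the series converges at `t = 1` because `c - a - b =
  -- -α` is positive.
  have h2 := Complex.tendsto_tsum_powerSeries_nhdsWithin_lt hsum
  rw [tendsto_map'_iff, e0, h] at h2
  refine (h2.comp tendsto_half_add_right).congr fun x => ?_
  rw [y₁_eq_psum]
  rfl

/-! ### Boundary values of `y₁` at `1` for `α ≠ 0` -/

theorem IsSolution.const_mul {α β : ℝ} {z : ℂ} {g : ℝ → ℂ} (hg : IsSolution α β z g) (k : ℂ) :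
    IsSolution α β z fun x => k * g x :=
  IsSolution.of_hasDerivAt (fun x hx => (hg x hx).1.hasDerivAt.const_mul k)
    (fun x hx => (hg x hx).2.1.hasDerivAt.const_mul k) fun x hx => by
      linear_combination k * (hg x hx).2.2

/-- Multiplication by `((1 - x)/2)^{-α}` turns solutions for `(-α, β)` into solutions for
`(α, β)`. -/
theorem IsSolution.one_sub_rpow_mul {α β : ℝ} {z : ℂ} {g : ℝ → ℂ}
    (hg : IsSolution (-α) β (z + α * (1 + β)) g) :
    IsSolution α β z fun x => ((((1 - x) / 2) ^ (-α) : ℝ) : ℂ) * g x := by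
  -- The factor at `1` is obtained from the one at `-1` by reflecting twice; `2^α` turns
  -- `(1-x)^{-α}` into `((1-x)/2)^{-α}`.
  have h := (hg.comp_neg.one_add_rpow_mul).comp_neg.const_mul ((2 ^ α : ℝ) : ℂ)
  refine h.congr fun x hx => ?_
  have h1 : 0 ≤ 1 - x := by linarith [hx.2]
  rw [Real.div_rpow h1 zero_le_two, Real.rpow_neg zero_le_two, div_inv_eq_mul, neg_neg,
    ← sub_eq_add_neg]
  push_cast; ring

theorem tendsto_half_sub_rpow_left (s : ℝ) :
    Tendsto (fun x : ℝ => ((((1 - x) / 2) ^ s : ℝ) : ℂ)) (𝓝[>] (-1)) (𝓝 1) := by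
  have h : ContinuousAt (fun x : ℝ => ((1 - x) / 2) ^ s) (-1) :=
    ((continuousAt_const.sub continuousAt_id).div_const 2).rpow_const (Or.inl (by norm_num))
  have h2 : Tendsto (fun x : ℝ => ((1 - x) / 2) ^ s) (𝓝[>] (-1)) (𝓝 1) := by
    have := h.tendsto.mono_left (nhdsWithin_le_nhds (s := Ioi (-1)))
    simpa using this
  exact_mod_cast (Complex.continuous_ofReal.tendsto 1).comp h2

theorem hasDerivAt_half_sub_rpow (s : ℝ) {x : ℝ} (hx : x ∈ Ioo (-1 : ℝ) 1) :
    HasDerivAt (fun x : ℝ => ((((1 - x) / 2) ^ s : ℝ) : ℂ))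
      (-(s / 2) * ((((1 - x) / 2) ^ (s - 1) : ℝ) : ℂ)) x := by
  have h : HasDerivAt (fun x : ℝ => ((1 - x) / 2) ^ s) (-1 / 2 * s * ((1 - x) / 2) ^ (s - 1)) x :=
    (((hasDerivAt_id x).const_sub 1).div_const 2).rpow_const
      (Or.inl (by have := hx.2; simp only [id]; intro h; linarith))
  convert! h.ofReal_comp using 1
  push_cast; ring

/-- **Euler's transformation**. -/
theorem y₁_eq_euler {α β : ℝ} (hα : α ∈ Ioo (-1 : ℝ) 1) (hβ : -1 < β) (z : ℂ) :
    ∀ x ∈ Ioo (-1 : ℝ) 1, y₁ α β z x =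
      ((((1 - x) / 2) ^ (-α) : ℝ) : ℂ) * y₁ (-α) β (z + α * (1 + β)) x := by
  have hG := isSolution_y₁ (-α) hβ (z + α * (1 + β))
  obtain ⟨d, hd⟩ := tendsto_deriv_y₁_left α hβ z
  obtain ⟨e, he⟩ := tendsto_deriv_y₁_left (-α) hβ (z + α * (1 + β))
  have l1 := tendsto_y₁_left (-α) hβ (z + α * (1 + β))
  have lu := tendsto_half_sub_rpow_left (-α)
  have lu' := (tendsto_half_sub_rpow_left (-α - 1)).const_mul (-((-α : ℝ) / 2 : ℂ))
  -- Both sides solve the same equation, tend to `1` at `-1` and have derivatives with limits there.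
  refine (isSolution_y₁ α hβ z).eq_of_tendsto_left hα hβ hG.one_sub_rpow_mul
    (tendsto_y₁_left α hβ z) hd (by simpa using lu.mul l1) (((lu'.mul l1).add (lu.mul he)).congr' ?_)
  filter_upwards [Ioo_mem_nhdsGT_neg_one] with x hx
  exact ((hasDerivAt_half_sub_rpow (-α) hx).mul (hG x hx).1.hasDerivAt).deriv.symm

theorem sig_succ_succ (α β : ℝ) (z : ℂ) :
    sig (α + 1) (β + 1) (z - (2 + α + β)) = sig α β z := by
  simp only [sig]; congr 1; push_cast; ring

theorem aPar_succ_succ (α β : ℝ) (σ : ℂ) : aPar (α + 1) (β + 1) σ = aPar α β σ + 1 := by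
  simp only [aPar]; push_cast; ring

/-- Differentiation raises `a`, `b`, `c` by one, that is, `α` and `β` by one, and the shift of `z`
keeps `σ`. The quasi-derivative at `1` thus becomes a value at `1` of another `y₁`. -/
theorem deriv_y₁ (α : ℝ) {β : ℝ} (hβ : -1 < β) (z : ℂ) {x : ℝ} (hx : x ∈ Ioo (-1 : ℝ) 1) :
    deriv (y₁ α β z) x = aPar α β (sig α β z) * aPar α β (-sig α β z) / (1 + β) / 2 *
      y₁ (α + 1) (β + 1) (z - (2 + α + β)) x := by
  have e : ((1 : ℂ) + ((β + 1 : ℝ) : ℂ)) = 1 + β + 1 := by push_cast; ring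
  rw [(hasDerivAt_y₁ α hβ z (norm_half_add_lt hx)).deriv, y₁_eq_psum, sig_succ_succ,
    aPar_succ_succ, aPar_succ_succ, e,
    funext (shift_hcoeff (aPar α β (sig α β z)) (aPar α β (-sig α β z))
      (c := 1 + β) (by simp; linarith)), psum_const_mul]
  ring

/-- Stated for reciprocals, the functional equation also holds at the poles, so no exceptional `z`
have to be set apart. -/
theorem mul_inv_Gamma_add_one (a : ℂ) : a * (Complex.Gamma (a + 1))⁻¹ = (Complex.Gamma a)⁻¹ := by
  by_cases h : a = 0
  · simp [h]
  · rw [Complex.Gamma_add_one a h, mul_inv, mul_inv_cancel_left₀ h]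

theorem tendsto_one_add_rpow_right (s : ℝ) :
    Tendsto (fun x : ℝ => (((1 + x) ^ s : ℝ) : ℂ)) (𝓝[<] 1) (𝓝 ((2 ^ s : ℝ) : ℂ)) := by
  have h : ContinuousAt (fun x : ℝ => (1 + x) ^ s) 1 :=
    (continuousAt_const.add continuousAt_id).rpow_const (Or.inl (by norm_num))
  have h2 : Tendsto (fun x : ℝ => (1 + x) ^ s) (𝓝[<] 1) (𝓝 (2 ^ s)) := by
    have := h.tendsto.mono_left (nhdsWithin_le_nhds (s := Iio 1))
    rwa [show (1 : ℝ) + 1 = 2 by norm_num] at this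
  exact (Complex.continuous_ofReal.tendsto _).comp h2

theorem hasBdryRight_y₁_of_neg {α β : ℝ} (hα : α ∈ Ioo (-1 : ℝ) 0) (hβ : -1 < β) (z : ℂ) :
    HasBdryRight α β (y₁ α β z)
      (Complex.Gamma (1 + β) * Complex.Gamma (-α) / GG (-α) β (sig α β z))
      (((2 ^ (1 + α + β) : ℝ) : ℂ) * Complex.Gamma (1 + α) * Complex.Gamma (1 + β)
        / GG α β (sig α β z)) := by
  rw [HasBdryRight, if_pos hα.2]
  refine ⟨tendsto_y₁_right hα.2 hβ z, ?_⟩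
  set a := aPar α β (sig α β z) with ha
  set b := aPar α β (-sig α β z) with hb
  have hα1 : α + 1 ∈ Ioo (-1 : ℝ) 1 := ⟨by linarith [hα.1], by linarith [hα.2]⟩
  set z' := z - (2 + α + β) with hz'
  set z'' := z' + ((α + 1 : ℝ) : ℂ) * (1 + ((β + 1 : ℝ) : ℂ)) with hz''
  -- Euler's transformation at `(α+1, β+1)` extracts `((1-x)/2)^{-(α+1)}`, which the weight cancels.
  -- The remaining factor has first parameter `-(α+1) < 0`, so Gauss's sum applies again.
  have l1 := tendsto_y₁_right (α := -(α + 1)) (β := β + 1) (by linarith [hα.1]) (by linarith) z''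
  have l2 := ((tendsto_one_add_rpow_right (β + 1)).const_mul
    (a * b / (1 + β) / 2 * ((2 ^ (α + 1) : ℝ) : ℂ))).mul l1
  have e1 : GG (- -(α + 1)) (β + 1) (sig (-(α + 1)) (β + 1) z'') =
      Complex.Gamma (a + 1) * Complex.Gamma (b + 1) := by
    rw [hz'', sig_shift_left, neg_neg, hz', sig_succ_succ, GG, aPar_succ_succ, aPar_succ_succ]
  have hβ0 : (1 + (β : ℂ)) ≠ 0 := by
    have : (1 + β) ≠ 0 := by linarith
    exact_mod_cast this
  have e2 : Complex.Gamma (1 + ((β + 1 : ℝ) : ℂ)) = (1 + β) * Complex.Gamma (1 + β) := by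
    rw [← Complex.Gamma_add_one _ hβ0]; push_cast; ring_nf
  have e3 : Complex.Gamma (-((-(α + 1) : ℝ) : ℂ)) = Complex.Gamma (1 + α) := by
    push_cast; ring_nf
  have e4 : ((2 ^ (1 + α + β) : ℝ) : ℂ) * 2 =
      ((2 ^ (β + 1) : ℝ) : ℂ) * ((2 ^ (α + 1) : ℝ) : ℂ) := by
    rw [rpow_mul_rpow_cast two_pos, show β + 1 + (α + 1) = (1 + α + β) + 1 by ring,
      Real.rpow_add two_pos (1 + α + β) 1, Real.rpow_one]
    push_cast; rfl
  have e5 := mul_inv_Gamma_add_one a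
  have e6 := mul_inv_Gamma_add_one b
  have lim : a * b / (1 + β) / 2 * ((2 ^ (α + 1) : ℝ) : ℂ) * ((2 ^ (β + 1) : ℝ) : ℂ) *
      (Complex.Gamma (1 + ((β + 1 : ℝ) : ℂ)) * Complex.Gamma (-((-(α + 1) : ℝ) : ℂ)) /
        GG (- -(α + 1)) (β + 1) (sig (-(α + 1)) (β + 1) z'')) =
      ((2 ^ (1 + α + β) : ℝ) : ℂ) * Complex.Gamma (1 + α) * Complex.Gamma (1 + β)
        / GG α β (sig α β z) := by
    rw [e1, e2, e3, GG, ← ha, ← hb, div_eq_mul_inv (_ * _) (Complex.Gamma (a + 1) * _),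
      div_eq_mul_inv _ (Complex.Gamma a * _), mul_inv, mul_inv, ← e5, ← e6]
    field_simp
    linear_combination -(a * b * Complex.Gamma (1 + α) * Complex.Gamma (1 + β) *
      (Complex.Gamma (a + 1))⁻¹ * (Complex.Gamma (b + 1))⁻¹) * e4
  rw [lim] at l2
  refine l2.congr' ?_
  filter_upwards [Ioo_mem_nhdsLT_one] with x hx
  rw [quasiDeriv, deriv_y₁ α hβ z hx, y₁_eq_euler hα1 (by linarith) _ x hx]
  have h1 : 0 < 1 - x := by linarith [hx.2]
  have e7 : ((((1 - x) / 2) ^ (-(α + 1)) : ℝ) : ℂ) * (((1 - x) ^ (α + 1) : ℝ) : ℂ) =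
      ((2 ^ (α + 1) : ℝ) : ℂ) := by
    rw [Real.div_rpow h1.le zero_le_two, Real.rpow_neg h1.le, Real.rpow_neg zero_le_two,
      ← Complex.ofReal_mul]
    congr 1
    have := (Real.rpow_pos_of_pos h1 (α + 1)).ne'
    field_simp
  rw [Complex.ofReal_mul, ← e7]
  ring

/-! ### Transfer between `-α` and `α` -/

/-- With the next lemma: multiplication by `((1-x)/2)^{-α}` interchanges the two members of the
system at `1`, up to the factor `2^α`. At `α = 0` this breaks down, `r₂` being logarithmic. -/
theorem half_sub_rpow_mul_r₁ {α : ℝ} (β : ℝ) (h0 : α ≠ 0) (z : ℂ) {x : ℝ}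
    (hx : x ∈ Ioo (-1 : ℝ) 1) :
    ((((1 - x) / 2) ^ (-α) : ℝ) : ℂ) * r₁ (-α) β (z + α * (1 + β)) x =
      ((2 ^ α : ℝ) : ℂ) * r₂ α β z x := by
  have h1 : 0 ≤ 1 - x := by linarith [hx.2]
  rw [r₂, y₂_eq_rpow_mul h0, r₁, Real.div_rpow h1 zero_le_two, Real.rpow_neg zero_le_two,
    div_inv_eq_mul, ← sub_eq_add_neg]
  push_cast; ring

theorem half_sub_rpow_mul_r₂ {α : ℝ} (β : ℝ) (h0 : α ≠ 0) (z : ℂ) {x : ℝ}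
    (hx : x ∈ Ioo (-1 : ℝ) 1) :
    ((((1 - x) / 2) ^ (-α) : ℝ) : ℂ) * r₂ (-α) β (z + α * (1 + β)) x =
      ((2 ^ α : ℝ) : ℂ) * r₁ α β z x := by
  have h1 : 0 < 1 - x := by linarith [hx.2]
  have e : z + α * (1 + β) + ((-α : ℝ) : ℂ) * (1 + β) = z := by push_cast; ring
  have e2 := rpow_mul_rpow_cast h1 (-α) α
  rw [neg_add_cancel, Real.rpow_zero] at e2
  rw [r₂, y₂_eq_rpow_mul (neg_ne_zero.2 h0), r₁, Real.div_rpow h1.le zero_le_two,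
    Real.rpow_neg zero_le_two, div_inv_eq_mul, ← sub_eq_add_neg, neg_neg, e]
  push_cast at e2 ⊢
  linear_combination ((2 ^ α : ℝ) : ℂ) * y₁ β α z (-x) * e2

/-- How the boundary values at `1` change under multiplication by `((1 - x)/2)^{-α}`. -/
theorem HasBdryRight.half_sub_rpow_mul {α β : ℝ} (hα : α ∈ Ioo (-1 : ℝ) 1) (h0 : α ≠ 0) {z : ℂ}
    {g G : ℝ → ℂ} (hG : IsSolution (-α) β (z + α * (1 + β)) G) {V V' : ℂ}
    (hV : HasBdryRight (-α) β G V V')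
    (hg : ∀ x ∈ Ioo (-1 : ℝ) 1, g x = ((((1 - x) / 2) ^ (-α) : ℝ) : ℂ) * G x) :
    HasBdryRight α β g
      (if α < 0 then ((2 ^ α / (α * 2 ^ (β + 1)) : ℝ) : ℂ) * V
        else -((2 ^ α * (α * 2 ^ (β + 1)) : ℝ) : ℂ) * V)
      (if α < 0 then ((2 ^ α * (α * 2 ^ (β + 1)) : ℝ) : ℂ) * V'
        else -((2 ^ α / (α * 2 ^ (β + 1)) : ℝ) : ℂ) * V') := by
  have hα' : -α ∈ Ioo (-1 : ℝ) 1 := ⟨by linarith [hα.2], by linarith [hα.1]⟩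
  obtain ⟨A, B, hAB, -⟩ := hG.exists_eq_r hα'
  have k := hV.unique (hasBdryRight_of_eq_r hα' hAB)
  have h := hasBdryRight_of_eq_r (z := z) (g := g) (A := ((2 ^ α : ℝ) : ℂ) * B)
    (B := ((2 ^ α : ℝ) : ℂ) * A) hα fun x hx => by
      rw [hg x hx, hAB x hx]
      linear_combination A * half_sub_rpow_mul_r₁ β h0 z hx + B * half_sub_rpow_mul_r₂ β h0 z hx
  have hα0 : (α : ℂ) ≠ 0 := Complex.ofReal_ne_zero.2 h0
  have h2 : (((2 : ℝ) ^ (β + 1) : ℝ) : ℂ) ≠ 0 := Complex.ofReal_ne_zero.2 (by positivity)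
  have e1 : leadingCoeff β (-α) = α * 2 ^ (β + 1) := by
    rw [leadingCoeff, if_neg (neg_ne_zero.2 h0), neg_neg]
  have e2 : leadingCoeff β α = -(α * 2 ^ (β + 1)) := by
    rw [leadingCoeff, if_neg h0, neg_mul]
  rw [e1] at k
  rw [e2] at h
  rcases lt_or_gt_of_ne h0 with h3 | h3
  · have h4 : ¬ (-α < 0) := by linarith
    simp only [if_pos h3, if_neg h4] at h k ⊢
    rw [k.1, k.2]
    convert! h using 1
    · push_cast; field_simp
    · push_cast; ring
  · have h4 : -α < 0 := by linarith
    have h5 : ¬ (α < 0) := by linarith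
    simp only [if_pos h4, if_neg h5] at h k ⊢
    rw [k.1, k.2]
    convert! h using 1
    · push_cast; ring
    · push_cast; field_simp

theorem hasBdryRight_y₁_of_pos {α β : ℝ} (hα : α ∈ Ioo (0 : ℝ) 1) (hβ : -1 < β) (z : ℂ) :
    HasBdryRight α β (y₁ α β z)
      (-((2 ^ (1 + α + β) : ℝ) : ℂ) * Complex.Gamma (1 + α) * Complex.Gamma (1 + β)
        / GG α β (sig α β z))
      (Complex.Gamma (1 + β) * Complex.Gamma (-α) / GG (-α) β (sig α β z)) := by
  have hα' : α ∈ Ioo (-1 : ℝ) 1 := ⟨by linarith [hα.1], hα.2⟩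
  have h := (hasBdryRight_y₁_of_neg (α := -α) (β := β) ⟨by linarith [hα.2], by linarith [hα.1]⟩ hβ
    (z + α * (1 + β))).half_sub_rpow_mul hα' hα.1.ne' (isSolution_y₁ (-α) hβ _)
      (y₁_eq_euler hα' hβ z)
  have h5 : ¬ (α < 0) := by linarith [hα.1]
  have hα0 : (α : ℂ) ≠ 0 := Complex.ofReal_ne_zero.2 hα.1.ne'
  rw [if_neg h5, if_neg h5, sig_shift_left, neg_neg] at h
  have g1 : Complex.Gamma (1 + α) = α * Complex.Gamma α := by
    rw [add_comm, Complex.Gamma_add_one _ hα0]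
  have g2 : Complex.Gamma (1 + (-α : ℝ)) = -α * Complex.Gamma (-α) := by
    rw [← Complex.Gamma_add_one _ (neg_ne_zero.2 hα0), add_comm]; push_cast; rfl
  have p1 : (2 : ℝ) ^ (1 + α + β) = 2 ^ α * 2 ^ (β + 1) := by
    rw [← Real.rpow_add two_pos]; ring_nf
  have p2 : (2 : ℝ) ^ (1 + -α + β) = 2 ^ (β + 1) / 2 ^ α := by
    rw [← Real.rpow_sub two_pos]; ring_nf
  have h2 : (((2 : ℝ) ^ (β + 1) : ℝ) : ℂ) ≠ 0 := Complex.ofReal_ne_zero.2 (by positivity)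
  have h3 : (((2 : ℝ) ^ α : ℝ) : ℂ) ≠ 0 := Complex.ofReal_ne_zero.2 (by positivity)
  convert! h using 1
  · rw [p1, g1]; push_cast; ring_nf
  · rw [p2, g2]; push_cast; field_simp

/-! ### The connection formula for `α = 0` -/

/-- Termwise differentiation in the parameter: the terms are holomorphic in `ε` and uniformly
dominated on a disk. -/
theorem hasDerivAt_psum_param {w : ℂ → ℕ → ℂ} {d : ℕ → ℂ} {B : ℕ → ℝ} {δ : ℝ} (hδ : 0 < δ)
    (hB : ∀ r : ℝ, 0 ≤ r → r < 1 → Summable fun n => B n * r ^ n)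
    (hd : ∀ n, DifferentiableOn ℂ (fun ε => w ε n) (Metric.ball 0 δ))
    (hle : ∀ n, ∀ ε ∈ Metric.ball (0 : ℂ) δ, ‖w ε n‖ ≤ B n)
    (h0 : ∀ n, HasDerivAt (fun ε => w ε n) (d n) 0) {t : ℂ} (ht : ‖t‖ < 1) :
    Summable (fun n => d n * t ^ n) ∧ HasDerivAt (fun ε => psum (w ε) t) (psum d t) 0 := by
  have hu := hB ‖t‖ (norm_nonneg t) ht
  have hF : ∀ n : ℕ, DifferentiableOn ℂ (fun ε => w ε n * t ^ n) (Metric.ball 0 δ) :=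
    fun n => (hd n).mul_const _
  have hle' : ∀ (n : ℕ) (ε : ℂ), ε ∈ Metric.ball (0 : ℂ) δ → ‖w ε n * t ^ n‖ ≤ B n * ‖t‖ ^ n :=
    fun n ε hε => by
      rw [norm_mul, norm_pow]; gcongr; exact hle n ε hε
  have hz : (0 : ℂ) ∈ Metric.ball (0 : ℂ) δ := Metric.mem_ball_self hδ
  have h1 := Complex.hasSum_deriv_of_summable_norm hu hF Metric.isOpen_ball hle' hz
  have h2 := (Complex.differentiableOn_tsum_of_summable_norm hu hF Metric.isOpen_ball hle'
    0 hz).differentiableAt (Metric.isOpen_ball.mem_nhds hz)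
  have e : ∀ n, deriv (fun ε => w ε n * t ^ n) 0 = d n * t ^ n :=
    fun n => ((h0 n).mul_const _).deriv
  simp_rw [e] at h1
  refine ⟨h1.summable, ?_⟩
  rw [psum, h1.tsum_eq]
  exact h2.hasDerivAt

theorem hasDerivAt_poch_add (n : ℕ) (a ε : ℂ) :
    HasDerivAt (fun ε => poch n (a + ε)) (pochDeriv n (a + ε)) ε :=
  HasDerivAt.comp_const_add a ε (hasDerivAt_poch n _)

theorem hasDerivAt_poch_one_sub (n : ℕ) (ε : ℂ) :
    HasDerivAt (fun ε => poch n (1 - ε)) (-pochDeriv n (1 - ε)) ε :=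
  HasDerivAt.comp_const_sub 1 ε (hasDerivAt_poch n _)

theorem half_le_re {ε : ℂ} (h : ‖ε‖ ≤ 1 / 2) : 1 / 2 ≤ (1 + ε).re ∧ 1 / 2 ≤ (1 - ε).re := by
  have := abs_le.1 ((Complex.abs_re_le_norm ε).trans h)
  simp; constructor <;> linarith [this.1, this.2]

/-- The derivative at `ε = 0` of the coefficients of `F(a, b; 1 - ε; ·)`. -/
def hcoeffDerivSub (a b : ℂ) (n : ℕ) : ℂ :=
  poch n a * poch n b * pochDeriv n 1 / (n.factorial : ℂ) ^ 3

/-- The derivative at `ε = 0` of the coefficients of `F(a + ε, b + ε; 1 + ε; ·)`. -/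
def hcoeffDerivAdd (a b : ℂ) (n : ℕ) : ℂ :=
  (pochDeriv n a * poch n b + poch n a * pochDeriv n b) / (n.factorial : ℂ) ^ 2
    - poch n a * poch n b * pochDeriv n 1 / (n.factorial : ℂ) ^ 3

theorem hasDerivAt_psum_hcoeff_one_sub (a b : ℂ) {t : ℂ} (ht : ‖t‖ < 1) :
    Summable (fun n => hcoeffDerivSub a b n * t ^ n) ∧
    HasDerivAt (fun ε => psum (hcoeff a b (1 - ε)) t)
      (psum (hcoeffDerivSub a b) t) 0 := by
  refine hasDerivAt_psum_param (δ := 1 / 2) (by norm_num)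
    (summable_majorant (M := ‖a‖ + ‖b‖ + 1) (δ := 1 / 2) (by positivity) (by norm_num))
    (fun n ε hε => ?_) (fun n ε hε => ?_) (fun n => ?_) ht
  · have hre := (half_le_re (mem_ball_zero_iff.1 hε).le).2
    have h3 : (n.factorial : ℂ) ≠ 0 := by exact_mod_cast n.factorial_ne_zero
    exact ((differentiableAt_const _).div ((hasDerivAt_poch_one_sub n ε).differentiableAt.mul_const _)
      (mul_ne_zero (poch_ne_zero (by linarith) n) h3)).differentiableWithinAt
  · exact norm_hcoeff_le (by linarith [norm_nonneg b]) (by linarith [norm_nonneg a]) (by norm_num)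
      (by norm_num) (half_le_re (mem_ball_zero_iff.1 hε).le).2 n
  · have h3 : (n.factorial : ℂ) ≠ 0 := by exact_mod_cast n.factorial_ne_zero
    have h := (hasDerivAt_const (0 : ℂ) (poch n a * poch n b)).div
      ((hasDerivAt_poch_one_sub n 0).mul_const (n.factorial : ℂ)) (by simp [poch_one, h3])
    convert! h using 1
    simp only [sub_zero, poch_one, hcoeffDerivSub]
    field_simp
    ring

theorem hasDerivAt_psum_hcoeff_add (a b : ℂ) {t : ℂ} (ht : ‖t‖ < 1) :
    Summable (fun n => hcoeffDerivAdd a b n * t ^ n) ∧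
    HasDerivAt (fun ε => psum (hcoeff (a + ε) (b + ε) (1 + ε)) t)
      (psum (hcoeffDerivAdd a b) t) 0 := by
  refine hasDerivAt_psum_param (δ := 1 / 2) (by norm_num)
    (summable_majorant (M := ‖a‖ + ‖b‖ + 1) (δ := 1 / 2) (by positivity) (by norm_num))
    (fun n ε hε => ?_) (fun n ε hε => ?_) (fun n => ?_) ht
  · have hre := (half_le_re (mem_ball_zero_iff.1 hε).le).1
    have h3 : (n.factorial : ℂ) ≠ 0 := by exact_mod_cast n.factorial_ne_zero
    exact (((hasDerivAt_poch_add n a ε).differentiableAt.mul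
      (hasDerivAt_poch_add n b ε).differentiableAt).div
      ((hasDerivAt_poch_add n 1 ε).differentiableAt.mul_const _)
      (mul_ne_zero (poch_ne_zero (by linarith) n) h3)).differentiableWithinAt
  · have hε' := (mem_ball_zero_iff.1 hε).le
    exact norm_hcoeff_le (by linarith [norm_add_le a ε, norm_nonneg b])
      (by linarith [norm_add_le b ε, norm_nonneg a]) (by norm_num) (by norm_num)
      (half_le_re hε').1 n
  · have h3 : (n.factorial : ℂ) ≠ 0 := by exact_mod_cast n.factorial_ne_zero
    have h := ((hasDerivAt_poch_add n a 0).mul (hasDerivAt_poch_add n b 0)).div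
      ((hasDerivAt_poch_add n 1 0).mul_const (n.factorial : ℂ)) (by simp [poch_one, h3])
    convert! h using 1
    simp only [add_zero, poch_one, Pi.mul_apply, hcoeffDerivAdd]
    field_simp

/-- `1/Γ`, an entire function. -/
def rGamma (s : ℂ) : ℂ := (Complex.Gamma s)⁻¹

theorem differentiable_rGamma : Differentiable ℂ rGamma := Complex.differentiable_one_div_Gamma

/-- The entire extension of `(2γ + ψ(a) + ψ(b)) / (Γ(a) Γ(b))`. -/
def psiRatio (a b : ℂ) : ℂ :=
  2 * (Real.eulerMascheroniConstant : ℂ) * (rGamma a * rGamma b)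
    - (deriv rGamma a * rGamma b + rGamma a * deriv rGamma b)

theorem tendsto_psum_hcoeff {X : Type*} {l : Filter X} {a b c : X → ℂ} {a₀ b₀ c₀ : ℂ}
    (ha : Tendsto a l (𝓝 a₀)) (hb : Tendsto b l (𝓝 b₀)) (hc : Tendsto c l (𝓝 c₀))
    (h : 0 < c₀.re) {t : ℂ} (ht : ‖t‖ < 1) :
    Tendsto (fun x => psum (hcoeff (a x) (b x) (c x)) t) l (𝓝 (psum (hcoeff a₀ b₀ c₀) t)) := by
  have hpc : ∀ n, Continuous (poch n) := fun n => Polynomial.continuous _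
  have hδ : 0 < min 1 (c₀.re / 2) := lt_min one_pos (by linarith)
  refine tendsto_psum (summable_majorant (M := ‖a₀‖ + ‖b₀‖ + 1) (δ := min 1 (c₀.re / 2))
    (by positivity) hδ) (fun n => ?_) ?_ ht
  · have h3 : (n.factorial : ℂ) ≠ 0 := by exact_mod_cast n.factorial_ne_zero
    exact ((((hpc n).tendsto _).comp ha).mul (((hpc n).tendsto _).comp hb)).div
      ((((hpc n).tendsto _).comp hc).mul_const _) (mul_ne_zero (poch_ne_zero h n) h3)
  · filter_upwards [ha.norm.eventually (gt_mem_nhds (lt_add_one _)),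
      hb.norm.eventually (gt_mem_nhds (lt_add_one _)),
      ((Complex.continuous_re.tendsto _).comp hc).eventually
        (lt_mem_nhds (by linarith : c₀.re / 2 < c₀.re))] with x h1 h2 h3 n
    exact norm_hcoeff_le (by linarith [norm_nonneg b₀]) (by linarith [norm_nonneg a₀]) hδ
      (min_le_left _ _) ((min_le_right _ _).trans h3.le) n

/-- The path `(-ε, β + ε)` keeps `α + β`, hence `σ`. In `y₁` the parameters `a`, `b` stay fixed and
only `c = 1 + β + ε` moves. -/
theorem sig_sub_add (β ε : ℝ) (z : ℂ) : sig (-ε) (β + ε) z = sig 0 β z := by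
  simp only [sig]; congr 1; push_cast; ring

/-- The connection formula for parameters `(-ε, β + ε)`, `ε > 0`. -/
theorem y₁_connection {β ε : ℝ} (hβ : -1 < β) (hε : ε ∈ Ioo (0 : ℝ) 1) (z : ℂ) {x : ℝ}
    (hx : x ∈ Ioo (-1 : ℝ) 1) {a b : ℂ} (ha : a = aPar 0 β (sig 0 β z))
    (hb : b = aPar 0 β (-sig 0 β z)) :
    y₁ (-ε) (β + ε) z x = Complex.Gamma (1 + β + ε) * ((ε : ℂ)⁻¹ *
      (Complex.Gamma (1 + ε) * (rGamma (a + ε) * rGamma (b + ε)) *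
          psum (hcoeff a b (1 - ε)) (((1 - x) / 2 : ℝ) : ℂ)
        - Complex.Gamma (1 - ε) * (rGamma a * rGamma b) * ((((1 - x) / 2 : ℝ) : ℂ) ^ (ε : ℂ) *
          psum (hcoeff (a + ε) (b + ε) (1 + ε)) (((1 - x) / 2 : ℝ) : ℂ)))) := by
  have hα : -ε ∈ Ioo (-1 : ℝ) 0 := ⟨by linarith [hε.2], by linarith [hε.1]⟩
  have hα' : -ε ∈ Ioo (-1 : ℝ) 1 := ⟨hα.1, by linarith [hα.2]⟩
  have hβε : -1 < β + ε := by linarith [hε.1]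
  obtain ⟨A, B, hAB, -⟩ := (isSolution_y₁ (-ε) hβε z).exists_eq_r hα'
  have k := (hasBdryRight_of_eq_r hα' hAB).unique (hasBdryRight_y₁_of_neg hα hβε z)
  rw [if_pos hα.2, if_pos hα.2, neg_neg, sig_sub_add] at k
  have a1 : aPar ε (β + ε) (sig 0 β z) = a + ε := by
    rw [ha]; simp only [aPar]; push_cast; ring
  have a2 : aPar ε (β + ε) (-sig 0 β z) = b + ε := by
    rw [hb]; simp only [aPar]; push_cast; ring
  have a3 : aPar (-ε) (β + ε) (sig 0 β z) = a := by
    rw [ha]; simp only [aPar]; push_cast; ring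
  have a4 : aPar (-ε) (β + ε) (-sig 0 β z) = b := by
    rw [hb]; simp only [aPar]; push_cast; ring
  have hL : leadingCoeff (β + ε) (-ε) = ε * 2 ^ (1 + β) * 2 ^ ε := by
    rw [leadingCoeff, if_neg hα.2.ne, neg_neg, mul_assoc, ← Real.rpow_add two_pos]; ring_nf
  have hε0 : (ε : ℂ) ≠ 0 := Complex.ofReal_ne_zero.2 hε.1.ne'
  have p1 : (((2 : ℝ) ^ (1 + β) : ℝ) : ℂ) ≠ 0 := Complex.ofReal_ne_zero.2 (by positivity)
  have p2 : (((2 : ℝ) ^ ε : ℝ) : ℂ) ≠ 0 := Complex.ofReal_ne_zero.2 (by positivity)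
  have hs : 0 < (1 - x) / 2 := by linarith [hx.2]
  have r1 : r₁ (-ε) (β + ε) z x = psum (hcoeff a b (1 - ε)) (((1 - x) / 2 : ℝ) : ℂ) := by
    rw [r₁, y₁_eq_psum, sig_comm, sig_sub_add, aPar_comm, a3, aPar_comm, a4, ← sub_eq_add_neg,
      Complex.ofReal_neg, ← sub_eq_add_neg]
  have r2 : r₂ (-ε) (β + ε) z x = ((2 ^ ε : ℝ) : ℂ) * ((((1 - x) / 2 : ℝ) : ℂ) ^ (ε : ℂ) *
      psum (hcoeff (a + ε) (b + ε) (1 + ε)) (((1 - x) / 2 : ℝ) : ℂ)) := by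
    rw [r₂, y₂_eq_rpow_mul hα.2.ne, y₁_eq_psum, sig_shift_right, neg_neg, sig_comm, sig_sub_add,
      aPar_comm, a1, aPar_comm, a2, ← sub_eq_add_neg, ← Complex.ofReal_cpow hs.le, ← mul_assoc,
      ← Complex.ofReal_mul, ← Real.mul_rpow zero_le_two hs.le]
    ring_nf
  -- The factor `ε⁻¹` is that of `Γ(ε) = Γ(1+ε)/ε` here, and that of `leadingCoeff` in `kB`.
  have kA : A = Complex.Gamma (1 + β + ε) * ((ε : ℂ)⁻¹ *
      (Complex.Gamma (1 + ε) * (rGamma (a + ε) * rGamma (b + ε)))) := by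
    rw [k.1, GG, a1, a2, add_comm 1 (ε : ℂ), Complex.Gamma_add_one _ hε0]
    simp only [rGamma]
    rw [div_eq_mul_inv, mul_inv]
    push_cast
    rw [neg_neg, ← add_assoc]
    field_simp
  have kB : B * ((2 ^ ε : ℝ) : ℂ) = -(Complex.Gamma (1 + β + ε) * ((ε : ℂ)⁻¹ *
      (Complex.Gamma (1 - ε) * (rGamma a * rGamma b)))) := by
    have h := k.2
    rw [hL, GG, a3, a4, div_eq_mul_inv, mul_inv, show 1 + -ε + (β + ε) = 1 + β by ring] at h
    simp only [rGamma]
    refine mul_left_cancel₀ (mul_ne_zero hε0 p1) ?_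
    push_cast at h ⊢
    rw [← add_assoc, ← sub_eq_add_neg] at h
    linear_combination -h + ((2 ^ (1 + β) : ℝ) : ℂ) * Complex.Gamma (1 + β + ε) *
      Complex.Gamma (1 - ε) * (Complex.Gamma a)⁻¹ * (Complex.Gamma b)⁻¹ * mul_inv_cancel₀ hε0
  rw [hAB x hx, r1, r2, kA]
  linear_combination ((((1 - x) / 2 : ℝ) : ℂ) ^ (ε : ℂ) *
      psum (hcoeff (a + ε) (b + ε) (1 + ε)) (((1 - x) / 2 : ℝ) : ℂ)) * kB

theorem norm_half_sub_lt {x : ℝ} (hx : x ∈ Ioo (-1 : ℝ) 1) :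
    ‖(((1 - x) / 2 : ℝ) : ℂ)‖ < 1 := by
  have := norm_half_add_lt (neg_mem_Ioo hx)
  rwa [← sub_eq_add_neg] at this

/-- The logarithmic connection formula. -/
theorem y₁_zero_connection {β : ℝ} (hβ : -1 < β) (z : ℂ) {x : ℝ} (hx : x ∈ Ioo (-1 : ℝ) 1)
    {a b : ℂ} (ha : a = aPar 0 β (sig 0 β z)) (hb : b = aPar 0 β (-sig 0 β z)) :
    y₁ 0 β z x = -Complex.Gamma (1 + β) *
      (psiRatio a b * r₁ 0 β z x + rGamma a * rGamma b * r₂ 0 β z x) := by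
  set s : ℂ := (((1 - x) / 2 : ℝ) : ℂ) with hs
  have hs1 : ‖s‖ < 1 := norm_half_sub_lt hx
  have hs0' : 0 < (1 - x) / 2 := by linarith [hx.2]
  have hs0 : s ≠ 0 := Complex.ofReal_ne_zero.2 hs0'.ne'
  have hγ : HasDerivAt (fun ε : ℂ => Complex.Gamma (1 + ε))
      (-(Real.eulerMascheroniConstant : ℂ)) 0 :=
    HasDerivAt.comp_const_add 1 0 (by simpa using Complex.hasDerivAt_Gamma_one)
  have hγ' : HasDerivAt (fun ε : ℂ => Complex.Gamma (1 - ε))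
      (-(-(Real.eulerMascheroniConstant : ℂ))) 0 :=
    HasDerivAt.comp_const_sub 1 0 (by simpa using Complex.hasDerivAt_Gamma_one)
  have hR : ∀ a : ℂ, HasDerivAt (fun ε : ℂ => rGamma (a + ε)) (deriv rGamma a) 0 := fun a =>
    HasDerivAt.comp_const_add a 0 (by simpa using (differentiable_rGamma a).hasDerivAt)
  have hpow : HasDerivAt (fun ε : ℂ => s ^ ε) (Complex.log s) 0 := by
    simpa using (hasDerivAt_id (0 : ℂ)).const_cpow (c := s) (Or.inl hs0)
  obtain ⟨S1, hP1⟩ := hasDerivAt_psum_hcoeff_one_sub a b hs1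
  obtain ⟨S2, hP2⟩ := hasDerivAt_psum_hcoeff_add a b hs1
  -- The bracket `N(ε)` of the connection formula vanishes at `ε = 0`, where its two terms coincide.
  -- So `N(ε)/ε` tends to `N'(0)`, and the product rule yields `γ`, the derivatives of `1/Γ`, and
  -- `log s`.
  have hN := ((hγ.mul ((hR a).mul (hR b))).mul hP1).sub
    ((hγ'.mul_const (rGamma a * rGamma b)).mul (hpow.mul hP2))
  have hlim := hN.tendsto_slope_zero
  simp only [Pi.mul_apply, Pi.sub_apply, add_zero, sub_zero, Complex.Gamma_one, one_mul,
    Complex.cpow_zero, zero_add, sub_self, smul_eq_mul] at hlim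
  have hr : Tendsto (fun ε : ℝ => (ε : ℂ)) (𝓝[>] 0) (𝓝[≠] 0) := by
    refine tendsto_nhdsWithin_iff.2 ⟨?_, ?_⟩
    · exact_mod_cast (Complex.continuous_ofReal.tendsto 0).mono_left nhdsWithin_le_nhds
    · filter_upwards [self_mem_nhdsWithin] with ε hε
      exact Complex.ofReal_ne_zero.2 (ne_of_gt hε)
  have hr0 : Tendsto (fun ε : ℝ => (ε : ℂ)) (𝓝[>] 0) (𝓝 0) :=
    hr.mono_right nhdsWithin_le_nhds
  have hG : Tendsto (fun ε : ℝ => Complex.Gamma (1 + β + ε)) (𝓝[>] 0)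
      (𝓝 (Complex.Gamma (1 + β))) := by
    have hc : ContinuousAt Complex.Gamma (1 + β) := by
      refine Complex.continuousAt_Gamma _ fun m h => ?_
      have := congrArg Complex.re h
      simp at this
      linarith [(m.cast_nonneg : (0 : ℝ) ≤ m)]
    refine hc.tendsto.comp ?_
    simpa using hr0.const_add (1 + β : ℂ)
  have h1 := hG.mul (hlim.comp hr)
  have h2 : Tendsto (fun ε : ℝ => y₁ (-ε) (β + ε) z x) (𝓝[>] 0) (𝓝 (y₁ 0 β z x)) := by
    have e : ∀ ε : ℝ, y₁ (-ε) (β + ε) z x =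
        psum (hcoeff a b (1 + β + ε)) (((1 + x) / 2 : ℝ) : ℂ) := by
      intro ε
      rw [y₁_eq_psum, sig_sub_add, ha, hb]
      simp only [aPar]
      push_cast
      ring_nf
    simp_rw [e]
    rw [y₁_eq_psum, ← ha, ← hb]
    refine tendsto_psum_hcoeff tendsto_const_nhds tendsto_const_nhds ?_ (by simp; linarith)
      (norm_half_add_lt hx)
    simpa using hr0.const_add (1 + β : ℂ)
  have h3 := tendsto_nhds_unique h2 (h1.congr' (by
    filter_upwards [Ioo_mem_nhdsGT (zero_lt_one' ℝ)] with ε hε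
    rw [y₁_connection hβ hε z hx ha hb]
    rfl))
  -- The `ε`-derivatives of the two hypergeometric series combine to the power series part of the
  -- logarithmic solution.
  have hlog : psum (logCoeff a b) s =
      psum (hcoeffDerivAdd a b) s - psum (hcoeffDerivSub a b) s := by
    have := S2.tsum_sub S1
    rw [psum, psum, psum, ← this]
    refine tsum_congr fun n => ?_
    rw [logCoeff_eq_pochDeriv, hcoeffDerivAdd, hcoeffDerivSub]
    ring
  have er1 : r₁ 0 β z x = psum (hcoeff a b 1) s := by
    rw [r₁, y₁_eq_psum, sig_comm, aPar_comm, ← ha, aPar_comm, ← hb, ← sub_eq_add_neg]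
    simp [hs]
  have er2 : r₂ 0 β z x = psum (hcoeff a b 1) s * Complex.log s + psum (logCoeff a b) s := by
    rw [r₂, y₂_zero_eq z (neg_mem_Ioo hx), sig_comm, aPar_comm, ← ha, aPar_comm, ← hb,
      ← sub_eq_add_neg, Complex.ofReal_log hs0'.le]
  rw [h3, er1, er2, hlog, psiRatio]
  ring

theorem hasBdryRight_y₁_zero {β : ℝ} (hβ : -1 < β) (z : ℂ) :
    HasBdryRight 0 β (y₁ 0 β z)
      (-((2 ^ (1 + β) : ℝ) : ℂ) * Complex.Gamma (1 + β) / GG 0 β (sig 0 β z))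
      (-Complex.Gamma (1 + β) * psiRatio (aPar 0 β (sig 0 β z)) (aPar 0 β (-sig 0 β z))) := by
  have h := hasBdryRight_of_eq_r (α := 0) (β := β) (z := z) (g := y₁ 0 β z)
    (A := -Complex.Gamma (1 + β) * psiRatio (aPar 0 β (sig 0 β z)) (aPar 0 β (-sig 0 β z)))
    (B := -Complex.Gamma (1 + β) * (rGamma (aPar 0 β (sig 0 β z)) * rGamma (aPar 0 β (-sig 0 β z))))
    (by norm_num) fun x hx => by rw [y₁_zero_connection hβ z hx rfl rfl]; ring
  rw [if_neg (lt_irrefl _), if_neg (lt_irrefl _), leadingCoeff, if_pos rfl] at h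
  convert! h using 1
  rw [GG, div_eq_mul_inv, mul_inv, rGamma, rGamma, add_comm β 1]
  ring

/-! ### Dependence on `z` -/

/-- The square root jumps across its cut, but only by a sign, which an even `E` does not see. Since
`(σ(w) - σ(w₀))(σ(w) + σ(w₀)) = 4(w - w₀)`, one of the factors is below `δ` once `|w - w₀| < δ²/4`.
-/
theorem continuous_comp_sig {E : ℂ → ℂ} (hE : Continuous E) (he : ∀ σ, E (-σ) = E σ) (α β : ℝ) :
    Continuous fun w => E (sig α β w) := by
  rw [continuous_iff_continuousAt]
  intro w₀
  rw [Metric.continuousAt_iff]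
  intro ε hε
  obtain ⟨δ, hδ, h⟩ := Metric.continuousAt_iff.1 hE.continuousAt ε hε
  refine ⟨δ ^ 2 / 4, by positivity, fun {w} hw => ?_⟩
  have e : (sig α β w - sig α β w₀) * (sig α β w + sig α β w₀) = 4 * (w - w₀) := by
    linear_combination sig_sq α β w - sig_sq α β w₀
  have e2 : ‖sig α β w - sig α β w₀‖ * ‖sig α β w + sig α β w₀‖ < δ * δ := by
    rw [← norm_mul, e, norm_mul]
    rw [dist_eq_norm] at hw
    have : ‖(4 : ℂ)‖ = 4 := by simp
    rw [this]
    nlinarith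
  rcases lt_or_ge ‖sig α β w - sig α β w₀‖ δ with h1 | h1
  · exact h (by rwa [dist_eq_norm])
  · have h2 : ‖sig α β w + sig α β w₀‖ < δ := by
      by_contra h3
      exact absurd e2 (not_lt.2 (mul_le_mul h1 (not_lt.1 h3) hδ.le (norm_nonneg _)))
    have h3 := h (x := -sig α β w) (by
      rw [dist_eq_norm, ← norm_neg]; convert! h2 using 2; ring)
    rwa [he] at h3

theorem continuous_aPar (μ ν : ℝ) : Continuous (aPar μ ν) := by
  unfold aPar; fun_prop

theorem continuous_psiRatio_sig (μ ν α β : ℝ) :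
    Continuous fun w => psiRatio (aPar μ ν (sig α β w)) (aPar μ ν (-sig α β w)) := by
  have h1 : Continuous rGamma := differentiable_rGamma.continuous
  have h2 : Continuous (deriv rGamma) :=
    (differentiable_rGamma.contDiff (n := 1)).continuous_deriv le_rfl
  have ha := continuous_aPar μ ν
  have hb : Continuous fun σ => aPar μ ν (-σ) := ha.comp continuous_neg
  refine continuous_comp_sig (E := fun σ => psiRatio (aPar μ ν σ) (aPar μ ν (-σ))) ?_
    (fun σ => ?_) α β
  · exact (((h1.comp ha).mul (h1.comp hb)).const_mul _).sub
      (((h2.comp ha).mul (h1.comp hb)).add ((h1.comp ha).mul (h2.comp hb)))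
  · simp only [neg_neg, psiRatio]; ring

theorem continuous_y₁_param (α : ℝ) {β : ℝ} (hβ : -1 < β) {x : ℝ} (hx : x ∈ Ioo (-1 : ℝ) 1) :
    Continuous fun w => y₁ α β w x := by
  simp_rw [y₁_eq_psum]
  refine continuous_comp_sig (E := fun σ => psum (hcoeff (aPar α β σ) (aPar α β (-σ)) (1 + β))
    (((1 + x) / 2 : ℝ) : ℂ)) ?_ (fun σ => ?_) α β
  · have ha := continuous_aPar α β
    exact continuous_iff_continuousAt.2 fun σ => tendsto_psum_hcoeff (ha.tendsto σ)
      ((ha.comp continuous_neg).tendsto σ) tendsto_const_nhds (by simp; linarith)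
      (norm_half_add_lt hx)
  · simp only [neg_neg]; rw [hcoeff_symm]

theorem logCoeff_symm (a b : ℂ) : logCoeff a b = logCoeff b a := by
  funext n; simp only [logCoeff]; ring

theorem tendsto_psum_logCoeff {X : Type*} {l : Filter X} {a b : X → ℂ} {a₀ b₀ : ℂ}
    (ha : Tendsto a l (𝓝 a₀)) (hb : Tendsto b l (𝓝 b₀)) {t : ℂ} (ht : ‖t‖ < 1) :
    Tendsto (fun x => psum (logCoeff (a x) (b x)) t) l (𝓝 (psum (logCoeff a₀ b₀) t)) := by
  have hp : ∀ n, Continuous (poch n) := fun n => Polynomial.continuous _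
  have hd : ∀ n, Continuous (pochDeriv n) := fun n => Polynomial.continuous _
  refine tendsto_psum (summable_two_mul_majorant (M := ‖a₀‖ + ‖b₀‖ + 3 / 2) (δ := 1 / 2)
    (by positivity) (by norm_num)) (fun n => ?_) ?_ ht
  · have pa := ((hp n).tendsto _).comp ha
    have pb := ((hp n).tendsto _).comp hb
    have da := ((hd n).tendsto _).comp ha
    have db := ((hd n).tendsto _).comp hb
    exact (((da.mul pb).add (pa.mul db)).add ((pa.mul pb).mul_const _)).div_const _
  · filter_upwards [ha.norm.eventually (gt_mem_nhds (lt_add_one _)),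
      hb.norm.eventually (gt_mem_nhds (lt_add_one _))] with x h1 h2 n
    exact norm_logCoeff_le (by linarith [norm_nonneg b₀]) (by linarith [norm_nonneg a₀]) n

theorem continuous_y₂_zero_param (α : ℝ) {x : ℝ} (hx : x ∈ Ioo (-1 : ℝ) 1) :
    Continuous fun w => y₂ α 0 w x := by
  have h1 : (fun w => y₂ α 0 w x) = fun w => y₁ α 0 w x * (Real.log ((1 + x) / 2) : ℂ) +
      psum (logCoeff (aPar α 0 (sig α 0 w)) (aPar α 0 (-sig α 0 w))) (((1 + x) / 2 : ℝ) : ℂ) := by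
    funext w
    rw [y₂_zero_eq w hx, y₁_eq_psum, Complex.ofReal_zero, add_zero]
  rw [h1]
  refine ((continuous_y₁_param α (by norm_num) hx).mul continuous_const).add ?_
  refine continuous_comp_sig (E := fun σ => psum (logCoeff (aPar α 0 σ) (aPar α 0 (-σ)))
    (((1 + x) / 2 : ℝ) : ℂ)) ?_ (fun σ => ?_) α 0
  · have ha := continuous_aPar α 0
    exact continuous_iff_continuousAt.2 fun σ => tendsto_psum_logCoeff (ha.tendsto σ)
      ((ha.comp continuous_neg).tendsto σ) (norm_half_add_lt hx)
  · simp only [neg_neg]; rw [logCoeff_symm]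

/-- A pole forces `σ² = (1+μ+ν+2n)²`, so the exceptional points lie in a real sequence tending to
infinity. Only finitely many of its terms are near `z`. -/
theorem eventually_noPole (μ ν α β : ℝ) (z : ℂ) :
    ∀ᶠ w in 𝓝[≠] z, NoPole μ ν (sig α β w) := by
  set g : ℕ → ℝ := fun n => ((1 + μ + ν + 2 * n) ^ 2 - (1 + α + β) ^ 2) / 4 with hg
  have hbad : ∀ w, ¬ NoPole μ ν (sig α β w) → ∃ n : ℕ, w = g n := by
    intro w hw
    simp only [NoPole, not_forall, not_and_or, not_not] at hw
    obtain ⟨n, hn⟩ := hw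
    refine ⟨n, ?_⟩
    have h := sig_sq α β w
    have h2 : sig α β w ^ 2 = (1 + μ + ν + 2 * n) ^ 2 := by
      simp only [aPar] at hn
      rcases hn with hn | hn
      · have : sig α β w = -(1 + μ + ν + 2 * n) := by linear_combination 2 * hn
        rw [this]; ring
      · have : sig α β w = 1 + μ + ν + 2 * n := by linear_combination -2 * hn
        rw [this]
    simp only [hg]
    push_cast
    linear_combination (h2 - h) / 4
  have hlim : Tendsto g atTop atTop := by
    refine Tendsto.atTop_div_const (by norm_num) (tendsto_atTop_add_const_right _ _ ?_)
    refine (tendsto_pow_atTop two_ne_zero).comp (tendsto_atTop_add_const_left _ _ ?_)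
    exact tendsto_natCast_atTop_atTop.const_mul_atTop two_pos
  obtain ⟨N, hN⟩ := eventually_atTop.1 (hlim.eventually_gt_atTop (‖z‖ + 1))
  set S : Set ℂ := (fun n : ℕ => (g n : ℂ)) '' Iio N with hS
  have hfin : (S \ {z}).Finite := ((finite_Iio N).image _).subset sdiff_subset
  have h1 : ∀ᶠ w in 𝓝 z, w ∉ S \ {z} :=
    hfin.isClosed.isOpen_compl.mem_nhds (by simp)
  have h2 : ∀ᶠ w in 𝓝 z, ‖w‖ < ‖z‖ + 1 :=
    continuous_norm.continuousAt.eventually (gt_mem_nhds (lt_add_one _))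
  filter_upwards [nhdsWithin_le_nhds h1, nhdsWithin_le_nhds h2, self_mem_nhdsWithin] with w w1 w2 w3
  by_contra hw
  obtain ⟨n, rfl⟩ := hbad w hw
  refine w1 ⟨⟨n, ?_, rfl⟩, w3⟩
  by_contra hn
  have h3 := hN n (not_lt.1 hn)
  rw [Complex.norm_real] at w2
  linarith [Real.le_norm_self (g n)]

theorem isContinuedValue_of_continuousAt {regular : ℂ → Prop} {f E : ℂ → ℂ} {z : ℂ}
    (hE : ContinuousAt E z) (hf : ∀ w, regular w → f w = E w)
    (hr : ∀ᶠ w in 𝓝[≠] z, regular w) : IsContinuedValue regular f z (E z) := by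
  refine ⟨(hE.tendsto.mono_left nhdsWithin_le_nhds).congr' ?_, fun h => (hf z h).symm⟩
  filter_upwards [hr] with w hw using (hf w hw).symm

theorem deriv_rGamma {a : ℂ} (ha : ∀ n : ℕ, a ≠ -(n : ℂ)) :
    deriv rGamma a = -Complex.digamma a * rGamma a := by
  have h0 := Complex.Gamma_ne_zero ha
  have h := ((Complex.differentiableAt_Gamma a ha).hasDerivAt.inv h0).deriv
  have h2 : deriv rGamma a = _ := h
  rw [h2, Complex.digamma_def, logDeriv_apply, rGamma]
  field_simp

theorem psiRatio_eq {μ ν : ℝ} {σ : ℂ} (h : NoPole μ ν σ) :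
    psiRatio (aPar μ ν σ) (aPar μ ν (-σ)) = psiSum μ ν σ * (GG μ ν σ)⁻¹ := by
  rw [psiRatio, deriv_rGamma fun n => (h n).1, deriv_rGamma fun n => (h n).2, psiSum, GG, mul_inv,
    rGamma, rGamma]
  ring

/-! ### Boundary values of `y₂` at `1` for `β ≠ 0` -/

/-- The power differs from `1` by `O(1+x)`, so multiplying by it preserves logarithmic asymptotics
at `-1` up to `o(1)`. -/
theorem tendsto_half_sub_rpow_sub_one_mul_log (s : ℝ) :
    Tendsto (fun x : ℝ => (((((1 - x) / 2) ^ s : ℝ) : ℂ) - 1) * (Real.log ((1 + x) / 2) : ℂ))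
      (𝓝[>] (-1)) (𝓝 0) := by
  have h : HasDerivAt (fun x : ℝ => ((1 - x) / 2) ^ s)
      (-1 / 2 * s * ((1 - -1) / 2) ^ (s - 1)) (-1) :=
    (((hasDerivAt_id (-1 : ℝ)).const_sub 1).div_const 2).rpow_const (Or.inl (by norm_num))
  rw [hasDerivAt_iff_tendsto_slope] at h
  have h1 := h.mono_left (nhdsWithin_mono _ fun x (hx : x ∈ Ioi (-1 : ℝ)) => ne_of_gt hx)
  have h2 := ((Complex.continuous_ofReal.tendsto _).comp h1).mul tendsto_one_add_mul_log
  rw [mul_zero] at h2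
  refine h2.congr' ?_
  filter_upwards [self_mem_nhdsWithin] with x hx
  have h0 : (1 + (x : ℂ)) ≠ 0 := by
    have : -1 < x := hx
    exact_mod_cast (by linarith : (1 + x) ≠ 0)
  simp only [Function.comp, slope_def_field, sub_neg_eq_add]
  rw [add_comm x 1]
  rw [show ((1 : ℝ) + 1) / 2 = 1 by norm_num, Real.one_rpow]
  push_cast
  field_simp

/-- Euler's transformation for the second solution. -/
theorem y₂_eq_euler {α β : ℝ} (hα : α ∈ Ioo (-1 : ℝ) 1) (hβ : β ∈ Ioo (-1 : ℝ) 1) (z : ℂ) :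
    ∀ x ∈ Ioo (-1 : ℝ) 1, y₂ α β z x =
      ((((1 - x) / 2) ^ (-α) : ℝ) : ℂ) * y₂ (-α) β (z + α * (1 + β)) x := by
  by_cases h0 : β = 0
  · subst h0
    intro x hx
    -- For `β = 0` the right-hand side is a solution with the same logarithmic asymptotics, which
    -- determine it.
    refine (IsSolution.eq_y₂_of_tendsto (IsSolution.one_sub_rpow_mul
      (isSolution_y₂ (-α) hβ.2 (z + α * (1 + (0 : ℝ))))) ?_ x hx).symm
    have h := ((tendsto_half_sub_rpow_left (-α)).mul (tendsto_y₂_sub_log (-α)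
      (z + α * (1 + (0 : ℝ))))).add (tendsto_half_sub_rpow_sub_one_mul_log (-α))
    rw [mul_zero, add_zero] at h
    refine h.congr fun x => ?_
    ring
  · intro x hx
    rw [y₂_eq_rpow_mul h0, y₂_eq_rpow_mul h0, y₁_eq_euler hα (by linarith [hβ.2]) _ x hx,
      show z + β * (1 + α) + α * (1 + ((-β : ℝ) : ℂ)) =
        z + α * (1 + β) + β * (1 + ((-α : ℝ) : ℂ)) by push_cast; ring]
    ring

/-- How the boundary values at `1` change under multiplication by `(1 + x)^{-β}`. -/
theorem HasBdryRight.one_add_rpow_mul {α β : ℝ} (hα : α ∈ Ioo (-1 : ℝ) 1)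
    (hβ : β ∈ Ioo (-1 : ℝ) 1) {z : ℂ} {g G : ℝ → ℂ}
    (hG : IsSolution α (-β) (z + β * (1 + α)) G) {V V' : ℂ} (hV : HasBdryRight α (-β) G V V')
    (hg : ∀ x ∈ Ioo (-1 : ℝ) 1, g x = (((1 + x) ^ (-β) : ℝ) : ℂ) * G x) :
    HasBdryRight α β g (if α < 0 then ((2 ^ (-β) : ℝ) : ℂ) * V else ((2 ^ β : ℝ) : ℂ) * V)
      (if α < 0 then ((2 ^ β : ℝ) : ℂ) * V' else ((2 ^ (-β) : ℝ) : ℂ) * V') := by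
  obtain ⟨A, B, hAB, -⟩ := hG.exists_eq_r hα
  have k := hV.unique (hasBdryRight_of_eq_r hα hAB)
  have hpow : ∀ x ∈ Ioo (-1 : ℝ) 1, (((1 + x) ^ (-β) : ℝ) : ℂ) =
      ((2 ^ (-β) : ℝ) : ℂ) * ((((1 - -x) / 2) ^ (-β) : ℝ) : ℂ) := by
    intro x hx
    have : 0 ≤ 1 + x := by linarith [hx.1]
    rw [← Complex.ofReal_mul, ← Real.mul_rpow zero_le_two (by linarith)]
    ring_nf
  have h := hasBdryRight_of_eq_r (z := z) (g := g) (A := ((2 ^ (-β) : ℝ) : ℂ) * A)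
    (B := ((2 ^ (-β) : ℝ) : ℂ) * B) hα fun x hx => by
      -- Reflected, Euler's transformation says that `((1+x)/2)^{-β}` takes `r₁`, `r₂` at `-β` to
      -- those at `β`. Both coefficients are thus multiplied by `2^{-β}`, while `leadingCoeff`
      -- changes by `4^β`.
      have e1 := y₁_eq_euler hβ hα.1 z (-x) (neg_mem_Ioo hx)
      have e2 := y₂_eq_euler hβ hα z (-x) (neg_mem_Ioo hx)
      rw [hg x hx, hAB x hx, hpow x hx, r₁, r₁, r₂, r₂, e1, e2]
      ring
  have hL : (leadingCoeff β α : ℂ) = ((2 ^ β : ℝ) : ℂ) * ((2 ^ β : ℝ) : ℂ) *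
      leadingCoeff (-β) α := by
    have e : (2 : ℝ) ^ (β + 1) = 2 ^ β * 2 ^ β * 2 ^ (-β + 1) := by
      rw [← Real.rpow_add two_pos, ← Real.rpow_add two_pos]; ring_nf
    rw [← Complex.ofReal_mul, ← Complex.ofReal_mul]
    congr 1
    unfold leadingCoeff
    split_ifs
    · exact e
    · rw [e]; ring
  have h1 : ((2 ^ (-β) : ℝ) : ℂ) * ((2 ^ β : ℝ) : ℂ) = 1 := by
    rw [rpow_mul_rpow_cast two_pos, neg_add_cancel]; simp
  rw [hL] at h
  by_cases h3 : α < 0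
  · simp only [if_pos h3] at h k ⊢
    rw [k.1, k.2]
    convert! h using 1
    linear_combination (((2 ^ β : ℝ) : ℂ) * B * leadingCoeff (-β) α) * h1
  · simp only [if_neg h3] at h k ⊢
    rw [k.1, k.2]
    convert! h using 1
    linear_combination -(((2 ^ β : ℝ) : ℂ) * B * leadingCoeff (-β) α) * h1

theorem hasBdryRight_y₂_of_neg {α β : ℝ} (hα : α ∈ Ioo (-1 : ℝ) 0) (hβ : β ∈ Ioo (-1 : ℝ) 1)
    (h0 : β ≠ 0) (z : ℂ) : HasBdryRight α β (y₂ α β z)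
      (((2 ^ (-β) : ℝ) : ℂ) * Complex.Gamma (1 - β) * Complex.Gamma (-α)
        / GG (-α) (-β) (sig α β z))
      (((2 ^ (α + 1) : ℝ) : ℂ) * Complex.Gamma (1 + α) * Complex.Gamma (1 - β)
        / GG α (-β) (sig α β z)) := by
  have hβ' : -1 < -β := by linarith [hβ.2]
  have h := (hasBdryRight_y₁_of_neg hα hβ' (z + β * (1 + α))).one_add_rpow_mul
    ⟨hα.1, by linarith [hα.2]⟩ hβ (isSolution_y₁ α hβ' _) fun x _ => y₂_eq_rpow_mul h0 z x
  rw [if_pos hα.2, if_pos hα.2, sig_shift_right] at h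
  have e : ((2 ^ (α + 1) : ℝ) : ℂ) = ((2 ^ β : ℝ) : ℂ) * ((2 ^ (1 + α + -β) : ℝ) : ℂ) := by
    rw [rpow_mul_rpow_cast two_pos]; ring_nf
  convert! h using 1
  · push_cast; ring_nf
  · rw [e]; push_cast; ring_nf

theorem hasBdryRight_y₂_of_pos {α β : ℝ} (hα : α ∈ Ioo (0 : ℝ) 1) (hβ : β ∈ Ioo (-1 : ℝ) 1)
    (h0 : β ≠ 0) (z : ℂ) : HasBdryRight α β (y₂ α β z)
      (-((2 ^ (α + 1) : ℝ) : ℂ) * Complex.Gamma (1 + α) * Complex.Gamma (1 - β)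
        / GG α (-β) (sig α β z))
      (((2 ^ (-β) : ℝ) : ℂ) * Complex.Gamma (1 - β) * Complex.Gamma (-α)
        / GG (-α) (-β) (sig α β z)) := by
  have hβ' : -1 < -β := by linarith [hβ.2]
  have h := (hasBdryRight_y₁_of_pos hα hβ' (z + β * (1 + α))).one_add_rpow_mul
    ⟨by linarith [hα.1], hα.2⟩ hβ (isSolution_y₁ α hβ' _) fun x _ => y₂_eq_rpow_mul h0 z x
  rw [if_neg (not_lt.2 hα.1.le), if_neg (not_lt.2 hα.1.le), sig_shift_right] at h
  have e : ((2 ^ (α + 1) : ℝ) : ℂ) = ((2 ^ β : ℝ) : ℂ) * ((2 ^ (1 + α + -β) : ℝ) : ℂ) := by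
    rw [rpow_mul_rpow_cast two_pos]; ring_nf
  convert! h using 1
  · rw [e]; push_cast; ring_nf
  · push_cast; ring_nf

theorem hasBdryRight_y₂_of_zero {β : ℝ} (hβ : β ∈ Ioo (-1 : ℝ) 1) (h0 : β ≠ 0) (z : ℂ) :
    HasBdryRight 0 β (y₂ 0 β z)
      (-(2 * Complex.Gamma (1 - β)) / GG 0 (-β) (sig 0 β z))
      (-((2 ^ (-β) : ℝ) : ℂ) * Complex.Gamma (1 - β) *
        psiRatio (aPar 0 (-β) (sig 0 β z)) (aPar 0 (-β) (-sig 0 β z))) := by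
  have hβ' : -1 < -β := by linarith [hβ.2]
  have h := (hasBdryRight_y₁_zero hβ' (z + β * (1 + (0 : ℝ)))).one_add_rpow_mul
    (by norm_num) hβ (isSolution_y₁ 0 hβ' _) fun x _ => y₂_eq_rpow_mul h0 z x
  rw [if_neg (lt_irrefl 0), if_neg (lt_irrefl 0), sig_shift_right] at h
  have e : (2 : ℂ) = ((2 ^ β : ℝ) : ℂ) * ((2 ^ (1 + -β) : ℝ) : ℂ) := by
    rw [rpow_mul_rpow_cast two_pos, show β + (1 + -β) = 1 by ring]; simp
  convert! h using 1
  · rw [e]; push_cast; ring_nf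
  · push_cast; ring_nf

/-! ### Boundary values of the logarithmic solution at `1` -/

theorem wronskian_of_eq_add {α β : ℝ} {f g h k : ℝ → ℂ} {A B : ℂ}
    (df : ∀ x ∈ Ioo (-1 : ℝ) 1, DifferentiableAt ℝ f x)
    (dg : ∀ x ∈ Ioo (-1 : ℝ) 1, DifferentiableAt ℝ g x)
    (hh : ∀ x ∈ Ioo (-1 : ℝ) 1, h x = A * f x + B * g x) {x : ℝ} (hx : x ∈ Ioo (-1 : ℝ) 1) :
    wronskian α β h k x = A * wronskian α β f k x + B * wronskian α β g k x := by
  have e : h =ᶠ[𝓝 x] fun x => A * f x + B * g x := by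
    filter_upwards [isOpen_Ioo.mem_nhds hx] with s hs using hh s hs
  have := (((df x hx).hasDerivAt.const_mul A).add
    ((dg x hx).hasDerivAt.const_mul B)).congr_of_eventuallyEq e
  simp only [wronskian, quasiDeriv]
  rw [this.deriv, hh x hx]
  ring

/-- The logarithmic connection formula read at `-x` with the two parameters exchanged. -/
theorem r₁_eq_of_beta_zero {α : ℝ} (hα : -1 < α) (z : ℂ) {x : ℝ} (hx : x ∈ Ioo (-1 : ℝ) 1) :
    r₁ α 0 z x = -Complex.Gamma (1 + α) *
      (psiRatio (aPar α 0 (sig α 0 z)) (aPar α 0 (-sig α 0 z)) * y₁ α 0 z x +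
        rGamma (aPar α 0 (sig α 0 z)) * rGamma (aPar α 0 (-sig α 0 z)) * y₂ α 0 z x) := by
  have h := y₁_zero_connection hα z (neg_mem_Ioo hx) (a := aPar α 0 (sig α 0 z))
    (b := aPar α 0 (-sig α 0 z)) (by rw [sig_comm, aPar_comm]) (by rw [sig_comm, aPar_comm])
  rw [r₁, h, r₁, r₂, neg_neg]

/-- The coefficient of the logarithmic solution along `r₂`. -/
theorem exists_y₂_zero_eq {α : ℝ} (hα : α ∈ Ioo (-1 : ℝ) 1) (z : ℂ) : ∃ A B : ℂ,
    (∀ x ∈ Ioo (-1 : ℝ) 1, y₂ α 0 z x = A * r₁ α 0 z x + B * r₂ α 0 z x) ∧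
    B * leadingCoeff 0 α = ((2 ^ (α + 1) : ℝ) : ℂ) * Complex.Gamma (1 + α) *
      psiRatio (aPar α 0 (sig α 0 z)) (aPar α 0 (-sig α 0 z)) := by
  have h0 : (0 : ℝ) ∈ Ioo (-1 : ℝ) 1 := by norm_num
  have hy := isSolution_y₂ α h0.2 z
  have hy₁ := isSolution_y₁ α h0.1 z
  obtain ⟨A, B, hAB, hw⟩ := hy.exists_eq_r hα
  refine ⟨A, B, hAB, ?_⟩
  have h1 := hw 0 h0
  -- The Wronskian of `r₁` and `y₂` computed in both systems: in that at `-1` the `y₂` term drops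
  -- out, leaving the `psiRatio` coefficient of `y₁`.
  have h2 := wronskian_of_eq_add (α := α) (β := 0) (h := r₁ α 0 z) (k := y₂ α 0 z)
    (A := -Complex.Gamma (1 + α) * psiRatio (aPar α 0 (sig α 0 z)) (aPar α 0 (-sig α 0 z)))
    (B := -Complex.Gamma (1 + α) *
      (rGamma (aPar α 0 (sig α 0 z)) * rGamma (aPar α 0 (-sig α 0 z))))
    (fun x hx => (hy₁ x hx).1) (fun x hx => (hy x hx).1)
    (fun x hx => by rw [r₁_eq_of_beta_zero hα.1 z hx]; ring) h0
  rw [wronskian_self, wronskian_y₁_y₂ α h0 z 0 h0, h1, leadingCoeff, leadingCoeff, if_pos rfl] at h2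
  rw [leadingCoeff]
  linear_combination -h2

/-- The Wronskian gives only the coefficient along `r₂`. The one along `r₁` is, up to constants, the
`r₂` coefficient for `-α`, because Euler's transformation swaps the system. -/
theorem hasBdryRight_y₂_beta_zero_of_neg {α : ℝ} (hα : α ∈ Ioo (-1 : ℝ) 0) (z : ℂ) :
    HasBdryRight α 0 (y₂ α 0 z)
      (-Complex.Gamma (-α) * psiRatio (aPar (-α) 0 (sig α 0 z)) (aPar (-α) 0 (-sig α 0 z)))
      (-((2 ^ (α + 1) : ℝ) : ℂ) * Complex.Gamma (1 + α) *
        psiRatio (aPar α 0 (sig α 0 z)) (aPar α 0 (-sig α 0 z))) := by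
  have hα' : α ∈ Ioo (-1 : ℝ) 1 := ⟨hα.1, by linarith [hα.2]⟩
  have hα'' : -α ∈ Ioo (-1 : ℝ) 1 := ⟨by linarith [hα.2], by linarith [hα.1]⟩
  have h0 : (0 : ℝ) ∈ Ioo (-1 : ℝ) 1 := by norm_num
  obtain ⟨A, B, hAB, hB⟩ := exists_y₂_zero_eq hα' z
  have k := hasBdryRight_of_eq_r hα' hAB
  obtain ⟨C, D, hCD, hD⟩ := exists_y₂_zero_eq hα'' (z + α * (1 + (0 : ℝ)))
  have k2 := (hasBdryRight_of_eq_r hα'' hCD).half_sub_rpow_mul hα' hα.2.ne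
    (isSolution_y₂ (-α) h0.2 _) (y₂_eq_euler hα' h0 z)
  have hn : ¬ (-α < 0) := by linarith [hα.2]
  simp only [if_pos hα.2, if_neg hn] at k k2
  rw [hD, sig_shift_left] at k2
  have e := (k.unique k2).1
  have hα0 : (α : ℂ) ≠ 0 := Complex.ofReal_ne_zero.2 hα.2.ne
  have g2 : Complex.Gamma (1 + (-α : ℝ)) = -α * Complex.Gamma (-α) := by
    rw [← Complex.Gamma_add_one _ (neg_ne_zero.2 hα0), add_comm]; push_cast; rfl
  have p : (2 : ℝ) ^ (-α + 1) = 2 / 2 ^ α := by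
    rw [Real.rpow_add two_pos, Real.rpow_neg zero_le_two, Real.rpow_one]; ring
  have p2 : (((2 : ℝ) ^ α : ℝ) : ℂ) ≠ 0 := Complex.ofReal_ne_zero.2 (by positivity)
  rw [e, hB] at k
  convert! k using 1
  · rw [g2, p, zero_add, Real.rpow_one]; push_cast; field_simp
  · ring

theorem hasBdryRight_y₂_beta_zero_of_pos {α : ℝ} (hα : α ∈ Ioo (0 : ℝ) 1) (z : ℂ) :
    HasBdryRight α 0 (y₂ α 0 z)
      (((2 ^ (α + 1) : ℝ) : ℂ) * Complex.Gamma (1 + α) *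
        psiRatio (aPar α 0 (sig α 0 z)) (aPar α 0 (-sig α 0 z)))
      (-Complex.Gamma (-α) *
        psiRatio (aPar (-α) 0 (sig α 0 z)) (aPar (-α) 0 (-sig α 0 z))) := by
  have hα' : α ∈ Ioo (-1 : ℝ) 1 := ⟨by linarith [hα.1], hα.2⟩
  have hα'' : -α ∈ Ioo (-1 : ℝ) 1 := ⟨by linarith [hα.2], by linarith [hα.1]⟩
  have h0 : (0 : ℝ) ∈ Ioo (-1 : ℝ) 1 := by norm_num
  obtain ⟨A, B, hAB, hB⟩ := exists_y₂_zero_eq hα' z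
  have k := hasBdryRight_of_eq_r hα' hAB
  obtain ⟨C, D, hCD, hD⟩ := exists_y₂_zero_eq hα'' (z + α * (1 + (0 : ℝ)))
  have k2 := (hasBdryRight_of_eq_r hα'' hCD).half_sub_rpow_mul hα' hα.1.ne'
    (isSolution_y₂ (-α) h0.2 _) (y₂_eq_euler hα' h0 z)
  have hn : ¬ (α < 0) := by linarith [hα.1]
  have hn' : -α < 0 := by linarith [hα.1]
  simp only [if_neg hn, if_pos hn'] at k k2
  rw [hD, sig_shift_left] at k2
  have e := (k.unique k2).2
  have hα0 : (α : ℂ) ≠ 0 := Complex.ofReal_ne_zero.2 hα.1.ne'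
  have g2 : Complex.Gamma (1 + (-α : ℝ)) = -α * Complex.Gamma (-α) := by
    rw [← Complex.Gamma_add_one _ (neg_ne_zero.2 hα0), add_comm]; push_cast; rfl
  have p : (2 : ℝ) ^ (-α + 1) = 2 / 2 ^ α := by
    rw [Real.rpow_add two_pos, Real.rpow_neg zero_le_two, Real.rpow_one]; ring
  have p2 : (((2 : ℝ) ^ α : ℝ) : ℂ) ≠ 0 := Complex.ofReal_ne_zero.2 (by positivity)
  rw [e, hB] at k
  convert! k using 1
  rw [g2, p, zero_add, Real.rpow_one]; push_cast; field_simp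

/-- Let `E` be `psiRatio` and `R = 1/(Γ(a) Γ(b))`. Then `r₁ = -(E y₁ + R y₂)`, `y₁ = -(E r₁ + R r₂)`
and `y₂ = A r₁ + E r₂` give `R A = E² - 1`. This determines `A` off the poles, and elsewhere `A` is
its limit by continuity. -/
theorem exists_hasBdryRight_y₂_zero_zero (z : ℂ) : ∃ v' : ℂ,
    HasBdryRight 0 0 (y₂ 0 0 z)
      (2 * psiRatio (aPar 0 0 (sig 0 0 z)) (aPar 0 0 (-sig 0 0 z))) v' ∧
    IsContinuedValue (fun w => NoPole 0 0 (sig 0 0 w))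
      (fun w => -GG 0 0 (sig 0 0 w) + psiSum 0 0 (sig 0 0 w) ^ 2 / GG 0 0 (sig 0 0 w)) z v' := by
  have h0 : (0 : ℝ) ∈ Ioo (-1 : ℝ) 1 := by norm_num
  set E : ℂ → ℂ := fun w => psiRatio (aPar 0 0 (sig 0 0 w)) (aPar 0 0 (-sig 0 0 w)) with hE
  have hL : leadingCoeff 0 0 = 2 := by rw [leadingCoeff, if_pos rfl]; norm_num
  have hex : ∀ w, ∃ A : ℂ, ∀ x ∈ Ioo (-1 : ℝ) 1,
      y₂ 0 0 w x = A * r₁ 0 0 w x + E w * r₂ 0 0 w x := by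
    intro w
    obtain ⟨A, B, hAB, hB⟩ := exists_y₂_zero_eq h0 w
    refine ⟨A, fun x hx => ?_⟩
    rw [hL] at hB
    have : B = E w := by
      have h2 : (((2 : ℝ) ^ ((0 : ℝ) + 1) : ℝ) : ℂ) = 2 := by norm_num
      rw [h2, Complex.ofReal_zero, add_zero, Complex.Gamma_one] at hB
      push_cast at hB
      linear_combination hB / 2
    rw [hAB x hx, this]
  choose A hA using hex
  refine ⟨A z, ?_, ?_⟩
  · have := hasBdryRight_of_eq_r h0 (hA z)
    rw [if_neg (lt_irrefl _), if_neg (lt_irrefl _), hL] at this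
    convert! this using 1
    push_cast; ring
  refine isContinuedValue_of_continuousAt (E := A) ?_ (fun w hw => ?_) (eventually_noPole 0 0 0 0 z)
  · obtain ⟨x, hx, hxz⟩ : ∃ x ∈ Ioo (-1 : ℝ) 1, y₁ 0 0 z x ≠ 0 :=
      (Filter.Eventually.and Ioo_mem_nhdsGT_neg_one
        ((tendsto_y₁_left 0 h0.1 z).eventually_ne one_ne_zero)).exists
    have hx' := neg_mem_Ioo hx
    have c1 : Continuous fun w => r₁ 0 0 w (-x) := by
      simp only [r₁, neg_neg]; exact continuous_y₁_param 0 h0.1 hx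
    have c2 : Continuous fun w => r₂ 0 0 w (-x) := by
      simp only [r₂, neg_neg]; exact continuous_y₂_zero_param 0 hx
    have c3 : Continuous fun w => y₂ 0 0 w (-x) := continuous_y₂_zero_param 0 hx'
    have hne : r₁ 0 0 z (-x) ≠ 0 := by rwa [r₁, neg_neg]
    -- At a fixed point where `r₁` does not vanish, `A` is a quotient of functions continuous in
    -- `w`.
    have hc : ContinuousAt (fun w => (y₂ 0 0 w (-x) - E w * r₂ 0 0 w (-x)) / r₁ 0 0 w (-x)) z :=
      (c3.sub ((continuous_psiRatio_sig 0 0 0 0).mul c2)).continuousAt.div c1.continuousAt hne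
    refine hc.congr ?_
    filter_upwards [c1.continuousAt.eventually_ne hne] with w hw
    rw [hA w (-x) hx']
    field_simp
    ring
  · obtain ⟨x, hx, hxz⟩ : ∃ x ∈ Ioo (-1 : ℝ) 1, y₁ 0 0 w x ≠ 0 :=
      (Filter.Eventually.and Ioo_mem_nhdsGT_neg_one
        ((tendsto_y₁_left 0 h0.1 w).eventually_ne one_ne_zero)).exists
    have hne : r₁ 0 0 w (-x) ≠ 0 := by rwa [r₁, neg_neg]
    have hG : GG 0 0 (sig 0 0 w) ≠ 0 := mul_ne_zero
      (Complex.Gamma_ne_zero fun n => (hw n).1) (Complex.Gamma_ne_zero fun n => (hw n).2)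
    have hR : rGamma (aPar 0 0 (sig 0 0 w)) * rGamma (aPar 0 0 (-sig 0 0 w)) =
        (GG 0 0 (sig 0 0 w))⁻¹ := by rw [rGamma, rGamma, GG, mul_inv]
    have e1 := r₁_eq_of_beta_zero h0.1 w (neg_mem_Ioo hx)
    have e2 := y₁_zero_connection h0.1 w (neg_mem_Ioo hx) rfl rfl
    -- Inserting `e2` and `e3` into `e1` cancels the `r₂` terms; dividing by `r₁ ≠ 0` leaves the
    -- relation for `A w`.
    have e3 := hA w (-x) (neg_mem_Ioo hx)
    have eE := psiRatio_eq hw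
    simp only [Complex.ofReal_zero, add_zero, Complex.Gamma_one] at e1 e2
    rw [hR, eE] at e1 e2
    simp only [hE] at e3
    rw [eE] at e3
    rw [e2, e3] at e1
    field_simp at e1
    have e4 : A w * GG 0 0 (sig 0 0 w) = -GG 0 0 (sig 0 0 w) ^ 2 + psiSum 0 0 (sig 0 0 w) ^ 2 :=
      mul_left_cancel₀ hne (by linear_combination e1)
    field_simp
    linear_combination -e4

theorem two_rpow_neg_sub_one (α : ℝ) :
    ((2 ^ (-α - 1) : ℝ) : ℂ) = (((2 ^ (α + 1) : ℝ) : ℂ))⁻¹ := by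
  rw [← Complex.ofReal_inv, ← Real.rpow_neg zero_le_two, neg_add, sub_eq_add_neg]

theorem isContinuedValue_const_mul_psiRatio {μ ν α β : ℝ} {f : ℂ → ℂ} (z k : ℂ)
    (hf : ∀ w, f w = k * (psiSum μ ν (sig α β w) * (GG μ ν (sig α β w))⁻¹)) :
    IsContinuedValue (fun w => NoPole μ ν (sig α β w)) f z
      (k * psiRatio (aPar μ ν (sig α β z)) (aPar μ ν (-sig α β z))) :=
  isContinuedValue_of_continuousAt
    (E := fun w => k * psiRatio (aPar μ ν (sig α β w)) (aPar μ ν (-sig α β w)))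
    (continuous_const.mul (continuous_psiRatio_sig μ ν α β)).continuousAt
    (fun w hw => by rw [psiRatio_eq hw, hf]) (eventually_noPole μ ν α β z)

end Jacobi

end

/-! ### Assembly of all boundary values -/

theorem mainTheorem4 (α β : ℝ) (hβ : β ∈ Set.Ioo (-1 : ℝ) 1) (z : ℂ) :
    -- the functions are solutions of the Jacobi equation, for every real `α`
    Jacobi.IsSolution α β z (Jacobi.y₁ α β z) ∧
    Jacobi.IsSolution α β z (Jacobi.y₂ α β z) ∧
    -- boundary values at `-1`, for every real `α`
    (β < 0 →
      Jacobi.HasBdryLeft α β (Jacobi.y₁ α β z) 1 0 ∧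
      Jacobi.HasBdryLeft α β (Jacobi.y₂ α β z) 0 ((-β * 2 ^ (α + 1) : ℝ) : ℂ)) ∧
    (β = 0 →
      Jacobi.HasBdryLeft α β (Jacobi.y₁ α β z) 0 1 ∧
      Jacobi.HasBdryLeft α β (Jacobi.y₂ α β z) ((-2 ^ (α + 1) : ℝ) : ℂ) 0) ∧
    (0 < β →
      Jacobi.HasBdryLeft α β (Jacobi.y₁ α β z) 0 1 ∧
      Jacobi.HasBdryLeft α β (Jacobi.y₂ α β z) ((β * 2 ^ (α + 1) : ℝ) : ℂ) 0) ∧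
    -- boundary values of `y₁` at `1`
    (α ∈ Set.Ioo (-1 : ℝ) 0 →
      Jacobi.HasBdryRight α β (Jacobi.y₁ α β z)
        (Complex.Gamma (1 + β) * Complex.Gamma (-α) / Jacobi.GG (-α) β (Jacobi.sig α β z))
        (((2 ^ (1 + α + β) : ℝ) : ℂ) * Complex.Gamma (1 + α) * Complex.Gamma (1 + β)
          / Jacobi.GG α β (Jacobi.sig α β z))) ∧
    (α = 0 →
      ∃ v' : ℂ,
        Jacobi.HasBdryRight α β (Jacobi.y₁ α β z)
          (-((2 ^ (1 + α + β) : ℝ) : ℂ) * Complex.Gamma (1 + α) * Complex.Gamma (1 + β)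
            / Jacobi.GG α β (Jacobi.sig α β z)) v' ∧
        Jacobi.IsContinuedValue (fun w => Jacobi.NoPole 0 β (Jacobi.sig 0 β w))
          (fun w => -Complex.Gamma (1 + β) / Jacobi.GG 0 β (Jacobi.sig 0 β w)
            * Jacobi.psiSum 0 β (Jacobi.sig 0 β w)) z v') ∧
    (α ∈ Set.Ioo (0 : ℝ) 1 →
      Jacobi.HasBdryRight α β (Jacobi.y₁ α β z)
        (-((2 ^ (1 + α + β) : ℝ) : ℂ) * Complex.Gamma (1 + α) * Complex.Gamma (1 + β)
          / Jacobi.GG α β (Jacobi.sig α β z))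
        (Complex.Gamma (1 + β) * Complex.Gamma (-α) / Jacobi.GG (-α) β (Jacobi.sig α β z))) ∧
    -- boundary values of `y₂` at `1`, for `β ≠ 0`
    (β ≠ 0 → α ∈ Set.Ioo (-1 : ℝ) 0 →
      Jacobi.HasBdryRight α β (Jacobi.y₂ α β z)
        (((2 ^ (-β) : ℝ) : ℂ) * Complex.Gamma (1 - β) * Complex.Gamma (-α)
          / Jacobi.GG (-α) (-β) (Jacobi.sig α β z))
        (((2 ^ (α + 1) : ℝ) : ℂ) * Complex.Gamma (1 + α) * Complex.Gamma (1 - β)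
          / Jacobi.GG α (-β) (Jacobi.sig α β z))) ∧
    (β ≠ 0 → α = 0 →
      ∃ v' : ℂ,
        Jacobi.HasBdryRight α β (Jacobi.y₂ α β z)
          (-((2 ^ (α + 1) : ℝ) : ℂ) * Complex.Gamma (1 + α) * Complex.Gamma (1 - β)
            / Jacobi.GG α (-β) (Jacobi.sig α β z)) v' ∧
        Jacobi.IsContinuedValue (fun w => Jacobi.NoPole 0 (-β) (Jacobi.sig 0 β w))
          (fun w => -((2 ^ (-β) : ℝ) : ℂ) * Complex.Gamma (1 - β)
            / Jacobi.GG 0 (-β) (Jacobi.sig 0 β w)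
            * Jacobi.psiSum 0 (-β) (Jacobi.sig 0 β w)) z v') ∧
    (β ≠ 0 → α ∈ Set.Ioo (0 : ℝ) 1 →
      Jacobi.HasBdryRight α β (Jacobi.y₂ α β z)
        (-((2 ^ (α + 1) : ℝ) : ℂ) * Complex.Gamma (1 + α) * Complex.Gamma (1 - β)
          / Jacobi.GG α (-β) (Jacobi.sig α β z))
        (((2 ^ (-β) : ℝ) : ℂ) * Complex.Gamma (1 - β) * Complex.Gamma (-α)
          / Jacobi.GG (-α) (-β) (Jacobi.sig α β z))) ∧
    -- boundary values of `y₂` at `1`, for `β = 0`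
    (β = 0 → α ∈ Set.Ioo (-1 : ℝ) 0 →
      ∃ v v' : ℂ,
        Jacobi.HasBdryRight α β (Jacobi.y₂ α β z) v v' ∧
        Jacobi.IsContinuedValue (fun w => Jacobi.NoPole (-α) 0 (Jacobi.sig α 0 w))
          (fun w => -Jacobi.psiSum (-α) 0 (Jacobi.sig α 0 w) * Complex.Gamma (-α)
            / Jacobi.GG (-α) 0 (Jacobi.sig α 0 w)) z v ∧
        Jacobi.IsContinuedValue (fun w => Jacobi.NoPole α 0 (Jacobi.sig α 0 w))
          (fun w => Jacobi.psiSum α 0 (Jacobi.sig α 0 w) * Complex.Gamma (1 + α)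
            / (-((2 ^ (-α - 1) : ℝ) : ℂ) * Jacobi.GG α 0 (Jacobi.sig α 0 w))) z v') ∧
    (β = 0 → α = 0 →
      ∃ v v' : ℂ,
        Jacobi.HasBdryRight α β (Jacobi.y₂ α β z) v v' ∧
        Jacobi.IsContinuedValue (fun w => Jacobi.NoPole α 0 (Jacobi.sig α 0 w))
          (fun w => Jacobi.psiSum α 0 (Jacobi.sig α 0 w) * Complex.Gamma (1 + α)
            / (((2 ^ (-α - 1) : ℝ) : ℂ) * Jacobi.GG α 0 (Jacobi.sig α 0 w))) z v ∧
        Jacobi.IsContinuedValue (fun w => Jacobi.NoPole 0 0 (Jacobi.sig 0 0 w))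
          (fun w => -Jacobi.GG 0 0 (Jacobi.sig 0 0 w)
            + Jacobi.psiSum 0 0 (Jacobi.sig 0 0 w) ^ 2
              / Jacobi.GG 0 0 (Jacobi.sig 0 0 w)) z v') ∧
    (β = 0 → α ∈ Set.Ioo (0 : ℝ) 1 →
      ∃ v v' : ℂ,
        Jacobi.HasBdryRight α β (Jacobi.y₂ α β z) v v' ∧
        Jacobi.IsContinuedValue (fun w => Jacobi.NoPole α 0 (Jacobi.sig α 0 w))
          (fun w => Jacobi.psiSum α 0 (Jacobi.sig α 0 w) * Complex.Gamma (1 + α)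
            / (((2 ^ (-α - 1) : ℝ) : ℂ) * Jacobi.GG α 0 (Jacobi.sig α 0 w))) z v ∧
        Jacobi.IsContinuedValue (fun w => Jacobi.NoPole (-α) 0 (Jacobi.sig α 0 w))
          (fun w => -Jacobi.psiSum (-α) 0 (Jacobi.sig α 0 w) * Complex.Gamma (-α)
            / Jacobi.GG (-α) 0 (Jacobi.sig α 0 w)) z v') := by
  refine ⟨Jacobi.isSolution_y₁ α hβ.1 z, Jacobi.isSolution_y₂ α hβ.2 z,
    fun h => ⟨Jacobi.hasBdryLeft_y₁_of_neg α hβ.1 h z, Jacobi.hasBdryLeft_y₂_of_neg α h z⟩,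
    ?_, fun h => ⟨Jacobi.hasBdryLeft_y₁_of_nonneg α h.le z,
      Jacobi.hasBdryLeft_y₂_of_pos α h hβ.2 z⟩,
    fun h => Jacobi.hasBdryRight_y₁_of_neg h hβ.1 z, ?_,
    fun h => Jacobi.hasBdryRight_y₁_of_pos h hβ.1 z,
    fun h0 h => Jacobi.hasBdryRight_y₂_of_neg h hβ h0 z, ?_,
    fun h0 h => Jacobi.hasBdryRight_y₂_of_pos h hβ h0 z, ?_, ?_, ?_⟩
  · rintro rfl
    exact ⟨Jacobi.hasBdryLeft_y₁_of_nonneg α le_rfl z, Jacobi.hasBdryLeft_y₂_zero α z⟩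
  · rintro rfl
    refine ⟨-Complex.Gamma (1 + β) *
      Jacobi.psiRatio (Jacobi.aPar 0 β (Jacobi.sig 0 β z)) (Jacobi.aPar 0 β (-Jacobi.sig 0 β z)),
      ?_, Jacobi.isContinuedValue_const_mul_psiRatio z _ fun w => ?_⟩
    · convert! Jacobi.hasBdryRight_y₁_zero hβ.1 z using 1
      simp
    · ring
  · rintro h0 rfl
    refine ⟨-((2 ^ (-β) : ℝ) : ℂ) * Complex.Gamma (1 - β) *
      Jacobi.psiRatio (Jacobi.aPar 0 (-β) (Jacobi.sig 0 β z))
        (Jacobi.aPar 0 (-β) (-Jacobi.sig 0 β z)),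
      ?_, Jacobi.isContinuedValue_const_mul_psiRatio z _ fun w => ?_⟩
    · convert! Jacobi.hasBdryRight_y₂_of_zero hβ h0 z using 1
      simp
    · ring
  · rintro rfl h
    refine ⟨_, _, Jacobi.hasBdryRight_y₂_beta_zero_of_neg h z,
      Jacobi.isContinuedValue_const_mul_psiRatio z _ fun w => ?_,
      Jacobi.isContinuedValue_const_mul_psiRatio z _ fun w => ?_⟩
    · ring
    · rw [Jacobi.two_rpow_neg_sub_one, div_eq_mul_inv, neg_mul, inv_neg, mul_inv, inv_inv]
      ring
  · rintro rfl rfl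
    obtain ⟨v', h, hv⟩ := Jacobi.exists_hasBdryRight_y₂_zero_zero z
    refine ⟨_, v', h, Jacobi.isContinuedValue_const_mul_psiRatio z _ fun w => ?_, hv⟩
    rw [Jacobi.two_rpow_neg_sub_one, div_eq_mul_inv, mul_inv, inv_inv]
    simp
    ring
  · rintro rfl h
    refine ⟨_, _, Jacobi.hasBdryRight_y₂_beta_zero_of_pos h z,
      Jacobi.isContinuedValue_const_mul_psiRatio z _ fun w => ?_,
      Jacobi.isContinuedValue_const_mul_psiRatio z _ fun w => ?_⟩
    · rw [Jacobi.two_rpow_neg_sub_one, div_eq_mul_inv, mul_inv, inv_inv]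
      ring
    · ring
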